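/- Let $d\ge 2$, let $\Omega\subset\mathbb R^d$ be a bounded open set, let $\mathfrak D\subset\partial\Omega$ be closed, let $T>0$ and $J=(0,T)$. **Spaces.** Let $W^{1,2}_{\mathfrak D}$ be the completion of $\{\psi|_\Omega:\psi\in C_c^\infty(\mathbb R^d),\ \operatorname{supp}\psi\cap\mathfrak D=\emptyset\}$ (complex-valued functions) for the norm $\bigl(\int_\Omega|\nabla\psi|^2+|\psi|^2\bigr)^{1/2}$, and let $W^{-1,2}_{\mathfrak D}$ be the space of continuous antilinear functionals on $W^{1,2}_{\mathfrak D}$; the former is embedded in the latter through the $L^2(\Omega)$ scalar product. Let $\mathcal J:W^{1,2}_{\mathfrak D}\to W^{-1,2}_{\mathfrak D}$ be the duality map, $\langle\mathcal J\psi,\varphi\rangle=(\psi,\varphi)_{W^{1,2}_{\mathfrak D}}$. For $r\in(1,\infty)$ let $\mathrm{MR}^r_0=\{u\in L^r(J;W^{1,2}_{\mathfrak D}):u'\in L^r(J;W^{-1,2}_{\mathfrak D}),\ u(0)=0\}$ with norm $\|u\|_{L^r(J;W^{1,2}_{\mathfrak D})}+\|u'\|_{L^r(J;W^{-1,2}_{\mathfrak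 D})}$, where $u'$ is the distributional derivative, and let $(\mathrm{MR}^r_0)^{\sim}$ be the same space with the norm $\|(\tfrac{\partial}{\partial t}+\mathcal J)u\|_{L^r(J;W^{-1,2}_{\mathfrak D})}$. **Operators.** For $c_\bullet,c^\bullet>0$ let $\mathcal E(c_\bullet,c^\bullet)$ be the set of measurable $\mu:\Omega\to\mathbb R^{d\times d}$ with $\operatorname{Re}(\mu(x)\xi,\xi)_{\mathbb C^d}\ge c_\bullet|\xi|^2$ and $\|\mu(x)\|_{\mathcal L(\mathbb C^d)}\le c^\bullet$ for all $\xi\in\mathbb C^d$ and almost all $x\in\Omega$. For such $\mu$ define $\mathcal A_2(\mu):W^{1,2}_{\mathfrak D}\to W^{-1,2}_{\mathfrak D}$ by $\langle\mathcal A_2(\mu)\psi,\varphi\rangle=\int_\Omega\mu\nabla\psi\cdot\overline{\nabla\varphi}$. A map $\mu:J\to\mathcal E(c_\bullet,c^\bullet)$, $t\mapsto\mu_t$, is called $L^1$-measurable if it is measurable as a map into $L^1(\Omega;\mathbb R^{d\times d})$. A bounded, strongly measurable family $\{\mathcal A(t)\}_{t\in J}$ of bounded operators $W^{1,2}_{\mathfrak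 D}\to W^{-1,2}_{\mathfrak D}$, each closed as an operator in $W^{-1,2}_{\mathfrak D}$, has maximal $L^r(J;W^{-1,2}_{\mathfrak D})$-regularity if for every $f\in L^r(J;W^{-1,2}_{\mathfrak D})$ there is a unique $u\in\mathrm{MR}^r_0$ with $u'(t)+\mathcal A(t)u(t)=f(t)$ for almost all $t\in J$; the map $f\mapsto u$ is denoted by $(\tfrac{\partial}{\partial t}+\mathcal A(\cdot))^{-1}$. **Theorem.** Let $0<c_\bullet\le 1\le c^\bullet<\infty$ and $s\in(2,\infty)$. Then $\tfrac{\partial}{\partial t}+\mathcal J:\mathrm{MR}^r_0\to L^r(J;W^{-1,2}_{\mathfrak D})$ is boundedly invertible for $r\in\{s,s'\}$, where $\frac1s+\frac1{s'}=1$. Put $$C_{\mathcal J,s}=\max_{r\in\{s,s'\}}\Bigl\|\bigl(\tfrac{\partial}{\partial t}+\mathcal J\bigr)^{-1}\Bigr\|_{L^r(J;W^{-1,2}_{\mathfrak D})\to\mathrm{MR}^r_0},\qquad \kappa_s=\frac1{12}\,\frac{1}{1+2\bigl(1+\frac{1+c_\bullet+c^\bullet}{c_\bullet}\bigr)\max(1,c^\bullet)\,C_{\mathcal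 J,s}},$$ $$r_0=\Bigl(\tfrac12-\kappa_s\bigl(1-\tfrac2s\bigr)\Bigr)^{-1}.$$ Then $r_0>2$, and for every $L^1$-measurable $\mu:J\to\mathcal E(c_\bullet,c^\bullet)$ and every $r\in(r_0',r_0)$, where $\frac1{r_0}+\frac1{r_0'}=1$, the family $\{\mathcal A_2(\mu_t)+I\}_{t\in J}$ has maximal $L^r(J;W^{-1,2}_{\mathfrak D})$-regularity and $$\Bigl\|\bigl(\tfrac{\partial}{\partial t}+\mathcal A_2(\mu(\cdot))+I\bigr)^{-1}\Bigr\|_{L^r(J;W^{-1,2}_{\mathfrak D})\to(\mathrm{MR}^r_0)^{\sim}}\le 8\,\frac{1+c_\bullet+c^\bullet}{c_\bullet}.$$ -/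

import Mathlib

open MeasureTheory Set
open scoped ENNReal ContDiff ComplexConjugate InnerProductSpace

noncomputable section

namespace MaxReg

/-! ### Sobolev space with partially vanishing trace, its antidual, and the elliptic operators -/

/-- The point space `ℝ^d`. -/
abbrev Pt (d : ℕ) : Type := EuclideanSpace ℝ (Fin d)

/-- The space `ℂ^d` of values of gradients. -/
abbrev Vec (d : ℕ) : Type := EuclideanSpace ℂ (Fin d)

/-- The gradient `(∂₁ψ, …, ∂_dψ)` of a complex valued function on `ℝ^d`. -/
def grad {d : ℕ} (ψ : Pt d → ℂ) (x : Pt d) : Vec d :=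
  WithLp.toLp 2 fun i => fderiv ℝ ψ x (EuclideanSpace.single i 1)

/-- `ψ ∈ C_c^∞(ℝ^d)` (complex valued) and `supp ψ ∩ D = ∅`. -/
structure IsTestFun {d : ℕ} (D : Set (Pt d)) (ψ : Pt d → ℂ) : Prop where
  smooth : ContDiff ℝ ∞ ψ
  compact : HasCompactSupport ψ
  disjoint : Disjoint (tsupport ψ) D

/-- `L²(Ω; ℂ) × L²(Ω; ℂ^d)` with the Hilbert norm `(‖ψ‖² + ‖g‖²)^{1/2}`. -/
abbrev L2Pair {d : ℕ} (Ω : Set (Pt d)) : Type :=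
  WithLp 2 (Lp ℂ 2 (volume.restrict Ω) × Lp (Vec d) 2 (volume.restrict Ω))

lemma grad_add {d : ℕ} {ψ φ : Pt d → ℂ} (hψ : ContDiff ℝ ∞ ψ) (hφ : ContDiff ℝ ∞ φ) (x : Pt d) :
    grad (ψ + φ) x = grad ψ x + grad φ x := by
  ext i
  simp [grad, fderiv_add (hψ.differentiable (by simp) x) (hφ.differentiable (by simp) x)]

lemma grad_smul {d : ℕ} {ψ : Pt d → ℂ} (c : ℂ) (hψ : ContDiff ℝ ∞ ψ) (x : Pt d) :
    grad (c • ψ) x = c • grad ψ x := by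
  ext i
  simp [grad, fderiv_const_smul (hψ.differentiable (by simp) x) c]

/-- The pairs `(ψ|_Ω, (∇ψ)|_Ω)`, where `ψ ∈ C_c^∞(ℝ^d)` and `supp ψ ∩ D = ∅`. -/
def testPairs {d : ℕ} (Ω D : Set (Pt d)) : Submodule ℂ (L2Pair Ω) where
  carrier := {p | ∃ ψ : Pt d → ℂ, IsTestFun D ψ ∧
    p.fst =ᵐ[volume.restrict Ω] ψ ∧ p.snd =ᵐ[volume.restrict Ω] grad ψ}
  zero_mem' := by
    refine ⟨0, ⟨contDiff_const, HasCompactSupport.zero, by simp [tsupport]⟩, ?_, ?_⟩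
    · exact Lp.coeFn_zero _ _ _
    · have h : grad (0 : Pt d → ℂ) = 0 := by
        funext x; ext i; simp [grad]
      rw [h]
      exact Lp.coeFn_zero _ _ _
  add_mem' := by
    rintro p q ⟨ψ, hψ, h1, h2⟩ ⟨φ, hφ, k1, k2⟩
    refine ⟨ψ + φ, ⟨hψ.smooth.add hφ.smooth, hψ.compact.add hφ.compact, ?_⟩, ?_, ?_⟩
    · exact (hψ.disjoint.union_left hφ.disjoint).mono_left (tsupport_add ψ φ)
    · exact (Lp.coeFn_add _ _).trans (h1.add k1)
    · refine (Lp.coeFn_add _ _).trans ((h2.add k2).trans ?_)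
      exact Filter.Eventually.of_forall fun x => (grad_add hψ.smooth hφ.smooth x).symm
  smul_mem' := by
    rintro c p ⟨ψ, hψ, h1, h2⟩
    refine ⟨c • ψ, ⟨hψ.smooth.const_smul c, ?_, ?_⟩, ?_, ?_⟩
    · exact hψ.compact.mono (Function.support_const_smul_subset c ψ)
    · exact hψ.disjoint.mono_left (closure_mono (Function.support_const_smul_subset c ψ))
    · exact (Lp.coeFn_smul _ _).trans (h1.const_smul c)
    · refine (Lp.coeFn_smul _ _).trans ((h2.const_smul c).trans ?_)
      exact Filter.Eventually.of_forall fun x => (grad_smul c hψ.smooth x).symm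

/-- `W^{1,2}_D(Ω)`: the completion of `C^∞_D(Ω)` for the norm `(∫_Ω |∇ψ|² + |ψ|²)^{1/2}`, realised
as the closure of the pairs `(ψ, ∇ψ)` in `L²(Ω; ℂ) × L²(Ω; ℂ^d)`. -/
def W {d : ℕ} (Ω D : Set (Pt d)) : Type := ↥(testPairs Ω D).topologicalClosure

instance {d : ℕ} (Ω D : Set (Pt d)) : NormedAddCommGroup (W Ω D) :=
  inferInstanceAs (NormedAddCommGroup ↥(testPairs Ω D).topologicalClosure)

instance {d : ℕ} (Ω D : Set (Pt d)) : InnerProductSpace ℂ (W Ω D) :=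
  inferInstanceAs (InnerProductSpace ℂ ↥(testPairs Ω D).topologicalClosure)

/-- The inclusion of `W^{1,2}_D(Ω)` in `L²(Ω; ℂ) × L²(Ω; ℂ^d)`, `ψ ↦ (ψ, ∇ψ)`. -/
def toPair {d : ℕ} (Ω D : Set (Pt d)) : W Ω D →L[ℂ] L2Pair Ω :=
  (testPairs Ω D).topologicalClosure.subtypeL

/-- `W^{-1,2}_D(Ω)`: the continuous antilinear functionals on `W^{1,2}_D(Ω)`. -/
abbrev WDual {d : ℕ} (Ω D : Set (Pt d)) : Type := W Ω D →L⋆[ℂ] ℂ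

/-- The function in `L²(Ω)` underlying an element of `W^{1,2}_D(Ω)`. -/
def toL2 {d : ℕ} (Ω D : Set (Pt d)) : W Ω D →L[ℂ] Lp ℂ 2 (volume.restrict Ω) :=
  (WithLp.fstL 2 ℂ _ _).comp (toPair Ω D)

/-- The (weak) gradient in `L²(Ω; ℂ^d)` of an element of `W^{1,2}_D(Ω)`. -/
def wgrad {d : ℕ} (Ω D : Set (Pt d)) : W Ω D →L[ℂ] Lp (Vec d) 2 (volume.restrict Ω) :=
  (WithLp.sndL 2 ℂ _ _).comp (toPair Ω D)

/-- The embedding `W^{1,2}_D → W^{-1,2}_D` through the `L²` scalar product,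
`⟨ψ, φ⟩ = ∫_Ω ψ conj(φ)`. (Mathlib's inner product is antilinear in its first argument.) -/
def embed {d : ℕ} (Ω D : Set (Pt d)) : W Ω D →L[ℂ] WDual Ω D :=
  LinearMap.mkContinuous₂
    (LinearMap.mk₂'ₛₗ (RingHom.id ℂ) (starRingEnd ℂ)
      (fun ψ φ => ⟪toL2 Ω D φ, toL2 Ω D ψ⟫_ℂ)
      (fun _ _ _ => by simp [inner_add_right])
      (fun _ _ _ => by simp [inner_smul_right])
      (fun _ _ _ => by simp [inner_add_left])
      (fun _ _ _ => by simp [inner_smul_left]))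
    (‖toL2 Ω D‖ * ‖toL2 Ω D‖) (by
      intro ψ φ
      calc ‖⟪toL2 Ω D φ, toL2 Ω D ψ⟫_ℂ‖ ≤ ‖toL2 Ω D φ‖ * ‖toL2 Ω D ψ‖ := norm_inner_le_norm _ _
        _ ≤ (‖toL2 Ω D‖ * ‖φ‖) * (‖toL2 Ω D‖ * ‖ψ‖) := by
          gcongr <;> exact ContinuousLinearMap.le_opNorm _ _
        _ = _ := by ring)

/-- The duality map `𝒥 : W^{1,2}_D → W^{-1,2}_D`, `⟨𝒥 ψ, φ⟩ = (ψ, φ)_{W^{1,2}_D}`. -/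
def dualityMap {d : ℕ} (Ω D : Set (Pt d)) : W Ω D →L[ℂ] WDual Ω D :=
  innerSLFlip ℂ

/-- A real matrix acting on `ℂ^d`. -/
def cplx {d : ℕ} (M : Matrix (Fin d) (Fin d) ℝ) : Vec d →L[ℂ] Vec d :=
  Matrix.toEuclideanCLM (n := Fin d) (𝕜 := ℂ) (M.map ((↑) : ℝ → ℂ))

/-- The class `𝓔(c_•, c^•)` of measurable coefficient functions `μ : Ω → ℝ^{d×d}` with
`Re (μ(x) ξ, ξ) ≥ c_• |ξ|²` and `‖μ(x)‖ ≤ c^•` for all `ξ ∈ ℂ^d` and almost all `x ∈ Ω`.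
The values of `μ` outside `Ω` play no role. -/
structure IsElliptic {d : ℕ} (Ω : Set (Pt d)) (cl cu : ℝ)
    (μ : Pt d → Matrix (Fin d) (Fin d) ℝ) : Prop where
  measurable : ∀ i j, AEMeasurable (fun x => μ x i j) (volume.restrict Ω)
  coercive : ∀ᵐ x ∂(volume.restrict Ω), ∀ ξ : Vec d,
    cl * ‖ξ‖ ^ 2 ≤ RCLike.re ⟪ξ, cplx (μ x) ξ⟫_ℂ
  bounded : ∀ᵐ x ∂(volume.restrict Ω), ‖cplx (μ x)‖ ≤ cu

/-- The set `𝓔(c_•, c^•)` as a type. -/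
abbrev Coeff {d : ℕ} (Ω : Set (Pt d)) (cl cu : ℝ) : Type :=
  {μ : Pt d → Matrix (Fin d) (Fin d) ℝ // IsElliptic Ω cl cu μ}

lemma Coeff.memLp {d : ℕ} {Ω : Set (Pt d)} {cl cu : ℝ} (μ : Coeff Ω cl cu)
    (g : Lp (Vec d) 2 (volume.restrict Ω)) :
    MemLp (fun x => cplx (μ.1 x) (g x)) 2 (volume.restrict Ω) := by
  have hg : AEMeasurable (fun x => g x) (volume.restrict Ω) :=
    (Lp.aestronglyMeasurable g).aemeasurable
  have hm : AEStronglyMeasurable (fun x => cplx (μ.1 x) (g x)) (volume.restrict Ω) := by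
    have h1 : AEMeasurable (fun x => fun i : Fin d => (cplx (μ.1 x) (g x)) i)
        (volume.restrict Ω) := by
      refine aemeasurable_pi_lambda _ fun i => ?_
      have h2 : (fun x => (cplx (μ.1 x) (g x)) i)
          = fun x => ∑ j, ((μ.1 x i j : ℝ) : ℂ) * (g x) j := by
        funext x
        simp [cplx, Matrix.mulVec, dotProduct]
      rw [h2]
      refine Finset.aemeasurable_fun_sum _ fun j _ => ?_
      refine (Complex.measurable_ofReal.comp_aemeasurable (μ.2.measurable i j)).mul ?_
      exact (EuclideanSpace.proj (𝕜 := ℂ) j).continuous.measurable.comp_aemeasurable hg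
    have h3 := (PiLp.continuous_toLp 2 (fun _ : Fin d => ℂ)).measurable.comp_aemeasurable h1
    exact h3.aestronglyMeasurable
  refine MemLp.of_le_mul (c := cu) (Lp.memLp g) hm ?_
  filter_upwards [μ.2.bounded] with x hx
  exact (ContinuousLinearMap.le_opNorm _ _).trans
    (mul_le_mul_of_nonneg_right hx (norm_nonneg _))

lemma Coeff.integral_eq_inner {d : ℕ} {Ω : Set (Pt d)} {cl cu : ℝ} (μ : Coeff Ω cl cu)
    (g h : Lp (Vec d) 2 (volume.restrict Ω)) :
    ∫ x in Ω, ⟪h x, cplx (μ.1 x) (g x)⟫_ℂ = ⟪h, (μ.memLp g).toLp⟫_ℂ := by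
  rw [L2.inner_def]
  refine integral_congr_ae ?_
  filter_upwards [(μ.memLp g).coeFn_toLp] with x hx
  rw [hx]

lemma Coeff.integral_bound {d : ℕ} {Ω : Set (Pt d)} {cl cu : ℝ} (μ : Coeff Ω cl cu)
    (g h : Lp (Vec d) 2 (volume.restrict Ω)) :
    ‖∫ x in Ω, ⟪h x, cplx (μ.1 x) (g x)⟫_ℂ‖ ≤ |cu| * ‖g‖ * ‖h‖ := by
  rw [μ.integral_eq_inner]
  refine (norm_inner_le_norm _ _).trans ?_
  have : ‖(μ.memLp g).toLp‖ ≤ |cu| * ‖g‖ := by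
    refine Lp.norm_le_mul_norm_of_ae_le_mul ?_
    filter_upwards [(μ.memLp g).coeFn_toLp, μ.2.bounded] with x hx hb
    rw [hx]
    exact (ContinuousLinearMap.le_opNorm _ _).trans
      (mul_le_mul_of_nonneg_right (hb.trans (le_abs_self _)) (norm_nonneg _))
  calc ‖h‖ * ‖(μ.memLp g).toLp‖ ≤ ‖h‖ * (|cu| * ‖g‖) := by gcongr
    _ = _ := by ring

lemma Coeff.toLp_add {d : ℕ} {Ω : Set (Pt d)} {cl cu : ℝ} (μ : Coeff Ω cl cu)
    (g h : Lp (Vec d) 2 (volume.restrict Ω)) :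
    (μ.memLp (g + h)).toLp = (μ.memLp g).toLp + (μ.memLp h).toLp := by
  rw [← MemLp.toLp_add]
  refine MemLp.toLp_congr _ _ ?_
  filter_upwards [Lp.coeFn_add g h] with x hx
  rw [hx, Pi.add_apply, map_add, Pi.add_apply]

lemma Coeff.toLp_smul {d : ℕ} {Ω : Set (Pt d)} {cl cu : ℝ} (μ : Coeff Ω cl cu) (c : ℂ)
    (g : Lp (Vec d) 2 (volume.restrict Ω)) :
    (μ.memLp (c • g)).toLp = c • (μ.memLp g).toLp := by
  rw [← MemLp.toLp_const_smul]
  refine MemLp.toLp_congr _ _ ?_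
  filter_upwards [Lp.coeFn_smul c g] with x hx
  rw [hx, Pi.smul_apply, map_smul, Pi.smul_apply]

/-- The operator `𝒜₂(μ) : W^{1,2}_D → W^{-1,2}_D`, `⟨𝒜₂(μ) ψ, φ⟩ = ∫_Ω μ ∇ψ · conj(∇φ)`. -/
def ellipticOp {d : ℕ} {Ω : Set (Pt d)} (D : Set (Pt d)) {cl cu : ℝ} (μ : Coeff Ω cl cu) :
    W Ω D →L[ℂ] WDual Ω D :=
  LinearMap.mkContinuous₂
    (LinearMap.mk₂'ₛₗ (RingHom.id ℂ) (starRingEnd ℂ)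
      (fun ψ φ => ∫ x in Ω, ⟪wgrad Ω D φ x, cplx (μ.1 x) (wgrad Ω D ψ x)⟫_ℂ)
      (fun _ _ _ => by simp only [μ.integral_eq_inner, map_add, μ.toLp_add, inner_add_right])
      (fun _ _ _ => by
        simp only [μ.integral_eq_inner, map_smul, μ.toLp_smul, inner_smul_right]; rfl)
      (fun _ _ _ => by simp only [μ.integral_eq_inner, map_add, inner_add_left])
      (fun _ _ _ => by simp only [μ.integral_eq_inner, map_smul, inner_smul_left]; rfl))
    (|cu| * ‖wgrad Ω D‖ * ‖wgrad Ω D‖) (by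
      intro ψ φ
      calc _ ≤ |cu| * ‖wgrad Ω D ψ‖ * ‖wgrad Ω D φ‖ := μ.integral_bound _ _
        _ ≤ |cu| * (‖wgrad Ω D‖ * ‖ψ‖) * (‖wgrad Ω D‖ * ‖φ‖) := by
          gcongr <;> exact ContinuousLinearMap.le_opNorm _ _
        _ = _ := by ring)

/-! ### Vector valued function spaces on `J = (0, T)` and maximal parabolic regularity -/

/-- Integrability exponents `r ∈ (1, ∞)`. -/
abbrev Expo : Type := {r : ℝ // 1 < r}

instance (r : Expo) : Fact (1 ≤ ENNReal.ofReal r.1) :=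
  ⟨by simpa using ENNReal.ofReal_le_ofReal r.2.le⟩

/-- The conjugate exponent `r' = r / (r - 1)`. -/
def Expo.conj (r : Expo) : Expo :=
  ⟨r.1.conjExponent, by
    have h : 0 < r.1 - 1 := by linarith [r.2]
    rw [Real.conjExponent, lt_div_iff₀ h]; linarith⟩

/-- Lebesgue measure on `J = (0, T)`. -/
abbrev volJ (T : ℝ) : Measure ℝ := volume.restrict (Ioo 0 T)

/-- The Bochner space `L^r(J; X)`. -/
abbrev LJ (T : ℝ) (r : Expo) (X : Type*) [NormedAddCommGroup X] : Type _ :=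
  Lp X (ENNReal.ofReal r.1) (volJ T)

section Abstract

variable {V X : Type*} [NormedAddCommGroup V] [NormedSpace ℂ V]
  [NormedAddCommGroup X] [NormedSpace ℂ X]

/-- `v` is the derivative of `u` on `J = (0, T)` in the sense of `X`-valued distributions. -/
def IsDistribDeriv (T : ℝ) (u v : ℝ → X) : Prop :=
  ∀ φ : ℝ → ℝ, ContDiff ℝ ∞ φ → HasCompactSupport φ → tsupport φ ⊆ Ioo 0 T →
    ∫ t in Ioo 0 T, deriv φ t • u t = - ∫ t in Ioo 0 T, φ t • v t

/-- `u(0) = 0`: the continuous representative of `u` on `[0, T]` vanishes at `0`. -/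
def VanishesAtZero (T : ℝ) (u : ℝ → X) : Prop :=
  ∃ w : ℝ → X, ContinuousOn w (Icc 0 T) ∧ w =ᵐ[volJ T] u ∧ w 0 = 0

lemma integrable_mul {T : ℝ} {r : Expo} (u : LJ T r X) {φ : ℝ → ℝ} (hφ : Continuous φ)
    (hc : HasCompactSupport φ) : Integrable (fun t => φ t • u t) (volJ T) := by
  have hu : Integrable (fun t => u t) (volJ T) :=
    (Lp.memLp u).integrable (Fact.out (p := 1 ≤ ENNReal.ofReal r.1))
  obtain ⟨C, hC⟩ := hc.exists_bound_of_continuous hφ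
  exact hu.bdd_smul (𝕜 := ℝ) C hφ.aestronglyMeasurable (Filter.Eventually.of_forall hC)

lemma IsDistribDeriv.congr {T : ℝ} {u v u' v' : ℝ → X} (h : IsDistribDeriv T u v)
    (hu : u' =ᵐ[volJ T] u) (hv : v' =ᵐ[volJ T] v) : IsDistribDeriv T u' v' := by
  intro φ h1 h2 h3
  have e1 : ∫ t in Ioo 0 T, deriv φ t • u' t = ∫ t in Ioo 0 T, deriv φ t • u t :=
    integral_congr_ae (by filter_upwards [hu] with t ht; rw [ht])
  have e2 : ∫ t in Ioo 0 T, φ t • v' t = ∫ t in Ioo 0 T, φ t • v t :=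
    integral_congr_ae (by filter_upwards [hv] with t ht; rw [ht])
  rw [e1, e2, h φ h1 h2 h3]

/-- The space `MR^r_0(J; V, X) = L^r(J; V) ∩ W^{1,r}_0(J; X)` with the norm
`‖u‖_{L^r(J; V)} + ‖u'‖_{L^r(J; X)}`, as the space of the pairs `(u, u')` in the `ℓ¹`-product.
Here `V` is a subspace of `X` through `e : V → X`. -/
def MR (T : ℝ) (r : Expo) (e : V →L[ℂ] X) :
    Submodule ℂ (WithLp 1 (LJ T r V × LJ T r X)) where
  carrier := {p | IsDistribDeriv T (fun t => e (p.fst t)) p.snd ∧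
    VanishesAtZero T (fun t => e (p.fst t))}
  zero_mem' := by
    have h : (fun t => e ((0 : LJ T r V) t)) =ᵐ[volJ T] fun _ => 0 := by
      filter_upwards [Lp.coeFn_zero V (ENNReal.ofReal r.1) (volJ T)] with t ht
      rw [ht, Pi.zero_apply, map_zero]
    refine ⟨IsDistribDeriv.congr (u := fun _ => 0) (v := fun _ => 0) ?_ h
      (Lp.coeFn_zero X (ENNReal.ofReal r.1) (volJ T)), ?_⟩
    · intro φ _ _ _
      simp
    · exact ⟨fun _ => 0, continuousOn_const, h.symm, rfl⟩
  add_mem' := by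
    rintro p q ⟨hp, wp, cp, ap, zp⟩ ⟨hq, wq, cq, aq, zq⟩
    have h : (fun t => e ((p.fst + q.fst : LJ T r V) t)) =ᵐ[volJ T]
        fun t => e (p.fst t) + e (q.fst t) := by
      filter_upwards [Lp.coeFn_add p.fst q.fst] with t ht
      rw [ht, Pi.add_apply, map_add]
    refine ⟨IsDistribDeriv.congr ?_ h (Lp.coeFn_add p.snd q.snd), ?_⟩
    · intro φ h1 h2 h3
      have hd : Continuous (deriv φ) := h1.continuous_deriv (by simp)
      have i1 := integrable_mul (e.compLp p.fst) hd h2.deriv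
      have i2 := integrable_mul (e.compLp q.fst) hd h2.deriv
      have j1 : Integrable (fun t => deriv φ t • e (p.fst t)) (volJ T) := by
        refine i1.congr ?_
        filter_upwards [e.coeFn_compLp p.fst] with t ht
        rw [ht]
      have j2 : Integrable (fun t => deriv φ t • e (q.fst t)) (volJ T) := by
        refine i2.congr ?_
        filter_upwards [e.coeFn_compLp q.fst] with t ht
        rw [ht]
      have k1 := integrable_mul p.snd h1.continuous h2
      have k2 := integrable_mul q.snd h1.continuous h2
      simp only [Pi.add_apply, smul_add]
      rw [integral_add j1 j2, integral_add k1 k2, hp φ h1 h2 h3, hq φ h1 h2 h3]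
      abel
    · exact ⟨wp + wq, cp.add cq, (ap.add aq).trans h.symm, by simp [zp, zq]⟩
  smul_mem' := by
    rintro c p ⟨hp, wp, cp, ap, zp⟩
    have h : (fun t => e ((c • p.fst : LJ T r V) t)) =ᵐ[volJ T] fun t => c • e (p.fst t) := by
      filter_upwards [Lp.coeFn_smul c p.fst] with t ht
      rw [ht, Pi.smul_apply, map_smul]
    refine ⟨IsDistribDeriv.congr ?_ h (Lp.coeFn_smul c p.snd), ?_⟩
    · intro φ h1 h2 h3
      simp only [Pi.smul_apply, smul_comm _ c]
      rw [integral_smul, integral_smul, hp φ h1 h2 h3, smul_neg]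
    · exact ⟨c • wp, cp.const_smul c, (ap.const_smul c).trans h.symm, by simp [zp]⟩

/-- `u ∈ L^r(J; V)` for `u ∈ MR^r_0(J; V, X)`. -/
def MR.val {T : ℝ} {r : Expo} {e : V →L[ℂ] X} (u : MR T r e) : LJ T r V := u.1.fst

/-- `u' ∈ L^r(J; X)` for `u ∈ MR^r_0(J; V, X)`. -/
def MR.der {T : ℝ} {r : Expo} {e : V →L[ℂ] X} (u : MR T r e) : LJ T r X := u.1.snd

/-- The bounded operator `∂/∂t + K : MR^r_0(J; V, X) → L^r(J; X)` for one fixed `K : V → X`. -/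
def parabolicOp (T : ℝ) (r : Expo) (e K : V →L[ℂ] X) : MR T r e →L[ℂ] LJ T r X :=
  (WithLp.sndL 1 ℂ (LJ T r V) (LJ T r X)
    + (K.compLpL (ENNReal.ofReal r.1) (volJ T)).comp (WithLp.fstL 1 ℂ (LJ T r V) (LJ T r X))).comp
    (MR T r e).subtypeL

/-- `u ∈ MR^r_0(J; V, X)` satisfies `u'(t) + 𝒜(t) u(t) = f(t)` for almost all `t ∈ J`. -/
def IsSolution {T : ℝ} {r : Expo} {e : V →L[ℂ] X} (𝒜 : ℝ → V →L[ℂ] X) (f : LJ T r X)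
    (u : MR T r e) : Prop :=
  ∀ᵐ t ∂(volJ T), MR.der u t + 𝒜 t (MR.val u t) = f t

/-- Non-autonomous maximal parabolic `L^r(J; X)`-regularity of `{𝒜(t)}_{t ∈ J}`, where
`𝒜(t) ∈ 𝓛(V; X)` and `V` is embedded in `X` through `e`. The first four clauses are the
requirements on the data that are part of the notion: `V` is densely embedded in `X`, the family
is bounded and (strongly) measurable, and every `𝒜(t)`, as an operator in `X` with domain `V`, is
closed. Only the values `𝒜 t` with `t ∈ J` matter. -/
structure HasMaximalRegularity (T : ℝ) (r : Expo) (e : V →L[ℂ] X) (𝒜 : ℝ → V →L[ℂ] X) :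
    Prop where
  embedding : Function.Injective e ∧ DenseRange e
  bounded : ∃ M : ℝ, ∀ t ∈ Ioo 0 T, ‖𝒜 t‖ ≤ M
  measurable : ∀ ψ : V, AEStronglyMeasurable (fun t => 𝒜 t ψ) (volJ T)
  closed : ∀ t ∈ Ioo 0 T, IsClosed (range fun ψ : V => (e ψ, 𝒜 t ψ))
  solvable : ∀ f : LJ T r X, ∃! u : MR T r e, IsSolution 𝒜 f u

end Abstract

/-! ### Coefficients depending on time, and the constants -/

/-- `μ : J → 𝓔(c_•, c^•)` is `L¹`-measurable: `t ↦ μ_t` is (strongly) Lebesgue measurable from `J`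
into `L¹(Ω; ℝ^{d×d})`. Only the values `μ t` with `t ∈ J` matter. (All norms on `ℝ^{d×d}` are
equivalent; the maximum norm of the entries is used.) -/
def L1Measurable {d : ℕ} {Ω : Set (Pt d)} {cl cu : ℝ} (T : ℝ) (μ : ℝ → Coeff Ω cl cu) : Prop :=
  ∃ m : ℝ → Lp (Fin d → Fin d → ℝ) 1 (volume.restrict Ω),
    (∀ t ∈ Ioo 0 T, m t =ᵐ[volume.restrict Ω] fun x i j => (μ t).1 x i j) ∧
    AEStronglyMeasurable m (volJ T)

/-- The space `MR^r_0(J; W^{1,2}_D, W^{-1,2}_D)`. -/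
abbrev MRW {d : ℕ} (Ω D : Set (Pt d)) (T : ℝ) (r : Expo) :
    Submodule ℂ (WithLp 1 (LJ T r (W Ω D) × LJ T r (WDual Ω D))) :=
  MR (V := W Ω D) (X := WDual Ω D) T r (embed Ω D)

/-- `∂/∂t + 𝒥 : MR^r_0(J; W^{1,2}_D, W^{-1,2}_D) → L^r(J; W^{-1,2}_D)`. -/
abbrev refOp {d : ℕ} (Ω D : Set (Pt d)) (T : ℝ) (r : Expo) :
    MRW Ω D T r →L[ℂ] LJ T r (WDual Ω D) :=
  parabolicOp (V := W Ω D) (X := WDual Ω D) T r (embed Ω D) (dualityMap Ω D)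

/-- `C_{𝒥,s}`: the maximum for `r ∈ {s, s'}` of the operator norm of
`(∂/∂t + 𝒥)⁻¹ : L^r(J; W^{-1,2}_D) → MR^r_0(J; W^{1,2}_D, W^{-1,2}_D)`. -/
def constJ {d : ℕ} (Ω D : Set (Pt d)) (T : ℝ) (s : Expo) : ℝ :=
  max ‖(refOp Ω D T s).inverse‖ ‖(refOp Ω D T s.conj).inverse‖

/-- The constant `κ_s`. -/
def kappa {d : ℕ} (Ω D : Set (Pt d)) (T cl cu : ℝ) (s : Expo) : ℝ :=
  1 / 12 * (1 / (1 + 2 * (1 + (1 + cl + cu) / cl) * max 1 cu * constJ Ω D T s))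

/-- The exponent `r₀ = (1/2 - κ_s (1 - 2/s))⁻¹`. -/
def rZero {d : ℕ} (Ω D : Set (Pt d)) (T cl cu : ℝ) (s : Expo) : ℝ :=
  (1 / 2 - kappa Ω D T cl cu s * (1 - 2 / s.1))⁻¹

end MaxReg

end

/-! Write `V` for the Sobolev space and identify its antidual with `V` through the duality map `𝒥`,
a surjective isometry. The embedding becomes a bounded positive injective operator `S = 𝒥⁻¹e` on
`V`. A pair `(u, u')` lies in `MR` exactly when `e u = ∫₀ᵗ u'` (`mem_MR_iff`), so with `g = 𝒥⁻¹h`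
the reference problem `u' + 𝒥u = h`, `u(0) = 0` reads `S u + ∫₀ᵗ u = ∫₀ᵗ g` in `L^r(J; V)`.

Autonomous part. If `S` has a bounded positive inverse `A`, the solution is `u = A ∫₀ᵗ e^{-(t-s)A}
g(s) ds`. Its `L^r` bound rests on the form `k_t(x) = Re⟨x, A e^{-tA} x⟩`, which is nonnegative,
decreasing in `t`, and has total integral at most `‖x‖²`. Pairing `u(t)` with itself gives `‖u(t)‖²
≤ ∫₀ᵗ k_{t-s}(g(s)) ds`. Integrated against a weight, the decreasing kernel is dominated by a
one-sided maximal function. The weight `‖u‖^{p-2}` together with the sharp one-sided maximal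
inequality (rising sun lemma and Doob's argument) settles `p > 2`, and duality by time reversal
settles `p < 2`. The constants do not depend on `A`, so `S` may be replaced by `S + ε` and `ε` sent
to `0` (`exists_solution_of_regularised`). For `r = 2` the constant is `1`.

Non-autonomous part. Take `f = 𝒥⁻¹(∂/∂t + 𝒥)u` as the unknown, so that `u` is the autonomous
solution with datum `f` and `𝒥⁻¹u' = f - u`. With `𝓑 = 𝒥⁻¹(𝒜₂(μ) + I)` the equation becomes `Q f =
𝒥⁻¹h`, where `Q f = (f - u) + 𝓑u` (`pertOp`, `isSolution_iff`). The norm of `f` is exactly the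
modified norm of `u`, so the theorem asks for invertibility of `Q` on `L^r` with `‖Q⁻¹‖ ≤ 8β`, where
`β = (1 + c_• + c^•)/c_•`. On `L^s` and `L^{s'}` one has `‖Q‖ ≤ c^• C_𝒥`. On `L²`, coercivity and
the energy inequality give `‖Q f‖ ≥ ‖f‖/β`.

The lower bound survives near `r = 2` by a quantitative Shneiberg argument
(`lower_bound_of_interpolation`). For step functions, the forms `⟨Q f, h⟩` with coefficients raised
to suitable complex powers make up a holomorphic function on a strip, bounded by `γ = c^• C_𝒥`. The
Schwarz lemma bounds its variation from `1/2` to `θ` by `4γ|θ - 1/2|`, and `κ_s` is chosen so that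
this loss is at most `1/(6β)`.

A lower bound gives only injectivity. Since `c_• ≤ 1 ≤ c^•`, the segment from the identity to `𝓑`
consists of coercive families with the same constants, so the lower bound is uniform along it. At
the identity `Q = 1`, and the method of continuity yields bijectivity (`pertOp_bijective`). -/

noncomputable section

namespace MaxReg

/-! ### The one-sided maximal function on an interval -/

/-- The points of `(0, T)` from which some average of `φ` to the right exceeds `l`. -/
def superlevel (T : ℝ) (φ : ℝ → ℝ) (l : ℝ) : Set ℝ :=
  {s ∈ Ioo 0 T | ∃ t ∈ Ioc s T, l * (t - s) < ∫ x in s..t, φ x}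

lemma isOpen_superlevel (T : ℝ) {φ : ℝ → ℝ} (hφ : Continuous φ) (l : ℝ) :
    IsOpen (superlevel T φ l) := by
  have h : superlevel T φ l
      = Ioo 0 T ∩ ⋃ t ∈ Iic T, {s | s < t ∧ l * (t - s) < ∫ x in s..t, φ x} := by
    ext s
    simp only [superlevel, mem_ofPred_eq, mem_Ioc, mem_inter_iff, mem_iUnion, mem_Iic, exists_prop]
    grind
  rw [h]
  refine isOpen_Ioo.inter (isOpen_biUnion fun t _ => ?_)
  have hc : Continuous fun s => ∫ x in s..t, φ x := by
    have : (fun s => ∫ x in s..t, φ x) = fun s => - ∫ x in t..s, φ x := by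
      funext s; rw [intervalIntegral.integral_symm]
    rw [this]
    exact (intervalIntegral.continuous_primitive (fun a b => hφ.intervalIntegrable a b) t).neg
  exact (isOpen_lt continuous_id continuous_const).inter (isOpen_lt (by fun_prop) hc)

/-- Rising sun lemma, without decomposing the set into intervals. With `Ψ(s) = ∫₀ˢ φ - ls` and `F(s)
= sup_{[s,T]} Ψ`, the set is `{F > Ψ}`. There `F` is locally constant, so `F - Ψ` has derivative `l
- φ`; elsewhere its derivative is `0`. As `F - Ψ` is nonnegative at `0` and zero at `T`, integrating
its derivative gives the claim. -/
lemma mul_measure_superlevel_le {T : ℝ} (hT : 0 < T) {φ : ℝ → ℝ} (hφ : Continuous φ) (l : ℝ) :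
    l * volume.real (superlevel T φ l) ≤ ∫ x in superlevel T φ l, φ x := by
  set E := superlevel T φ l with hE
  have hEm : MeasurableSet E := (isOpen_superlevel T hφ l).measurableSet
  have hEs : E ⊆ Ioo 0 T := fun s hs => hs.1
  set Ψ : ℝ → ℝ := fun s => (∫ x in (0:ℝ)..s, φ x) - l * s with hΨ
  have hΨd : ∀ s, HasDerivAt Ψ (φ s - l) s := fun s => by
    have h1 := intervalIntegral.integral_hasDerivAt_right (hφ.intervalIntegrable 0 s)
      (hφ.stronglyMeasurableAtFilter _ _) hφ.continuousAt
    convert! h1.sub ((hasDerivAt_id s).const_mul l) using 1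
    simp
  have hΨc : Continuous Ψ := continuous_iff_continuousAt.2 fun s => (hΨd s).continuousAt
  have hΨsub : ∀ s t, Ψ t - Ψ s = (∫ x in s..t, φ x) - l * (t - s) := fun s t => by
    have := intervalIntegral.integral_interval_sub_left (hφ.intervalIntegrable 0 t)
      (hφ.intervalIntegrable (μ := volume) 0 s)
    simp only [hΨ]; rw [← this]; ring
  set F : ℝ → ℝ := fun s => sSup (Ψ '' Icc s T) with hF
  have hbdd : ∀ s, BddAbove (Ψ '' Icc s T) := fun s => (isCompact_Icc.image hΨc).bddAbove
  have hle : ∀ {s t}, s ≤ t → t ≤ T → Ψ t ≤ F s := fun h1 h2 => le_csSup (hbdd _) ⟨_, ⟨h1, h2⟩, rfl⟩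
  have hsup : ∀ {s c}, s ≤ T → (∀ t ∈ Icc s T, Ψ t ≤ c) → F s ≤ c := fun {s c} h1 h2 =>
    csSup_le ⟨_, s, ⟨le_rfl, h1⟩, rfl⟩ (by rintro _ ⟨t, ht, rfl⟩; exact h2 t ht)
  have hanti : ∀ {s t}, s ≤ t → t ≤ T → F t ≤ F s := fun h1 h2 =>
    hsup h2 fun r hr => hle (h1.trans hr.1) hr.2
  obtain ⟨K, hK⟩ : ∃ K : ℝ, ∀ x ∈ Icc 0 T, ‖φ x - l‖ ≤ K :=
    isCompact_Icc.exists_bound_of_continuousOn (by fun_prop)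
  have hK0 : 0 ≤ K := (norm_nonneg _).trans (hK 0 ⟨le_rfl, hT.le⟩)
  have hΨL : ∀ x ∈ Icc 0 T, ∀ y ∈ Icc 0 T, |Ψ x - Ψ y| ≤ K * |x - y| := fun x hx y hy =>
    (convex_Icc 0 T).norm_image_sub_le_of_norm_hasDerivWithin_le
      (fun z _ => (hΨd z).hasDerivWithinAt) hK hy hx
  -- The running supremum inherits the Lipschitz constant of `Ψ`; absolute continuity is what allows
  -- `F - Ψ` to be recovered from its derivative.
  have hFL : LipschitzOnWith K.toNNReal F (Icc 0 T) := by
    refine LipschitzOnWith.of_le_add_mul _ fun x hx y hy => ?_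
    rw [Real.coe_toNNReal _ hK0, Real.dist_eq]
    rcases le_total x y with h | h
    · refine hsup hx.2 fun t ht => ?_
      rcases le_total y t with h' | h'
      · have := hle h' ht.2
        have : 0 ≤ K * |x - y| := by positivity
        linarith
      · have h1 := hle le_rfl hy.2
        have h2 := hΨL t ⟨hx.1.trans ht.1, ht.2⟩ y hy
        have h3 : |t - y| ≤ |x - y| := by
          rw [abs_of_nonpos (by linarith), abs_of_nonpos (by linarith)]; linarith [ht.1]
        have := (le_abs_self _).trans (h2.trans (mul_le_mul_of_nonneg_left h3 hK0))
        linarith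
    · have := hanti h hx.2
      have : 0 ≤ K * |x - y| := by positivity
      linarith
  set h : ℝ → ℝ := fun s => F s - Ψ s with hh
  have hac : AbsolutelyContinuousOnInterval h 0 T := by
    rw [← uIcc_of_le hT.le] at hFL
    have h2 : LipschitzOnWith K.toNNReal Ψ (uIcc 0 T) := by
      rw [uIcc_of_le hT.le]
      refine LipschitzOnWith.of_dist_le_mul fun x hx y hy => ?_
      rw [Real.coe_toNNReal _ hK0]
      exact hΨL x hx y hy
    exact hFL.absolutelyContinuousOnInterval.sub h2.absolutelyContinuousOnInterval
  have hint := hac.integral_deriv_eq_sub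
  have hT0 : h T = 0 := by
    have : F T = Ψ T := by simp [hF]
    simp [hh, this]
  have h0 : 0 ≤ h 0 := sub_nonneg.2 (hle le_rfl hT.le)
  have hder : ∀ s ∈ Ioo 0 T, deriv h s = E.indicator (fun x => l - φ x) s := by
    intro s hs
    by_cases hsE : s ∈ E
    · rw [indicator_of_mem hsE]
      obtain ⟨-, t, ht, hlt⟩ := hsE
      have hlt' : Ψ s < Ψ t := by have := hΨsub s t; linarith
      have hev : ∀ᶠ x in nhds s, Ψ x < Ψ t ∧ x < t := by
        refine (hΨc.continuousAt.eventually (gt_mem_nhds hlt')).and (gt_mem_nhds ht.1)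
      obtain ⟨δ, hδ, hball⟩ := Metric.eventually_nhds_iff_ball.1 hev
      -- All values of `Ψ` near `s` lie below the value at the later point `t`, so moving the left
      -- endpoint slightly does not change the supremum.
      have hconst : ∀ᶠ x in nhds s, F x = F s := by
        filter_upwards [Metric.ball_mem_nhds s hδ] with x hx
        have key : ∀ {a b}, a ∈ Metric.ball s δ → b ∈ Metric.ball s δ → a ≤ b → F a = F b := by
          intro a b ha hb hab
          have hbT : b ≤ T := ((hball b hb).2.le).trans ht.2
          refine le_antisymm (hsup (hab.trans hbT) fun r hr => ?_) (hanti hab hbT)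
          rcases le_total b r with h' | h'
          · exact hle h' hr.2
          · have hr' : r ∈ Metric.ball s δ := by
              rw [Real.ball_eq_Ioo] at ha hb ⊢
              exact ⟨ha.1.trans_le hr.1, h'.trans_lt hb.2⟩
            exact (hball r hr').1.le.trans (hle (hball b hb).2.le ht.2)
        rcases le_total x s with h' | h'
        · exact key hx (Metric.mem_ball_self hδ) h'
        · exact (key (Metric.mem_ball_self hδ) hx h').symm
      have hd : HasDerivAt h (0 - (φ s - l)) s :=
        ((hasDerivAt_const s (F s)).congr_of_eventuallyEq hconst).sub (hΨd s)
      rw [hd.deriv]; ring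
    · rw [indicator_of_notMem hsE]
      have hFs : F s = Ψ s := by
        refine le_antisymm (hsup hs.2.le fun t ht => ?_) (hle le_rfl hs.2.le)
        by_contra hcon
        refine hsE ⟨hs, t, ⟨lt_of_le_of_ne ht.1 ?_, ht.2⟩, ?_⟩
        · intro h'; rw [h'] at hcon; exact hcon le_rfl
        · have := hΨsub s t; push Not at hcon; linarith
      -- Off `E` the nonnegative function `F - Ψ` attains its minimum `0` at `s`.
      refine IsLocalMin.deriv_eq_zero ?_
      filter_upwards [Ioo_mem_nhds hs.1 hs.2] with x hx
      simp only [hh, hFs, sub_self]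
      exact sub_nonneg.2 (hle le_rfl hx.2.le)
  rw [intervalIntegral.integral_of_le hT.le, integral_Ioc_eq_integral_Ioo,
    setIntegral_congr_fun measurableSet_Ioo hder, integral_indicator hEm,
    Measure.restrict_restrict_of_subset hEs, integral_sub, setIntegral_const, smul_eq_mul, hT0] at hint
  · rw [mul_comm]; linarith
  · exact integrableOn_const (measure_mono hEs |>.trans_lt (by simp)).ne
  · exact (hφ.integrableOn_Icc (μ := volume) (a := 0) (b := T)).mono_set (hEs.trans Ioo_subset_Icc_self)

/-- The maximal function of the averages of `φ` over the intervals `[s, t]` with `s < t ≤ T`. -/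
def maxFun (T : ℝ) (φ : ℝ → ℝ) (s : ℝ) : ℝ :=
  open Classical in
  if s ∈ Ioo 0 T then sSup ((fun t => (t - s)⁻¹ * ∫ x in s..t, φ x) '' Ioc s T) else 0

section

variable {T : ℝ} {φ : ℝ → ℝ}

lemma exists_average_le (hφ : Continuous φ) :
    ∃ C : ℝ, 0 ≤ C ∧ ∀ s ∈ Ioo 0 T, ∀ t ∈ Ioc s T, (t - s)⁻¹ * ∫ x in s..t, φ x ≤ C := by
  obtain ⟨C, hC⟩ := isCompact_Icc.exists_bound_of_continuousOn (s := Icc 0 T) hφ.continuousOn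
  refine ⟨max C 0, le_max_right _ _, fun s hs t ht => ?_⟩
  have hts : 0 < t - s := by linarith [ht.1]
  rw [inv_mul_le_iff₀ hts]
  have := intervalIntegral.integral_mono_on ht.1.le (hφ.intervalIntegrable (μ := volume) s t)
    (intervalIntegrable_const (c := max C 0)) fun x hx =>
      ((le_abs_self _).trans (hC x ⟨hs.1.le.trans hx.1, hx.2.trans ht.2⟩)).trans (le_max_left _ _)
  simpa using this

lemma bddAbove_average (hφ : Continuous φ) {s : ℝ} (hs : s ∈ Ioo 0 T) :
    BddAbove ((fun t => (t - s)⁻¹ * ∫ x in s..t, φ x) '' Ioc s T) := by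
  obtain ⟨C, -, hC⟩ := exists_average_le (T := T) hφ
  exact ⟨C, by rintro _ ⟨t, ht, rfl⟩; exact hC s hs t ht⟩

lemma integral_le_maxFun (hφ : Continuous φ) {s t : ℝ} (hs : s ∈ Ioo 0 T)
    (ht : t ∈ Icc s T) : ∫ x in s..t, φ x ≤ maxFun T φ s * (t - s) := by
  rcases ht.1.eq_or_lt with rfl | h
  · simp
  · rw [maxFun, if_pos hs, ← div_le_iff₀ (by linarith), div_eq_inv_mul]
    exact le_csSup (bddAbove_average hφ hs) ⟨t, ⟨h, ht.2⟩, rfl⟩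

lemma maxFun_nonneg (h0 : ∀ x, 0 ≤ φ x) (s : ℝ) : 0 ≤ maxFun T φ s := by
  rw [maxFun]
  split_ifs with hs
  · refine Real.sSup_nonneg ?_
    rintro _ ⟨t, ht, rfl⟩
    have : 0 ≤ t - s := by linarith [ht.1]
    exact mul_nonneg (inv_nonneg.2 this) (intervalIntegral.integral_nonneg ht.1.le fun x _ => h0 x)
  · exact le_rfl

lemma exists_maxFun_le (hφ : Continuous φ) : ∃ C, ∀ s, maxFun T φ s ≤ C := by
  obtain ⟨C, hC0, hC⟩ := exists_average_le (T := T) hφ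
  refine ⟨C, fun s => ?_⟩
  rw [maxFun]
  split_ifs with hs
  · exact Real.sSup_le (by rintro _ ⟨t, ht, rfl⟩; exact hC s hs t ht) hC0
  · exact hC0

lemma setOf_lt_maxFun (hφ : Continuous φ) {l : ℝ} (hl : 0 ≤ l) :
    {s | l < maxFun T φ s} = superlevel T φ l := by
  ext s
  simp only [mem_ofPred_eq, superlevel, maxFun]
  split_ifs with hs
  · rw [lt_csSup_iff (bddAbove_average hφ hs) ⟨_, T, ⟨hs.2, le_rfl⟩, rfl⟩]
    simp only [exists_mem_image, hs, true_and]
    refine exists_congr fun t => and_congr_right fun ht => ?_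
    rw [← div_eq_inv_mul, lt_div_iff₀ (by linarith [ht.1])]
  -- Off `(0, T)` the maximal function is `0` by convention; `l ≥ 0` keeps such points out of the
  -- superlevel set.
  · simp [hs, hl]

lemma measurable_maxFun (hφ : Continuous φ) (h0 : ∀ x, 0 ≤ φ x) : Measurable (maxFun T φ) := by
  refine measurable_of_Ioi fun l => ?_
  rcases le_or_gt 0 l with hl | hl
  · have := setOf_lt_maxFun (T := T) hφ hl
    exact (congrArg MeasurableSet this).mpr (isOpen_superlevel T hφ l).measurableSet
  · have : maxFun T φ ⁻¹' Ioi l = univ := eq_univ_of_forall fun s => hl.trans_le (maxFun_nonneg h0 s)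
    rw [this]; exact MeasurableSet.univ

lemma integrable_maxFun_rpow_mul (hφ : Continuous φ) (h0 : ∀ x, 0 ≤ φ x) {q : ℝ} (hq : 0 ≤ q)
    {ψ : ℝ → ℝ} (hψ : Continuous ψ) :
    Integrable (fun s => ψ s * maxFun T φ s ^ q) (volJ T) := by
  obtain ⟨C, hC⟩ := exists_maxFun_le (T := T) hφ
  refine Integrable.mul_bdd (c := C ^ q) (hψ.integrableOn_Icc.mono_set Ioo_subset_Icc_self)
    ((measurable_maxFun hφ h0).pow_const q).aestronglyMeasurable
    (Filter.Eventually.of_forall fun s => ?_)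
  rw [Real.norm_of_nonneg (Real.rpow_nonneg (maxFun_nonneg h0 s) q)]
  exact Real.rpow_le_rpow (maxFun_nonneg h0 s) (hC s) hq

/-- Doob's argument: both sides are expanded by the layer-cake formula, the right one for the
measure `φ dx`, and compared level by level through the rising sun estimate. The constant is the
quotient of the prefactors `q` and `q - 1`. -/
lemma integral_maxFun_rpow_le_mul (hT : 0 < T) (hφ : Continuous φ) (h0 : ∀ x, 0 ≤ φ x) {q : ℝ}
    (hq : 1 < q) :
    ∫ s in Ioo 0 T, maxFun T φ s ^ q
      ≤ q / (q - 1) * ∫ s in Ioo 0 T, φ s * maxFun T φ s ^ (q - 1) := by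
  have hM := measurable_maxFun (T := T) hφ h0
  have hM0 := maxFun_nonneg (T := T) h0
  have hfin : ∀ l, volume (superlevel T φ l) ≠ ⊤ := fun l =>
    ((measure_mono fun s hs => hs.1).trans_lt (by simp : volume (Ioo 0 T) < ⊤)).ne
  set ν : Measure ℝ := (volJ T).withDensity fun x => ENNReal.ofReal (φ x) with hν
  have hsub : ∀ l, superlevel T φ l ⊆ Ioo 0 T := fun l s hs => hs.1
  have hlev : ∀ l ∈ Ioi (0:ℝ), ENNReal.ofReal l * volJ T {a | l < maxFun T φ a}
      ≤ ν {a | l < maxFun T φ a} := by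
    intro l hl
    have hlm := (isOpen_superlevel T hφ l).measurableSet
    rw [setOf_lt_maxFun hφ (le_of_lt hl), Measure.restrict_apply hlm,
      inter_eq_left.2 (hsub l), hν, withDensity_apply _ hlm, Measure.restrict_restrict_of_subset
      (hsub l), ← ofReal_integral_eq_lintegral_ofReal
        ((hφ.integrableOn_Icc (a := 0) (b := T)).mono_set ((hsub l).trans Ioo_subset_Icc_self))
        (Filter.Eventually.of_forall h0), ← ofReal_measureReal (hfin l),
      ← ENNReal.ofReal_mul (le_of_lt hl)]
    exact ENNReal.ofReal_le_ofReal (mul_measure_superlevel_le hT hφ l)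
  have h1 := lintegral_rpow_eq_lintegral_meas_lt_mul (volJ T)
    (Filter.Eventually.of_forall hM0) hM.aemeasurable (p := q) (by linarith)
  have h2 := lintegral_rpow_eq_lintegral_meas_lt_mul ν
    (Filter.Eventually.of_forall hM0) hM.aemeasurable (p := q - 1) (by linarith)
  have h3 : ∫⁻ t in Ioi 0, volJ T {a | t < maxFun T φ a} * ENNReal.ofReal (t ^ (q - 1))
      ≤ ∫⁻ t in Ioi 0, ν {a | t < maxFun T φ a} * ENNReal.ofReal (t ^ (q - 1 - 1)) := by
    refine setLIntegral_mono' measurableSet_Ioi fun t ht => ?_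
    have : t ^ (q - 1) = t * t ^ (q - 1 - 1) := by
      rw [← Real.rpow_one_add' (le_of_lt ht) (by linarith)]; ring_nf
    rw [this, ENNReal.ofReal_mul (le_of_lt ht), ← mul_assoc, mul_comm (volJ T _)]
    gcongr
    exact hlev t ht
  have h4 : ∫⁻ s, ENNReal.ofReal (maxFun T φ s ^ (q - 1)) ∂ν
      = ENNReal.ofReal (∫ s in Ioo 0 T, φ s * maxFun T φ s ^ (q - 1)) := by
    rw [hν, lintegral_withDensity_eq_lintegral_mul _ (by fun_prop)
      (hM.pow_const _).ennreal_ofReal, ofReal_integral_eq_lintegral_ofReal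
      (integrable_maxFun_rpow_mul hφ h0 (by linarith) hφ)
      (Filter.Eventually.of_forall fun s => mul_nonneg (h0 s) (Real.rpow_nonneg (hM0 s) _))]
    refine lintegral_congr fun s => ?_
    rw [Pi.mul_apply, ENNReal.ofReal_mul (h0 s)]
  have hi := integrable_maxFun_rpow_mul (T := T) hφ h0 (q := q) (by linarith)
    (continuous_const (y := (1:ℝ)))
  simp only [one_mul] at hi
  rw [← ofReal_integral_eq_lintegral_ofReal hi
    (Filter.Eventually.of_forall fun s => Real.rpow_nonneg (hM0 s) _)] at h1
  rw [h4] at h2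
  have hB : 0 ≤ ∫ s in Ioo 0 T, φ s * maxFun T φ s ^ (q - 1) :=
    integral_nonneg fun s => mul_nonneg (h0 s) (Real.rpow_nonneg (hM0 s) _)
  have hq1 : 0 < q - 1 := by linarith
  have h5 : ENNReal.ofReal ((q - 1) * ∫ s in Ioo 0 T, maxFun T φ s ^ q)
      ≤ ENNReal.ofReal (q * ∫ s in Ioo 0 T, φ s * maxFun T φ s ^ (q - 1)) := by
    rw [ENNReal.ofReal_mul hq1.le, ENNReal.ofReal_mul (by linarith), h1, h2, ← mul_assoc,
      ← mul_assoc, mul_comm (ENNReal.ofReal (q - 1))]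
    gcongr
  rw [ENNReal.ofReal_le_ofReal_iff (by positivity)] at h5
  rw [div_mul_eq_mul_div, le_div_iff₀ hq1]
  linarith

/-- The one-sided maximal inequality. -/
lemma integral_maxFun_rpow_le (hT : 0 < T) (hφ : Continuous φ) (h0 : ∀ x, 0 ≤ φ x) {q : ℝ}
    (hq : 1 < q) :
    (∫ s in Ioo 0 T, maxFun T φ s ^ q) ^ (1 / q)
      ≤ q / (q - 1) * (∫ s in Ioo 0 T, φ s ^ q) ^ (1 / q) := by
  have hM := measurable_maxFun (T := T) hφ h0
  have hM0 := maxFun_nonneg (T := T) h0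
  have hq1 : 0 < q - 1 := by linarith
  have h1 := integral_maxFun_rpow_le_mul hT hφ h0 hq
  obtain ⟨C, hC⟩ := exists_maxFun_le (T := T) hφ
  obtain ⟨C', hC'⟩ := isCompact_Icc.exists_bound_of_continuousOn (s := Icc 0 T) hφ.continuousOn
  have hconj : q.HolderConjugate (q / (q - 1)) := Real.HolderConjugate.conjExponent hq
  have hH := integral_mul_le_Lp_mul_Lq_of_nonneg (μ := volJ T) hconj
    (f := φ) (g := fun s => maxFun T φ s ^ (q - 1)) (Filter.Eventually.of_forall h0)
    (Filter.Eventually.of_forall fun s => Real.rpow_nonneg (hM0 s) _)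
    (MemLp.of_bound hφ.aestronglyMeasurable C' (by
      filter_upwards [ae_restrict_mem measurableSet_Ioo] with x hx
      exact hC' x (Ioo_subset_Icc_self hx)))
    (MemLp.of_bound (hM.pow_const _).aestronglyMeasurable (C ^ (q - 1))
      (Filter.Eventually.of_forall fun s => by
        rw [Real.norm_of_nonneg (Real.rpow_nonneg (hM0 s) _)]
        exact Real.rpow_le_rpow (hM0 s) (hC s) hq1.le))
  have h2 : ∀ s, (maxFun T φ s ^ (q - 1)) ^ (q / (q - 1)) = maxFun T φ s ^ q := fun s => by
    rw [← Real.rpow_mul (hM0 s)]; congr 1; field_simp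
  simp only [h2] at hH
  set X := ∫ s in Ioo 0 T, maxFun T φ s ^ q with hX
  have hX0 : 0 ≤ X := integral_nonneg fun s => Real.rpow_nonneg (hM0 s) _
  have hY0 : 0 ≤ (∫ s in Ioo 0 T, φ s ^ q) ^ (1 / q) :=
    Real.rpow_nonneg (integral_nonneg fun s => Real.rpow_nonneg (h0 s) _) _
  -- Hölder leaves the factor `X^{1 - 1/q}` on the right; it is cancelled when `X ≠ 0`.
  rcases hX0.eq_or_lt with h | hpos
  · rw [← h, Real.zero_rpow (by positivity)]
    positivity
  · have h3 : X ≤ q / (q - 1) * (∫ s in Ioo 0 T, φ s ^ q) ^ (1 / q) * X ^ (1 / (q / (q - 1))) := by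
      refine h1.trans ?_
      rw [mul_assoc]
      exact mul_le_mul_of_nonneg_left hH (by positivity)
    have h4 : X = X ^ (1 / q) * X ^ (1 / (q / (q - 1))) := by
      rw [← Real.rpow_add hpos]
      conv_lhs => rw [← Real.rpow_one X]
      congr 1; field_simp; ring
    exact le_of_mul_le_mul_right (h4.symm.trans_le h3) (Real.rpow_pos_of_pos hpos _)

end

/-! ### The semigroup of a bounded positive operator -/

section

variable {𝔸 : Type*} [NormedRing 𝔸] [NormedAlgebra ℝ 𝔸]

/-- The exponential `e^{-ta}` in a Banach algebra. -/
def expNeg (a : 𝔸) (t : ℝ) : 𝔸 := NormedSpace.exp ((-t) • a)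

lemma expNeg_zero (a : 𝔸) : expNeg a 0 = 1 := by simp [expNeg, NormedSpace.exp_zero]

lemma expNeg_add [CompleteSpace 𝔸] (a : 𝔸) (s t : ℝ) : expNeg a (s + t) = expNeg a s * expNeg a t := by
  let : NormedAlgebra ℚ 𝔸 := .restrictScalars ℚ ℝ _
  rw [expNeg, neg_add, add_smul, NormedSpace.exp_add_of_commute]
  · rfl
  · exact ((Commute.refl a).smul_left _).smul_right _

lemma commute_expNeg (a : 𝔸) (t : ℝ) : Commute a (expNeg a t) :=
  ((Commute.refl a).smul_right _).exp_right

lemma hasDerivAt_expNeg [CompleteSpace 𝔸] (a : 𝔸) (t : ℝ) : HasDerivAt (expNeg a) (-(a * expNeg a t)) t := by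
  have h := (hasDerivAt_exp_smul_const' (𝕂 := ℝ) a (-t)).scomp t (hasDerivAt_neg t)
  convert! h using 1
  simp [expNeg]

lemma isSelfAdjoint_expNeg [StarRing 𝔸] [NormedStarGroup 𝔸] [StarModule ℝ 𝔸] {a : 𝔸}
    (ha : IsSelfAdjoint a) (t : ℝ) : IsSelfAdjoint (expNeg a t) := by
  have : IsSelfAdjoint ((-t) • a) := (IsSelfAdjoint.all (-t)).smul ha
  exact this.exp

end

variable {V : Type*} [NormedAddCommGroup V] [InnerProductSpace ℂ V] [CompleteSpace V]

/-- The semigroup `e^{-tA}`. -/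
def sg (A : V →L[ℂ] V) (t : ℝ) : V →L[ℂ] V := expNeg A t

lemma sg_zero_apply (A : V →L[ℂ] V) (x : V) : sg A 0 x = x := by
  simp [sg, expNeg_zero]

lemma sg_add_apply (A : V →L[ℂ] V) (s t : ℝ) (x : V) : sg A (s + t) x = sg A s (sg A t x) :=
  congrArg (fun L : V →L[ℂ] V => L x) (expNeg_add A s t)

lemma sg_comm (A : V →L[ℂ] V) (t : ℝ) (x : V) : sg A t (A x) = A (sg A t x) :=
  (congrArg (fun L : V →L[ℂ] V => L x) (commute_expNeg A t).eq).symm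

lemma hasDerivAt_sg_apply (A : V →L[ℂ] V) (t : ℝ) (x : V) :
    HasDerivAt (fun t => sg A t x) (-(A (sg A t x))) t := by
  have h := hasDerivAt_expNeg A t
  have h2 := ((ContinuousLinearMap.apply ℂ V x).restrictScalars ℝ).hasFDerivAt.comp_hasDerivAt t h
  exact h2

lemma continuous_sg (A : V →L[ℂ] V) : Continuous (sg A) :=
  continuous_iff_continuousAt.2 fun t => (hasDerivAt_expNeg A t).continuousAt

lemma sg_inner {A : V →L[ℂ] V} (hA : A.IsPositive) (t : ℝ) (x y : V) :
    ⟪sg A t x, y⟫_ℂ = ⟪x, sg A t y⟫_ℂ :=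
  (isSelfAdjoint_expNeg hA.isSelfAdjoint t).isSymmetric x y

/-- The quadratic form of `A e^{-tA}`. -/
def kern (A : V →L[ℂ] V) (t : ℝ) (x : V) : ℝ := RCLike.re ⟪x, A (sg A t x)⟫_ℂ

section

variable {A : V →L[ℂ] V}

/-- `e^{-tA}` is the square of the self-adjoint `e^{-tA/2}`. All sign information on `kern` comes
from this splitting. -/
lemma sg_half (hA : A.IsPositive) (t : ℝ) (x y : V) :
    ⟪x, sg A t y⟫_ℂ = ⟪sg A (t / 2) x, sg A (t / 2) y⟫_ℂ := by
  rw [sg_inner hA, ← sg_add_apply, add_halves]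

lemma kern_nonneg (hA : A.IsPositive) (t : ℝ) (x : V) : 0 ≤ kern A t x := by
  rw [kern, ← sg_comm, sg_half hA, sg_comm]
  exact hA.re_inner_nonneg_right _

/-- The explicit square shows that the form decreases in time, which is what makes the comparison
with averages possible. -/
lemma hasDerivAt_kern (hA : A.IsPositive) (t : ℝ) (x : V) :
    HasDerivAt (fun t => kern A t x) (-‖A (sg A (t / 2) x)‖ ^ 2) t := by
  have h := (((RCLike.reCLM (K := ℂ)).comp ((innerSL ℂ x).restrictScalars ℝ)).comp
    (A.restrictScalars ℝ)).hasFDerivAt.comp_hasDerivAt t (hasDerivAt_sg_apply A t x)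
  convert! h using 1
  have e : ⟪x, A (A (sg A t x))⟫_ℂ = ⟪A (sg A (t / 2) x), A (sg A (t / 2) x)⟫_ℂ := by
    rw [← sg_comm, ← sg_comm, sg_half hA, sg_comm, sg_comm]
    exact (hA.isSelfAdjoint.isSymmetric _ _).symm
  have e' := inner_self_eq_norm_sq (𝕜 := ℂ) (A (sg A (t / 2) x))
  simp only [ContinuousLinearMap.comp_apply, ContinuousLinearMap.coe_restrictScalars', map_neg,
    innerSL_apply_apply, e, RCLike.reCLM_apply, e']

lemma hasDerivAt_re_inner_sg (t : ℝ) (x : V) :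
    HasDerivAt (fun t => RCLike.re ⟪x, sg A t x⟫_ℂ) (- kern A t x) t := by
  have h := ((RCLike.reCLM (K := ℂ)).comp
    ((innerSL ℂ x).restrictScalars ℝ)).hasFDerivAt.comp_hasDerivAt t (hasDerivAt_sg_apply A t x)
  convert! h using 1
  simp [kern]

lemma continuous_kern : Continuous fun p : ℝ × V => kern A p.1 p.2 := by
  unfold kern
  have h : Continuous fun p : ℝ × V => sg A p.1 p.2 :=
    ((continuous_sg A).comp continuous_fst).clm_apply continuous_snd
  exact RCLike.continuous_re.comp (continuous_snd.inner (A.continuous.comp h))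

/-- `kern` is minus the derivative of `Re⟨x, e^{-tA}x⟩`, which starts at `‖x‖²` and stays
nonnegative. -/
lemma integral_kern_le (hA : A.IsPositive) (t : ℝ) (x : V) :
    ∫ r in (0 : ℝ)..t, kern A r x ≤ ‖x‖ ^ 2 := by
  have hc : Continuous fun r => kern A r x := continuous_kern.comp (by fun_prop : Continuous fun r : ℝ => (r, x))
  have h := intervalIntegral.integral_eq_sub_of_hasDerivAt (a := 0) (b := t)
    (fun r _ => hasDerivAt_re_inner_sg (A := A) r x) (hc.neg.intervalIntegrable _ _)
  rw [intervalIntegral.integral_neg, sg_zero_apply, inner_self_eq_norm_sq, sg_half hA,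
    inner_self_eq_norm_sq] at h
  nlinarith [sq_nonneg ‖sg A (t / 2) x‖]

/-- Young's inequality for the nonnegative form of `A e^{-tA}`: evaluate it at `y - x`. -/
lemma two_mul_re_inner_le_kern (hA : A.IsPositive) (t : ℝ) (x y : V) :
    2 * RCLike.re ⟪y, A (sg A t x)⟫_ℂ ≤ kern A t x + kern A t y := by
  have h := kern_nonneg hA t (y - x)
  have e : ⟪A (sg A t x), y⟫_ℂ = ⟪x, A (sg A t y)⟫_ℂ := by
    rw [← sg_comm A t y, ← sg_inner hA]
    exact hA.isSelfAdjoint.isSymmetric _ _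
  have e2 : RCLike.re ⟪x, A (sg A t y)⟫_ℂ = RCLike.re ⟪y, A (sg A t x)⟫_ℂ := by
    rw [← e, inner_re_symm]
  simp only [kern, map_sub, inner_sub_left, inner_sub_right] at h ⊢
  linarith

end

/-- The function `A ∫_0^t e^{-A(t-s)} g(s) ds`. -/
def mild (A : V →L[ℂ] V) (g : ℝ → V) (t : ℝ) : V := ∫ s in (0 : ℝ)..t, A (sg A (t - s) (g s))

section

variable {A : V →L[ℂ] V} {g : ℝ → V}

/-- The solution of `w' + A w = g`, `w(0) = 0`. -/
def preMild (A : V →L[ℂ] V) (g : ℝ → V) (t : ℝ) : V := sg A t (∫ s in (0 : ℝ)..t, sg A (-s) (g s))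

lemma mild_eq (hg : Continuous g) (t : ℝ) : mild A g t = A (preMild A g t) := by
  have hc : Continuous fun s => sg A (-s) (g s) :=
    ((continuous_sg A).comp continuous_neg).clm_apply hg
  rw [mild, preMild, ← ContinuousLinearMap.comp_apply,
    ← ContinuousLinearMap.intervalIntegral_comp_comm _ (hc.intervalIntegrable _ _)]
  simp [sub_eq_add_neg, sg_add_apply]

lemma hasDerivAt_preMild (hg : Continuous g) (t : ℝ) :
    HasDerivAt (preMild A g) (g t - mild A g t) t := by
  have hc : Continuous fun s => sg A (-s) (g s) :=
    ((continuous_sg A).comp continuous_neg).clm_apply hg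
  have h1 := intervalIntegral.integral_hasDerivAt_right (hc.intervalIntegrable 0 t)
    (hc.stronglyMeasurableAtFilter _ _) hc.continuousAt
  have h2 := (ContinuousLinearMap.restrictScalarsL ℂ V V ℝ ℝ).hasFDerivAt.comp_hasDerivAt t
    (hasDerivAt_expNeg A t)
  have h3 : HasDerivAt (preMild A g) _ t := h2.clm_apply h1
  convert! h3 using 1
  have e : sg A t (sg A (-t) (g t)) = g t := by
    rw [← sg_add_apply, add_neg_cancel, sg_zero_apply]
  rw [mild_eq hg, sub_eq_neg_add]
  exact congrArg₂ _ rfl e.symm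

lemma continuous_mild (hg : Continuous g) : Continuous (mild A g) := by
  rw [funext (mild_eq hg)]
  exact A.continuous.comp (continuous_iff_continuousAt.2 fun t => (hasDerivAt_preMild hg t).continuousAt)

lemma preMild_eq (hg : Continuous g) (t : ℝ) :
    preMild A g t = (∫ s in (0 : ℝ)..t, g s) - ∫ s in (0 : ℝ)..t, mild A g s := by
  have hm := continuous_mild (A := A) hg
  have h := intervalIntegral.integral_eq_sub_of_hasDerivAt (a := 0) (b := t)
    (fun r _ => hasDerivAt_preMild (A := A) hg r) ((hg.sub hm).intervalIntegrable _ _)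
  rw [intervalIntegral.integral_sub (hg.intervalIntegrable _ _) (hm.intervalIntegrable _ _)] at h
  rw [h]
  simp [preMild]

/-- Pair `u = mild A g t` with its own integral representation and apply Young's inequality under
the integral. This gives `2‖u‖² ≤ ∫ kern(g) + ∫ kern(u)`, and the last integral is at most `‖u‖²`,
hence absorbed. -/
lemma norm_sq_mild_le (hA : A.IsPositive) (hg : Continuous g) {t : ℝ} (ht : 0 ≤ t) :
    ‖mild A g t‖ ^ 2 ≤ ∫ s in (0 : ℝ)..t, kern A (t - s) (g s) := by
  set u := mild A g t with hu
  have hc : Continuous fun s => A (sg A (t - s) (g s)) :=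
    A.continuous.comp (((continuous_sg A).comp (by fun_prop)).clm_apply hg)
  have hk : ∀ f : ℝ → V, Continuous f → Continuous fun s => kern A (t - s) (f s) := fun f hf =>
    continuous_kern.comp (by fun_prop : Continuous fun s : ℝ => (t - s, f s))
  have h1 : ‖u‖ ^ 2 = ∫ s in (0 : ℝ)..t, RCLike.re ⟪u, A (sg A (t - s) (g s))⟫_ℂ := by
    rw [← inner_self_eq_norm_sq (𝕜 := ℂ)]
    conv_lhs => rw [hu]; arg 2; arg 2; rw [mild]
    exact (((RCLike.reCLM (K := ℂ)).comp
      ((innerSL ℂ u).restrictScalars ℝ)).intervalIntegral_comp_comm (hc.intervalIntegrable _ _)).symm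
  have h2 : ∫ s in (0 : ℝ)..t, 2 * RCLike.re ⟪u, A (sg A (t - s) (g s))⟫_ℂ
      ≤ ∫ s in (0 : ℝ)..t, (kern A (t - s) (g s) + kern A (t - s) u) :=
    intervalIntegral.integral_mono_on ht
    (((RCLike.continuous_re.comp (continuous_const.inner hc)).const_smul (2 : ℝ)).intervalIntegrable (μ := volume) 0 t)
    (((hk g hg).add (hk (fun _ => u) continuous_const)).intervalIntegrable 0 t)
    fun s _ => two_mul_re_inner_le_kern hA (t - s) (g s) u
  rw [intervalIntegral.integral_add ((hk g hg).intervalIntegrable _ _)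
    ((hk (fun _ => u) continuous_const).intervalIntegrable _ _)] at h2
  have h3 := integral_kern_le hA t u
  have h4 : ∫ s in (0 : ℝ)..t, kern A (t - s) u = ∫ s in (0 : ℝ)..t, kern A s u := by
    rw [intervalIntegral.integral_comp_sub_left (fun r => kern A r u), sub_self, sub_zero]
  rw [intervalIntegral.integral_const_mul, ← h1] at h2
  linarith

end

/-- Interchanging the order of integration over a triangle. -/
lemma integral_triangle_swap {T : ℝ} (hT : 0 ≤ T) {K : ℝ → ℝ → ℝ}
    (hK : Continuous (Function.uncurry K)) :
    ∫ t in (0 : ℝ)..T, ∫ s in (0 : ℝ)..t, K t s = ∫ s in (0 : ℝ)..T, ∫ t in s..T, K t s := by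
  set f : ℝ → ℝ → ℝ := fun t s => {p : ℝ × ℝ | p.2 < p.1}.indicator (Function.uncurry K) (t, s)
    with hf
  have hm : MeasurableSet {p : ℝ × ℝ | p.2 < p.1} := measurableSet_lt measurable_snd measurable_fst
  have hi : Integrable (Function.uncurry f) ((volJ T).prod (volJ T)) := by
    rw [Measure.prod_restrict]
    refine Integrable.indicator ?_ hm
    exact (hK.continuousOn.integrableOn_compact (isCompact_Icc.prod isCompact_Icc)).mono_set
      (prod_mono Ioo_subset_Icc_self Ioo_subset_Icc_self)
  have h := integral_integral_swap hi
  rw [intervalIntegral.integral_of_le hT, intervalIntegral.integral_of_le hT,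
    integral_Ioc_eq_integral_Ioo, integral_Ioc_eq_integral_Ioo]
  convert h using 1
  · refine setIntegral_congr_fun measurableSet_Ioo fun t ht => ?_
    have : ∀ s, f t s = (Iio t).indicator (fun s => K t s) s := fun s => by
      simp [hf, indicator, Function.uncurry]
    simp only [this]
    rw [integral_indicator measurableSet_Iio, Measure.restrict_restrict measurableSet_Iio,
      intervalIntegral.integral_of_le ht.1.le, integral_Ioc_eq_integral_Ioo]
    congr 2
    ext s; simp only [mem_Ioo, mem_inter_iff, mem_Iio]; grind
  · refine setIntegral_congr_fun measurableSet_Ioo fun s hs => ?_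
    have : ∀ t, f t s = (Ioi s).indicator (fun t => K t s) t := fun t => by
      simp [hf, indicator, Function.uncurry]
    simp only [this]
    rw [integral_indicator measurableSet_Ioi, Measure.restrict_restrict measurableSet_Ioi,
      intervalIntegral.integral_of_le hs.2.le, integral_Ioc_eq_integral_Ioo]
    congr 2
    ext t; simp only [mem_Ioo, mem_inter_iff, mem_Ioi]; grind

/-- Integrals against a decreasing kernel are controlled by averages. -/
lemma integral_mul_le_of_antitone {s T m : ℝ} (hsT : s ≤ T) {φ k k' : ℝ → ℝ} (hφ : Continuous φ)
    (hk : ∀ t, HasDerivAt k (k' t) t) (hk' : Continuous k') (hneg : ∀ t, k' t ≤ 0)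
    (hk0 : 0 ≤ k T) (hm : ∀ t ∈ Icc s T, ∫ x in s..t, φ x ≤ m * (t - s)) :
    ∫ t in s..T, φ t * k t ≤ m * ∫ t in s..T, k t := by
  have hkc : Continuous k := continuous_iff_continuousAt.2 fun t => (hk t).continuousAt
  have hH : ∀ t, HasDerivAt (fun t => (∫ x in s..t, φ x) - m * (t - s)) (φ t - m) t := fun t => by
    have h1 := intervalIntegral.integral_hasDerivAt_right (hφ.intervalIntegrable s t)
      (hφ.stronglyMeasurableAtFilter _ _) hφ.continuousAt
    convert! h1.sub (((hasDerivAt_id t).sub_const s).const_mul m) using 1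
    simp
  -- Integration by parts against `H(t) = ∫_s^t φ - m(t - s)`, which vanishes at `s` and is
  -- nonpositive. As `k' ≤ 0` and `k(T) ≥ 0`, both remaining terms have the favourable sign.
  have h := intervalIntegral.integral_mul_deriv_eq_deriv_mul (a := s) (b := T)
    (fun t _ => hk t) (fun t _ => hH t) (hk'.intervalIntegrable _ _)
    ((hφ.sub continuous_const).intervalIntegrable _ _)
  have h2 : 0 ≤ ∫ t in s..T, k' t * ((∫ x in s..t, φ x) - m * (t - s)) :=
    intervalIntegral.integral_nonneg hsT fun t ht =>
      mul_nonneg_of_nonpos_of_nonpos (hneg t) (by linarith [hm t ht])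
  have h3 : k T * ((∫ x in s..T, φ x) - m * (T - s)) ≤ 0 :=
    mul_nonpos_of_nonneg_of_nonpos hk0 (by linarith [hm T ⟨hsT, le_rfl⟩])
  have h4 : ∫ t in s..T, k t * (φ t - m) = (∫ t in s..T, φ t * k t) - m * ∫ t in s..T, k t := by
    rw [← intervalIntegral.integral_const_mul, ← intervalIntegral.integral_sub]
    · congr 1; funext t; ring
    · exact (hφ.mul hkc).intervalIntegrable _ _
    · exact (hkc.const_smul m).intervalIntegrable _ _
  simp only [intervalIntegral.integral_same, sub_self, mul_zero, sub_zero] at h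
  linarith

/-! ### Weighted and `L^p` estimates for the mild solution -/

section

variable {A : V →L[ℂ] V} {g : ℝ → V}

/-- The weighted estimate for the mild solution. -/
lemma integral_mul_norm_sq_mild_le (hA : A.IsPositive) (hg : Continuous g) {T : ℝ} (hT : 0 < T)
    {φ m : ℝ → ℝ} (hφ : Continuous φ) (h0 : ∀ x, 0 ≤ φ x)
    (hm : ∀ s ∈ Ioo 0 T, ∀ t ∈ Icc s T, ∫ x in s..t, φ x ≤ m s * (t - s))
    (hint : Integrable (fun s => m s * ‖g s‖ ^ 2) (volJ T)) :
    ∫ t in Ioo 0 T, φ t * ‖mild A g t‖ ^ 2 ≤ ∫ s in Ioo 0 T, m s * ‖g s‖ ^ 2 := by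
  have hkc : Continuous (Function.uncurry fun t s => φ t * kern A (t - s) (g s)) :=
    (hφ.comp continuous_fst).mul (continuous_kern.comp
      (by fun_prop : Continuous fun p : ℝ × ℝ => (p.1 - p.2, g p.2)))
  have hu := continuous_mild (A := A) hg
  have h1 : ∫ t in (0 : ℝ)..T, φ t * ‖mild A g t‖ ^ 2
      ≤ ∫ t in (0 : ℝ)..T, ∫ s in (0 : ℝ)..t, φ t * kern A (t - s) (g s) := by
    refine intervalIntegral.integral_mono_on hT.le
      ((hφ.mul (hu.norm.pow 2)).intervalIntegrable _ _) ?_ fun t ht => ?_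
    · exact (intervalIntegral.continuous_parametric_intervalIntegral_of_continuous
        hkc continuous_id).intervalIntegrable _ _
    · rw [intervalIntegral.integral_const_mul]
      exact mul_le_mul_of_nonneg_left (norm_sq_mild_le hA hg ht.1) (h0 t)
  -- For fixed `s`, the inner integral is now `φ` against a kernel decreasing in `t` with total mass
  -- at most `‖g(s)‖²`.
  rw [integral_triangle_swap hT.le hkc] at h1
  rw [intervalIntegral.integral_of_le hT.le, intervalIntegral.integral_of_le hT.le,
    integral_Ioc_eq_integral_Ioo, integral_Ioc_eq_integral_Ioo] at h1
  refine h1.trans (setIntegral_mono_on ?_ hint measurableSet_Ioo fun s hs => ?_)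
  · have hc : Continuous fun s => ∫ t in s..T, φ t * kern A (t - s) (g s) := by
      have := (intervalIntegral.continuous_parametric_intervalIntegral_of_continuous
        (f := fun s t => φ t * kern A (t - s) (g s)) (μ := volume)
        (hkc.comp continuous_swap) continuous_id (a₀ := T)).neg
      convert! this using 1
      funext s
      exact intervalIntegral.integral_symm _ _
    exact hc.integrableOn_Icc.mono_set Ioo_subset_Icc_self
  · have hm0 : 0 ≤ m s := by
      have := hm s hs T ⟨hs.2.le, le_rfl⟩
      have h2 : 0 ≤ ∫ x in s..T, φ x := intervalIntegral.integral_nonneg hs.2.le fun x _ => h0 x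
      exact nonneg_of_mul_nonneg_left (h2.trans this) (by linarith [hs.2])
    refine (integral_mul_le_of_antitone (k := fun t => kern A (t - s) (g s))
      (k' := fun t => -‖A (sg A ((t - s) / 2) (g s))‖ ^ 2) hs.2.le hφ (fun t => ?_) ?_
      (fun t => by simp only [Left.neg_nonpos_iff]; positivity) (kern_nonneg hA _ _) (hm s hs)).trans ?_
    · exact (hasDerivAt_kern hA (t - s) (g s)).comp_sub_const t s
    · exact ((A.continuous.comp (((continuous_sg A).comp (by fun_prop)).clm_apply
        continuous_const)).norm.pow 2).neg
    · refine mul_le_mul_of_nonneg_left ?_ hm0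
      rw [intervalIntegral.integral_comp_sub_right (fun t => kern A t (g s)), sub_self]
      exact integral_kern_le hA _ _

/-- The `L^p` bound for the mild solution, `p > 2`. -/
lemma integral_norm_rpow_mild_le_of_two_lt (hA : A.IsPositive) (hg : Continuous g) {T : ℝ}
    (hT : 0 < T) {p : ℝ} (hp : 2 < p) :
    ∫ t in Ioo 0 T, ‖mild A g t‖ ^ p ≤ (p / 2) ^ (p / 2) * ∫ t in Ioo 0 T, ‖g t‖ ^ p := by
  have hu := continuous_mild (A := A) hg
  have hp2 : 0 < p - 2 := by linarith
  have hφ : Continuous fun t => ‖mild A g t‖ ^ (p - 2) := hu.norm.rpow_const fun _ => Or.inr hp2.le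
  have h0 : ∀ t, 0 ≤ ‖mild A g t‖ ^ (p - 2) := fun t => by positivity
  set φ := fun t => ‖mild A g t‖ ^ (p - 2) with hφdef
  -- The conjugate exponent of `p/2`: then `φ^q = ‖mild A g‖^p`, and the maximal constant `q/(q-1)`
  -- equals `p/2`.
  set q := p / (p - 2) with hq
  have hq1 : 1 < q := by rw [hq, lt_div_iff₀ hp2]; linarith
  have hg2 : Continuous fun t => ‖g t‖ ^ 2 := hg.norm.pow 2
  have hi : Integrable (fun s => maxFun T φ s * ‖g s‖ ^ 2) (volJ T) := by
    have := integrable_maxFun_rpow_mul (T := T) hφ h0 (q := 1) zero_le_one hg2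
    simpa only [Real.rpow_one, mul_comm] using this
  have h1 := integral_mul_norm_sq_mild_le hA hg hT hφ h0
    (fun s hs t ht => integral_le_maxFun hφ hs ht) hi
  have e1 : ∀ t, φ t * ‖mild A g t‖ ^ 2 = ‖mild A g t‖ ^ p := fun t => by
    rw [hφdef, ← Real.rpow_natCast, ← Real.rpow_add' (norm_nonneg _)]
    · norm_num
    · norm_num; linarith
  have e2 : ∀ t, φ t ^ q = ‖mild A g t‖ ^ p := fun t => by
    rw [hφdef, ← Real.rpow_mul (norm_nonneg _), hq]; congr 1; field_simp
  have hconj : q.HolderConjugate (p / 2) := by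
    rw [Real.holderConjugate_iff]; refine ⟨hq1, ?_⟩; rw [hq]; field_simp; ring
  obtain ⟨C, hC⟩ := exists_maxFun_le (T := T) hφ
  obtain ⟨C', hC'⟩ := isCompact_Icc.exists_bound_of_continuousOn (s := Icc 0 T) hg2.continuousOn
  have hM0 := maxFun_nonneg (T := T) h0
  have hH := integral_mul_le_Lp_mul_Lq_of_nonneg (μ := volJ T) hconj
    (f := maxFun T φ) (g := fun t => ‖g t‖ ^ 2) (Filter.Eventually.of_forall hM0)
    (Filter.Eventually.of_forall fun s => by positivity)
    (MemLp.of_bound (measurable_maxFun hφ h0).aestronglyMeasurable C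
      (Filter.Eventually.of_forall fun s => by rw [Real.norm_of_nonneg (hM0 s)]; exact hC s))
    (MemLp.of_bound hg2.aestronglyMeasurable C' (by
      filter_upwards [ae_restrict_mem measurableSet_Ioo] with x hx
      exact hC' x (Ioo_subset_Icc_self hx)))
  have e3 : ∀ t, (‖g t‖ ^ 2) ^ (p / 2) = ‖g t‖ ^ p := fun t => by
    rw [← Real.rpow_natCast, ← Real.rpow_mul (norm_nonneg _)]; congr 1; push_cast; ring
  have hMx := integral_maxFun_rpow_le hT hφ h0 hq1
  simp only [e1] at h1
  simp only [e2] at hMx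
  simp only [e3] at hH
  set X := ∫ t in Ioo 0 T, ‖mild A g t‖ ^ p with hX
  set Y := ∫ t in Ioo 0 T, ‖g t‖ ^ p with hY
  have hX0 : 0 ≤ X := integral_nonneg fun s => by positivity
  have hY0 : 0 ≤ Y := integral_nonneg fun s => by positivity
  have hqq : q / (q - 1) = p / 2 := by rw [hq]; field_simp; ring
  rw [hqq] at hMx
  have h2 : X ≤ p / 2 * X ^ (1 / q) * Y ^ (1 / (p / 2)) :=
    h1.trans (hH.trans (mul_le_mul_of_nonneg_right hMx (by positivity)))
  -- The chain of estimates reads `X ≤ (p/2) X^{1/q} Y^{2/p}`; divide by `X^{1/q}`.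
  rcases hX0.eq_or_lt with h | hpos
  · rw [← h]; positivity
  · have h4 : X = X ^ (1 / (p / 2)) * X ^ (1 / q) := by
      rw [← Real.rpow_add hpos]
      conv_lhs => rw [← Real.rpow_one X]
      congr 1; rw [hq]; field_simp; ring
    have h5 : X ^ (1 / (p / 2)) ≤ p / 2 * Y ^ (1 / (p / 2)) := by
      refine le_of_mul_le_mul_right ?_ (Real.rpow_pos_of_pos hpos (1 / q))
      rw [← h4]; linarith
    have h6 := Real.rpow_le_rpow (by positivity) h5 (by linarith : 0 ≤ p / 2)
    rw [Real.mul_rpow (by linarith) (by positivity), ← Real.rpow_mul hX0, ← Real.rpow_mul hY0,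
      one_div_mul_cancel (by linarith), Real.rpow_one, Real.rpow_one] at h6
    exact h6

/-- The `L²` bound for the mild solution. -/
lemma integral_norm_sq_mild_le (hA : A.IsPositive) (hg : Continuous g) {T : ℝ} (hT : 0 < T) :
    ∫ t in Ioo 0 T, ‖mild A g t‖ ^ 2 ≤ ∫ t in Ioo 0 T, ‖g t‖ ^ 2 := by
  have h := integral_mul_norm_sq_mild_le hA hg hT (φ := fun _ => 1) (m := fun _ => 1)
    continuous_const (fun _ => zero_le_one) (fun s _ t _ => by simp)
    (by
      have : Continuous fun t => (1 : ℝ) * ‖g t‖ ^ 2 := by fun_prop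
      exact this.integrableOn_Icc.mono_set Ioo_subset_Icc_self)
  simpa using h

/-- The adjoint of the map `mild A` is its conjugate by time reversal. -/
lemma integral_inner_mild (hA : A.IsPositive) {h : ℝ → V} (hg : Continuous g) (hh : Continuous h)
    {T : ℝ} (hT : 0 < T) :
    ∫ t in Ioo 0 T, RCLike.re ⟪h t, mild A g t⟫_ℂ
      = ∫ s in Ioo 0 T, RCLike.re ⟪mild A (fun t => h (T - t)) (T - s), g s⟫_ℂ := by
  have hEc : ∀ f : ℝ × ℝ → V, Continuous f →
      Continuous fun p : ℝ × ℝ => A (sg A (p.1 - p.2) (f p)) := fun f hf =>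
    A.continuous.comp (((continuous_sg A).comp (continuous_fst.sub continuous_snd)).clm_apply hf)
  have h1 : ∀ t, RCLike.re ⟪h t, mild A g t⟫_ℂ
      = ∫ s in (0 : ℝ)..t, RCLike.re ⟪h t, A (sg A (t - s) (g s))⟫_ℂ := fun t =>
    (((RCLike.reCLM (K := ℂ)).comp ((innerSL ℂ (h t)).restrictScalars ℝ)).intervalIntegral_comp_comm
      (((hEc (fun p => g p.2) (by fun_prop)).comp
        (by fun_prop : Continuous fun s : ℝ => (t, s))).intervalIntegrable _ _)).symm
  have h2 : ∀ s, RCLike.re ⟪mild A (fun t => h (T - t)) (T - s), g s⟫_ℂ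
      = ∫ t in s..T, RCLike.re ⟪h t, A (sg A (t - s) (g s))⟫_ℂ := fun s => by
    have e : mild A (fun t => h (T - t)) (T - s) = ∫ t in s..T, A (sg A (t - s) (h t)) := by
      have := intervalIntegral.integral_comp_sub_left
        (fun t => A (sg A (t - s) (h t))) (a := 0) (b := T - s) T
      rw [sub_sub_cancel, sub_zero] at this
      rw [← this, mild]
      congr 1; funext r; congr 3; ring
    have e2 : ∀ t, RCLike.re ⟪h t, A (sg A (t - s) (g s))⟫_ℂ
        = RCLike.re ⟪g s, A (sg A (t - s) (h t))⟫_ℂ := fun t => by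
      rw [← sg_comm A _ (g s), ← sg_inner hA, inner_re_symm]
      exact congrArg RCLike.re (hA.isSelfAdjoint.isSymmetric (g s) _)
    rw [inner_re_symm, e]
    simp only [e2]
    exact (((RCLike.reCLM (K := ℂ)).comp
      ((innerSL ℂ (g s)).restrictScalars ℝ)).intervalIntegral_comp_comm
      (((hEc (fun p => h p.1) (by fun_prop)).comp
        (by fun_prop : Continuous fun t : ℝ => (t, s))).intervalIntegrable _ _)).symm
  have h3 := integral_triangle_swap hT.le (K := fun t s => RCLike.re ⟪h t, A (sg A (t - s) (g s))⟫_ℂ)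
    (RCLike.continuous_re.comp ((hh.comp continuous_fst).inner (hEc (fun p => g p.2) (by fun_prop))))
  rw [intervalIntegral.integral_of_le hT.le, intervalIntegral.integral_of_le hT.le,
    integral_Ioc_eq_integral_Ioo, integral_Ioc_eq_integral_Ioo] at h3
  simp only [h1, h2, h3]

/-- The `L^p` bound for the mild solution, `p < 2`. -/
lemma integral_norm_rpow_mild_le_of_lt_two (hA : A.IsPositive) (hg : Continuous g) {T : ℝ}
    (hT : 0 < T) {p p' : ℝ} (hp : p < 2) (hpp : p.HolderConjugate p') :
    ∫ t in Ioo 0 T, ‖mild A g t‖ ^ p ≤ ((p' / 2) ^ (1 / 2 : ℝ)) ^ p * ∫ t in Ioo 0 T, ‖g t‖ ^ p := by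
  have hp1 := hpp.lt
  have hp'2 : 2 < p' := by
    rw [hpp.conjugate_eq, lt_div_iff₀ (by linarith)]; linarith
  have hp1' : 0 < p - 1 := by linarith
  have hu := continuous_mild (A := A) hg
  have hnorm : ∀ t, ‖(‖mild A g t‖ ^ (p - 2)) • mild A g t‖ = ‖mild A g t‖ ^ (p - 1) := fun t => by
    rw [norm_smul, Real.norm_of_nonneg (by positivity),
      ← Real.rpow_add_one' (norm_nonneg _) (by linarith)]
    congr 1; ring
  -- Here `p - 2 < 0`, so at a zero of `mild A g` continuity comes from the norm of the product
  -- being `‖mild A g‖^{p-1}`.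
  have hh : Continuous fun t => (‖mild A g t‖ ^ (p - 2)) • mild A g t := by
    refine continuous_iff_continuousAt.2 fun t => ?_
    by_cases h0 : mild A g t = 0
    · rw [ContinuousAt, h0, smul_zero]
      refine squeeze_zero_norm (a := fun t => ‖mild A g t‖ ^ (p - 1)) (fun s => ?_) ?_
      · rw [hnorm]
      · have : ContinuousAt (fun t => ‖mild A g t‖ ^ (p - 1)) t :=
          (hu.norm.rpow_const fun _ => Or.inr hp1'.le).continuousAt
        simpa [ContinuousAt, h0, Real.zero_rpow hp1'.ne'] using this
    · exact (hu.continuousAt.norm.rpow_const (Or.inl (norm_ne_zero_iff.2 h0))).smul hu.continuousAt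
  set h : ℝ → V := fun t => (‖mild A g t‖ ^ (p - 2)) • mild A g t with hdef
  have e1 : ∀ t, RCLike.re ⟪h t, mild A g t⟫_ℂ = ‖mild A g t‖ ^ p := fun t => by
    simp only [hdef]
    rw [RCLike.real_smul_eq_coe_smul (K := ℂ), inner_smul_left, RCLike.conj_ofReal,
      RCLike.re_ofReal_mul, inner_self_eq_norm_sq, ← Real.rpow_natCast, ← Real.rpow_add' (norm_nonneg _)]
    · norm_num
    · norm_num; linarith
  have e2 : ∀ t, ‖h t‖ ^ p' = ‖mild A g t‖ ^ p := fun t => by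
    rw [hnorm, ← Real.rpow_mul (norm_nonneg _), hpp.conjugate_eq]; congr 1; field_simp
  -- The adjoint applied to the function `h` dual to `mild A g`. Being a time-reversed mild
  -- solution, it obeys the bound for the exponent `p' > 2`.
  set z := fun s => mild A (fun t => h (T - t)) (T - s) with hz
  have hhr : Continuous fun t => h (T - t) := hh.comp (by fun_prop)
  have hzc : Continuous z := (continuous_mild hhr).comp (by fun_prop)
  have hdual := integral_inner_mild hA hg hh hT
  have hrev : ∀ f : ℝ → ℝ, ∫ s in Ioo 0 T, f (T - s) = ∫ s in Ioo 0 T, f s := fun f => by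
    rw [← integral_Ioc_eq_integral_Ioo, ← integral_Ioc_eq_integral_Ioo,
      ← intervalIntegral.integral_of_le hT.le, ← intervalIntegral.integral_of_le hT.le]
    simp
  have hzb := integral_norm_rpow_mild_le_of_two_lt hA hhr hT hp'2
  rw [← hrev, hrev (fun t => ‖h t‖ ^ p')] at hzb
  simp only [e2] at hzb
  simp only [e1] at hdual
  have hmem : ∀ (f : ℝ → V) (r : ℝ≥0∞), Continuous f → MemLp (fun t => ‖f t‖) r (volJ T) := fun f r hf => by
    obtain ⟨C, hC⟩ := isCompact_Icc.exists_bound_of_continuousOn (s := Icc 0 T) hf.norm.continuousOn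
    refine MemLp.of_bound hf.norm.aestronglyMeasurable C ?_
    filter_upwards [ae_restrict_mem measurableSet_Ioo] with x hx
    exact hC x (Ioo_subset_Icc_self hx)
  have hH := integral_mul_le_Lp_mul_Lq_of_nonneg (μ := volJ T) hpp
    (f := fun t => ‖g t‖) (g := fun t => ‖z t‖) (Filter.Eventually.of_forall fun _ => norm_nonneg _)
    (Filter.Eventually.of_forall fun _ => norm_nonneg _) (hmem g _ hg) (hmem z _ hzc)
  have h1 : ∫ s in Ioo 0 T, RCLike.re ⟪z s, g s⟫_ℂ ≤ ∫ s in Ioo 0 T, ‖g s‖ * ‖z s‖ := by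
    refine setIntegral_mono
      ((RCLike.continuous_re.comp (hzc.inner hg)).integrableOn_Icc.mono_set Ioo_subset_Icc_self)
      ((hg.norm.mul hzc.norm).integrableOn_Icc.mono_set Ioo_subset_Icc_self) fun s => ?_
    rw [mul_comm]; exact re_inner_le_norm _ _
  set X := ∫ t in Ioo 0 T, ‖mild A g t‖ ^ p with hX
  set Y := ∫ t in Ioo 0 T, ‖g t‖ ^ p with hY
  set Z := ∫ t in Ioo 0 T, ‖z t‖ ^ p' with hZ
  have hX0 : 0 ≤ X := integral_nonneg fun s => by positivity
  have hY0 : 0 ≤ Y := integral_nonneg fun s => by positivity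
  have hZ0 : 0 ≤ Z := integral_nonneg fun s => by positivity
  have hZX : Z ^ (1 / p') ≤ (p' / 2) ^ (1 / 2 : ℝ) * X ^ (1 / p') := by
    have := Real.rpow_le_rpow hZ0 hzb (by positivity : 0 ≤ 1 / p')
    rw [Real.mul_rpow (by positivity) hX0, ← Real.rpow_mul (by positivity)] at this
    convert! this using 3
    field_simp
  have h2 : X ≤ Y ^ (1 / p) * ((p' / 2) ^ (1 / 2 : ℝ) * X ^ (1 / p')) :=
    (hdual.le.trans h1).trans (hH.trans (mul_le_mul_of_nonneg_left hZX (by positivity)))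
  rcases hX0.eq_or_lt with h | hpos
  · rw [← h]; positivity
  · have h4 : X = X ^ (1 / p) * X ^ (1 / p') := by
      rw [← Real.rpow_add hpos, one_div, one_div, hpp.inv_add_inv_eq_one, Real.rpow_one]
    have h5 : X ^ (1 / p) ≤ (p' / 2) ^ (1 / 2 : ℝ) * Y ^ (1 / p) := by
      refine le_of_mul_le_mul_right ?_ (Real.rpow_pos_of_pos hpos (1 / p'))
      rw [← h4]; linarith
    have h6 := Real.rpow_le_rpow (by positivity) h5 (by linarith : 0 ≤ p)
    rw [Real.mul_rpow (by positivity) (by positivity), ← Real.rpow_mul hX0, ← Real.rpow_mul hY0,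
      one_div_mul_cancel (by linarith), Real.rpow_one, Real.rpow_one] at h6
    exact h6

end

/-! ### The Volterra operator -/

section

variable {X : Type*} [NormedAddCommGroup X] {T : ℝ} {r : Expo}

lemma Expo.pos (r : Expo) : 0 < r.1 := zero_lt_one.trans r.2

lemma Expo.toReal_ofReal (r : Expo) : (ENNReal.ofReal r.1).toReal = r.1 :=
  ENNReal.toReal_ofReal r.pos.le

lemma Expo.ofReal_ne_zero (r : Expo) : ENNReal.ofReal r.1 ≠ 0 := by simpa using r.pos

lemma LJ.integrable (u : LJ T r X) : Integrable u (volJ T) :=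
  (Lp.memLp u).integrable (Fact.out (p := 1 ≤ ENNReal.ofReal r.1))

lemma norm_LJ_eq (u : LJ T r X) : ‖u‖ = (∫ t in Ioo 0 T, ‖u t‖ ^ r.1) ^ (1 / r.1) := by
  rw [Lp.norm_def, (Lp.memLp u).eLpNorm_eq_integral_rpow_norm r.ofReal_ne_zero ENNReal.ofReal_ne_top,
    ENNReal.toReal_ofReal (by positivity), r.toReal_ofReal, one_div]

lemma norm_toLp_eq {f : ℝ → X} (hf : MemLp f (ENNReal.ofReal r.1) (volJ T)) :
    ‖hf.toLp‖ = (∫ t in Ioo 0 T, ‖f t‖ ^ r.1) ^ (1 / r.1) := by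
  rw [norm_LJ_eq]
  congr 1
  refine integral_congr_ae ?_
  filter_upwards [hf.coeFn_toLp] with t ht
  rw [ht]

lemma memLp_of_continuousOn {f : ℝ → X} (hf : ContinuousOn f (Icc 0 T)) (p : ℝ≥0∞) :
    MemLp f p (volJ T) := by
  obtain ⟨C, hC⟩ := isCompact_Icc.exists_bound_of_continuousOn hf
  refine MemLp.of_bound ((hf.mono Ioo_subset_Icc_self).aestronglyMeasurable measurableSet_Ioo) C ?_
  filter_upwards [ae_restrict_mem measurableSet_Ioo] with x hx
  exact hC x (Ioo_subset_Icc_self hx)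

lemma exists_integral_norm_le (T : ℝ) (r : Expo) : ∃ C : ℝ, 0 ≤ C ∧
    ∀ {X : Type*} [NormedAddCommGroup X] (u : LJ T r X), ∫ t in Ioo 0 T, ‖u t‖ ≤ C * ‖u‖ := by
  refine ⟨((volJ T) univ ^ (1 / (1 : ℝ≥0∞).toReal - 1 / (ENNReal.ofReal r.1).toReal)).toReal,
    ENNReal.toReal_nonneg, fun {X} _ u => ?_⟩
  have h := eLpNorm_le_eLpNorm_mul_rpow_measure_univ (μ := volJ T)
    (Fact.out (p := 1 ≤ ENNReal.ofReal r.1)) (Lp.aestronglyMeasurable u)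
  have h1 : ∫ t in Ioo 0 T, ‖u t‖ = (eLpNorm u 1 (volJ T)).toReal := by
    rw [integral_norm_eq_lintegral_enorm (Lp.aestronglyMeasurable u), eLpNorm_one_eq_lintegral_enorm]
  rw [h1, Lp.norm_def, mul_comm, ← ENNReal.toReal_mul]
  refine ENNReal.toReal_mono (ENNReal.mul_ne_top (Lp.eLpNorm_ne_top u) ?_) h
  refine ENNReal.rpow_ne_top_of_nonneg ?_ (measure_ne_top _ _)
  rw [r.toReal_ofReal, ENNReal.toReal_one, sub_nonneg]
  exact one_div_le_one_div_of_le zero_lt_one r.2.le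

lemma intervalIntegrable_of_integrable {u : ℝ → X} (hu : Integrable u (volJ T)) {a b : ℝ}
    (ha : a ∈ Icc 0 T) (hb : b ∈ Icc 0 T) : IntervalIntegrable u volume a b := by
  have : IntegrableOn u (Icc 0 T) := by rwa [integrableOn_Icc_iff_integrableOn_Ioo]
  exact (this.mono_set (uIcc_subset_Icc ha hb)).intervalIntegrable

variable [NormedSpace ℂ X]

lemma integral_congr_volJ {u v : ℝ → X} (h : u =ᵐ[volJ T] v) {t : ℝ} (ht : t ∈ Icc 0 T) :
    ∫ s in (0 : ℝ)..t, u s = ∫ s in (0 : ℝ)..t, v s := by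
  rw [intervalIntegral.integral_of_le ht.1, intervalIntegral.integral_of_le ht.1,
    integral_Ioc_eq_integral_Ioo, integral_Ioc_eq_integral_Ioo]
  exact integral_congr_ae (ae_restrict_of_ae_restrict_of_subset (Ioo_subset_Ioo_right ht.2) h)

lemma continuousOn_primitive {u : ℝ → X} (hu : Integrable u (volJ T)) :
    ContinuousOn (fun t => ∫ s in (0 : ℝ)..t, u s) (Icc 0 T) := by
  have : IntegrableOn u (Icc 0 T) := by rwa [integrableOn_Icc_iff_integrableOn_Ioo]
  rcases le_or_gt 0 T with h | h
  · rw [← uIcc_of_le h] at this ⊢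
    exact intervalIntegral.continuousOn_primitive_interval this
  · simp [h]

lemma norm_primitive_le {u : ℝ → X} (hu : Integrable u (volJ T)) {t : ℝ} (ht : t ∈ Icc 0 T) :
    ‖∫ s in (0 : ℝ)..t, u s‖ ≤ ∫ s in Ioo 0 T, ‖u s‖ := by
  refine (intervalIntegral.norm_integral_le_integral_norm ht.1).trans ?_
  rw [intervalIntegral.integral_of_le ht.1, integral_Ioc_eq_integral_Ioo]
  exact setIntegral_mono_set hu.norm (Filter.Eventually.of_forall fun _ => norm_nonneg _)
    (Ioo_subset_Ioo_right ht.2).eventuallyLE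

/-- The Volterra operator `u ↦ ∫_0^t u` on `L^r(J; X)`. -/
def volterra (T : ℝ) (r : Expo) (X : Type*) [NormedAddCommGroup X]
    [NormedSpace ℂ X] : LJ T r X →L[ℂ] LJ T r X :=
  LinearMap.mkContinuousOfExistsBound
    { toFun := fun u => (memLp_of_continuousOn (continuousOn_primitive (LJ.integrable u)) _).toLp
      map_add' := fun u v => by
        rw [← MemLp.toLp_add]
        refine MemLp.toLp_congr _ _ ?_
        filter_upwards [ae_restrict_mem measurableSet_Ioo] with t ht
        have ht' := Ioo_subset_Icc_self ht
        have h0 : (0 : ℝ) ∈ Icc 0 T := ⟨le_rfl, ht'.1.trans ht'.2⟩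
        rw [integral_congr_volJ (Lp.coeFn_add u v) ht', Pi.add_apply]
        exact intervalIntegral.integral_add (intervalIntegrable_of_integrable u.integrable h0 ht')
          (intervalIntegrable_of_integrable v.integrable h0 ht')
      map_smul' := fun c u => by
        rw [RingHom.id_apply, ← MemLp.toLp_const_smul]
        refine MemLp.toLp_congr _ _ ?_
        filter_upwards [ae_restrict_mem measurableSet_Ioo] with t ht
        rw [integral_congr_volJ (Lp.coeFn_smul c u) (Ioo_subset_Icc_self ht), Pi.smul_apply]
        exact intervalIntegral.integral_smul _ _ }
    (by
      obtain ⟨C, hC0, hC⟩ := exists_integral_norm_le T r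
      refine ⟨measureUnivNNReal (volJ T) ^ (ENNReal.ofReal r.1).toReal⁻¹ * C, fun u => ?_⟩
      have h : ∀ᵐ t ∂(volJ T), ‖MemLp.toLp _ (memLp_of_continuousOn (continuousOn_primitive
          (LJ.integrable u)) (ENNReal.ofReal r.1)) t‖ ≤ C * ‖u‖ := by
        filter_upwards [MemLp.coeFn_toLp (memLp_of_continuousOn (continuousOn_primitive
          (LJ.integrable u)) (ENNReal.ofReal r.1)), ae_restrict_mem measurableSet_Ioo] with t h1 ht
        rw [h1]
        exact (norm_primitive_le u.integrable (Ioo_subset_Icc_self ht)).trans (hC u)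
      exact (Lp.norm_le_of_ae_bound (mul_nonneg hC0 (norm_nonneg u)) h).trans (le_of_eq (by ring)))

lemma volterra_coeFn (u : LJ T r X) :
    ∀ᵐ t ∂(volJ T), volterra T r X u t = ∫ s in (0 : ℝ)..t, u s :=
  MemLp.coeFn_toLp (memLp_of_continuousOn (continuousOn_primitive u.integrable) _)

lemma volterra_comm {Y : Type*} [NormedAddCommGroup Y] [NormedSpace ℂ Y] [CompleteSpace X]
    [CompleteSpace Y] (L : X →L[ℂ] Y) (u : LJ T r X) :
    volterra T r Y (L.compLp u) = L.compLp (volterra T r X u) := by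
  refine Lp.ext ?_
  filter_upwards [volterra_coeFn (L.compLp u), L.coeFn_compLp (volterra T r X u), volterra_coeFn u,
    ae_restrict_mem measurableSet_Ioo] with t h1 h2 h3 ht
  have ht' := Ioo_subset_Icc_self ht
  rw [h1, h2, h3, integral_congr_volJ (L.coeFn_compLp u) ht']
  exact L.intervalIntegral_comp_comm (intervalIntegrable_of_integrable u.integrable
    ⟨le_rfl, ht'.1.trans ht'.2⟩ ht')

/-- Lebesgue differentiation of the primitive. -/
lemma ae_eq_zero_of_primitive_eq_zero [CompleteSpace X] {u : ℝ → X} (hu : Integrable u (volJ T))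
    (h : ∀ t ∈ Ioo 0 T, ∫ s in (0 : ℝ)..t, u s = 0) : u =ᵐ[volJ T] 0 := by
  have hT : T ≤ 0 ∨ 0 < T := le_or_gt T 0
  rcases hT with hT | hT
  · simp [volJ, Ioo_eq_empty_of_le hT, Filter.EventuallyEq]
  have hi := (intervalIntegrable_of_integrable hu ⟨le_rfl, hT.le⟩ ⟨hT.le, le_rfl⟩).ae_hasDerivAt_integral
  rw [Filter.EventuallyEq, ae_restrict_iff' measurableSet_Ioo]
  filter_upwards [hi] with t ht htT
  have h1 := ht (by rw [uIcc_of_le hT.le]; exact Ioo_subset_Icc_self htT) 0 left_mem_uIcc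
  have h2 : HasDerivAt (fun t => ∫ s in (0 : ℝ)..t, u s) 0 t := by
    refine (hasDerivAt_const t (0 : X)).congr_of_eventuallyEq ?_
    filter_upwards [Ioo_mem_nhds htT.1 htT.2] with s hs
    exact h s hs
  exact h1.unique h2

end

/-! ### The autonomous problem -/

section

variable {V : Type*} [NormedAddCommGroup V] [InnerProductSpace ℂ V] [CompleteSpace V] {T : ℝ}
  {r : Expo}

/-- Uniqueness for `(S u)' + u = 0`, `S u (0) = 0`. -/
lemma ae_eq_zero_of_add_primitive {S : V →L[ℂ] V} (hS : S.IsPositive) {u : ℝ → V}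
    (hu : Integrable u (volJ T)) (h : ∀ᵐ t ∂(volJ T), S (u t) + ∫ s in (0 : ℝ)..t, u s = 0) :
    u =ᵐ[volJ T] 0 := by
  rcases le_or_gt T 0 with hT | hT
  · simp [volJ, Ioo_eq_empty_of_le hT, Filter.EventuallyEq]
  -- `u` is merely integrable, so the equation is integrated once more. For `y = ∫v` one has `S v =
  -- -y`, and the energy `Re⟨y, S y⟩` has derivative `-2‖y‖²`. Starting at `0` and nonnegative, it
  -- vanishes identically, hence so do its derivative and `y`.
  set v : ℝ → V := fun t => ∫ s in (0 : ℝ)..t, u s with hv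
  have hvc : ContinuousOn v (Icc 0 T) := continuousOn_primitive hu
  set y : ℝ → V := fun t => ∫ s in (0 : ℝ)..t, v s with hy
  have h0 : (0 : ℝ) ∈ Icc 0 T := ⟨le_rfl, hT.le⟩
  have hvi : Integrable v (volJ T) := hvc.integrableOn_Icc.mono_set Ioo_subset_Icc_self
  have hyc : ContinuousOn y (Icc 0 T) := continuousOn_primitive hvi
  have hyd : ∀ t ∈ Ioo 0 T, HasDerivAt y (v t) t := fun t ht =>
    intervalIntegral.integral_hasDerivAt_right
      (intervalIntegrable_of_integrable hvi h0 (Ioo_subset_Icc_self ht))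
      ((hvc.mono Ioo_subset_Icc_self).stronglyMeasurableAtFilter isOpen_Ioo t ht)
      (hvc.continuousAt (Icc_mem_nhds ht.1 ht.2))
  have hSv : ∀ t ∈ Icc 0 T, S (v t) = - y t := fun t ht => by
    have h1 : (fun t => S (u t)) =ᵐ[volJ T] fun t => -v t := by
      filter_upwards [h] with t ht using eq_neg_of_add_eq_zero_left ht
    rw [hv, ← S.intervalIntegral_comp_comm (intervalIntegrable_of_integrable hu h0 ht),
      integral_congr_volJ h1 ht, intervalIntegral.integral_neg]
  set E : ℝ → ℝ := fun t => RCLike.re ⟪y t, S (y t)⟫_ℂ with hE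
  have hEd : ∀ t ∈ Ioo 0 T, HasDerivAt E (-2 * ‖y t‖ ^ 2) t := fun t ht => by
    have h1 := hyd t ht
    have h2 := (S.restrictScalars ℝ).hasFDerivAt.comp_hasDerivAt t h1
    have h3 := (RCLike.reCLM (K := ℂ)).hasFDerivAt.comp_hasDerivAt t (h1.inner ℂ h2)
    convert! h3 using 1
    have e1 : ⟪v t, S (y t)⟫_ℂ = ⟪S (v t), y t⟫_ℂ := (hS.isSelfAdjoint.isSymmetric _ _).symm
    have e3 := inner_self_eq_norm_sq (𝕜 := ℂ) (y t)
    simp only [ContinuousLinearMap.coe_restrictScalars', Function.comp, e1,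
      hSv t (Ioo_subset_Icc_self ht), inner_neg_left, inner_neg_right, RCLike.reCLM_apply, map_add,
      map_neg, e3]
    ring
  have hEc : ContinuousOn E (Icc 0 T) :=
    RCLike.continuous_re.comp_continuousOn (hyc.inner (S.continuous.comp_continuousOn hyc))
  have hanti : AntitoneOn E (Icc 0 T) := by
    refine antitoneOn_of_deriv_nonpos (convex_Icc 0 T) hEc ?_ ?_
    · rw [interior_Icc]
      exact fun t ht => (hEd t ht).differentiableAt.differentiableWithinAt
    · rw [interior_Icc]
      intro t ht
      rw [(hEd t ht).deriv]
      nlinarith [sq_nonneg ‖y t‖]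
  have hE0 : ∀ t ∈ Icc 0 T, E t = 0 := fun t ht =>
    le_antisymm ((hanti h0 ht ht.1).trans (by simp [hE, hy])) (hS.re_inner_nonneg_right _)
  have hy0 : ∀ t ∈ Ioo 0 T, y t = 0 := fun t ht => by
    have : HasDerivAt E 0 t := by
      refine (hasDerivAt_const t (0 : ℝ)).congr_of_eventuallyEq ?_
      filter_upwards [Ioo_mem_nhds ht.1 ht.2] with s hs
      exact hE0 s (Ioo_subset_Icc_self hs)
    have := (hEd t ht).unique this
    have : ‖y t‖ ^ 2 = 0 := by linarith
    simpa using this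
  refine ae_eq_zero_of_primitive_eq_zero hu fun t ht => ?_
  have : HasDerivAt y 0 t := by
    refine (hasDerivAt_const t (0 : V)).congr_of_eventuallyEq ?_
    filter_upwards [Ioo_mem_nhds ht.1 ht.2] with s hs
    exact hy0 s hs
  exact (hyd t ht).unique this

lemma eq_zero_of_add_volterra {S : V →L[ℂ] V} (hS : S.IsPositive) {u : LJ T r V}
    (h : S.compLpL _ (volJ T) u + volterra T r V u = 0) : u = 0 := by
  refine Lp.ext ((ae_eq_zero_of_add_primitive hS u.integrable ?_).trans (Lp.coeFn_zero _ _ _).symm)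
  have h' := Lp.ext_iff.1 h
  filter_upwards [h', Lp.coeFn_add (S.compLpL _ (volJ T) u) (volterra T r V u),
    S.coeFn_compLpL u, volterra_coeFn u, Lp.coeFn_zero V (ENNReal.ofReal r.1) (volJ T)]
    with t h1 h2 h3 h4 h5
  rw [← h3, ← h4, ← Pi.add_apply, ← h2, h1, h5, Pi.zero_apply]

/-- The constant in the autonomous estimate. -/
def mrConst (r : Expo) : ℝ := (max r.1 r.conj.1 / 2) ^ (1 / 2 : ℝ)

lemma Expo.holderConjugate (r : Expo) : r.1.HolderConjugate r.conj.1 :=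
  Real.HolderConjugate.conjExponent r.2

lemma mrConst_nonneg (r : Expo) : 0 ≤ mrConst r :=
  Real.rpow_nonneg (div_nonneg (r.pos.le.trans (le_max_left _ _)) zero_le_two) _

lemma mrConst_two {r : Expo} (h : r.1 = 2) : mrConst r = 1 := by
  have : r.conj.1 = 2 := by simp only [Expo.conj, Real.conjExponent, h]; norm_num
  simp [mrConst, h, this]

lemma integral_norm_rpow_mild_le {A : V →L[ℂ] V} (hA : A.IsPositive) {g : ℝ → V}
    (hg : Continuous g) (hT : 0 < T) (r : Expo) :
    ∫ t in Ioo 0 T, ‖mild A g t‖ ^ r.1 ≤ mrConst r ^ r.1 * ∫ t in Ioo 0 T, ‖g t‖ ^ r.1 := by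
  have hY0 : 0 ≤ ∫ t in Ioo 0 T, ‖g t‖ ^ r.1 := integral_nonneg fun s => by positivity
  have h1 := r.2
  have hc := r.holderConjugate
  have hcpos := r.conj.pos
  rcases lt_trichotomy r.1 2 with h | h | h
  · refine (integral_norm_rpow_mild_le_of_lt_two hA hg hT h hc).trans ?_
    refine mul_le_mul_of_nonneg_right ?_ hY0
    refine Real.rpow_le_rpow (by positivity) ?_ r.pos.le
    refine Real.rpow_le_rpow (by positivity) ?_ (by norm_num)
    gcongr
    exact le_max_right _ _
  · rw [mrConst_two h, h]
    simpa using integral_norm_sq_mild_le hA hg hT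
  · refine (integral_norm_rpow_mild_le_of_two_lt hA hg hT h).trans ?_
    refine mul_le_mul_of_nonneg_right ?_ hY0
    rw [mrConst, ← Real.rpow_mul (by positivity), one_div_mul_eq_div]
    refine Real.rpow_le_rpow (by linarith) ?_ (by linarith)
    gcongr
    exact le_max_left _ _

/-- A bounded solution map given on a dense set extends to the whole space. -/
lemma exists_solution_of_dense {Y : Type*} [NormedAddCommGroup Y] [NormedSpace ℂ Y] [CompleteSpace Y]
    {L M : Y →L[ℂ] Y} (hL : ∀ u, L u = 0 → u = 0) {C : ℝ} (hC : 0 ≤ C) {D : Set Y} (hD : Dense D)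
    (hsub : ∀ g ∈ D, ∀ h ∈ D, ∃ u, L u = M (g - h) ∧ ‖u‖ ≤ C * ‖g - h‖)
    (hsol : ∀ g ∈ D, ∃ u, L u = M g ∧ ‖u‖ ≤ C * ‖g‖) (g : Y) :
    ∃ u, L u = M g ∧ ‖u‖ ≤ C * ‖g‖ := by
  obtain ⟨x, hxD, hx⟩ := mem_closure_iff_seq_limit.1 (hD g)
  choose u hu1 hu2 using fun n => hsol (x n) (hxD n)
  have hdiff : ∀ n m, ‖u n - u m‖ ≤ C * ‖x n - x m‖ := fun n m => by
    -- Uniqueness identifies `u n - u m` with the solution for the difference of the data, so the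
    -- bound makes `u` a Cauchy sequence.
    obtain ⟨w, hw1, hw2⟩ := hsub _ (hxD n) _ (hxD m)
    have : u n - u m = w := by
      rw [← sub_eq_zero]
      refine hL _ ?_
      rw [map_sub, map_sub, hu1, hu1, hw1, map_sub, sub_self]
    rwa [this]
  have hcau : CauchySeq u := by
    refine Metric.cauchySeq_iff.2 fun ε hε => ?_
    obtain ⟨N, hN⟩ := Metric.cauchySeq_iff.1 hx.cauchySeq (ε / (C + 1)) (by positivity)
    refine ⟨N, fun m hm n hn => ?_⟩
    have h1 := hN m hm n hn
    rw [dist_eq_norm] at h1 ⊢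
    rw [lt_div_iff₀ (by positivity)] at h1
    nlinarith [hdiff m n, norm_nonneg (x m - x n)]
  obtain ⟨v, hv⟩ := cauchySeq_tendsto_of_complete hcau
  refine ⟨v, ?_, ?_⟩
  · refine tendsto_nhds_unique ((L.continuous.tendsto v).comp hv) ?_
    convert! (M.continuous.tendsto g).comp hx using 1
    funext n; exact hu1 n
  · exact le_of_tendsto_of_tendsto' hv.norm (hx.norm.const_mul C) hu2

/-- A singular limit: solvability with `S + ε` in place of `S`, uniformly in `ε > 0`, gives
solvability. -/
lemma exists_solution_of_regularised {Y : Type*} [NormedAddCommGroup Y] [NormedSpace ℂ Y]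
    [CompleteSpace Y] {S I : Y →L[ℂ] Y} (hSI : ∀ u, S (I u) = I (S u)) {C : ℝ} (hC : 0 ≤ C)
    (huniq : ∀ ε : ℝ, 0 ≤ ε → ∀ u, S u + (ε : ℂ) • u + I u = 0 → u = 0)
    (hsol : ∀ ε : ℝ, 0 < ε → ∀ g, ∃ u, S u + (ε : ℂ) • u + I u = I g ∧ ‖u‖ ≤ C * ‖g‖)
    (hI : DenseRange I) (g : Y) : ∃ u, S u + I u = I g ∧ ‖u‖ ≤ C * ‖g‖ := by
  have hrange : ∀ k, ∃ u, S u + I u = I (I k) ∧ ‖u‖ ≤ C * ‖I k‖ := fun k => by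
    have hε : ∀ n : ℕ, (0 : ℝ) < 1 / (n + 1) := fun n => by positivity
    choose x hx1 hx2 using fun n : ℕ => hsol _ (hε n) k
    choose u hu1 hu2 using fun n : ℕ => hsol _ (hε n) (I k)
    -- `S` commutes with `I`, so `I (x n)` solves the problem with datum `I k`. The regularised
    -- solutions therefore lie in the range of `I`, with preimages bounded uniformly in `n`.
    have hux : ∀ n, u n = I (x n) := fun n => by
      rw [← sub_eq_zero]
      refine huniq _ (hε n).le _ ?_
      have h2 : I (S (x n) + ((1 / ((n : ℝ) + 1) : ℝ) : ℂ) • x n + I (x n)) = I (I k) := by rw [hx1]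
      have h1 := hu1 n
      rw [map_add, map_add, I.map_smul, ← hSI] at h2
      rw [map_sub, map_sub, smul_sub]
      rw [← h2] at h1
      rw [← sub_eq_zero] at h1
      rw [← h1]; abel
    have hdiff : ∀ n m : ℕ, ‖u n - u m‖ ≤ |(1 / ((m : ℝ) + 1)) - 1 / ((n : ℝ) + 1)| * (C * (C * ‖k‖)) :=
      fun n m => by
        set a : ℝ := 1 / ((n : ℝ) + 1) with ha
        set b : ℝ := 1 / ((m : ℝ) + 1) with hb
        -- `u n - u m` solves the problem with parameter `a` and right-hand side `(b - a) u m = I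
        -- ((b - a) x m)`. This is again of the form `I g`, so the uniform bound applies and
        -- produces the factor `|b - a|`.
        obtain ⟨w, hw1, hw2⟩ := hsol a (hε n) (((b - a : ℝ) : ℂ) • x m)
        have : u n - u m = w := by
          rw [← sub_eq_zero]
          refine huniq a (hε n).le _ ?_
          have h1 := hu1 n
          have h2 := hu1 m
          rw [← h2] at h1
          rw [I.map_smul, ← hux m] at hw1
          rw [map_sub, map_sub, map_sub, map_sub, smul_sub, smul_sub]
          rw [Complex.ofReal_sub, sub_smul] at hw1
          rw [← sub_eq_zero] at h1 hw1
          calc _ = (S (u n) + (a : ℂ) • u n + I (u n) - (S (u m) + (b : ℂ) • u m + I (u m)))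
                - (S w + (a : ℂ) • w + I w - ((b : ℂ) • u m - (a : ℂ) • u m)) := by abel
            _ = 0 := by rw [h1, hw1, sub_zero]
        rw [this]
        refine hw2.trans ?_
        rw [norm_smul, Complex.norm_real, Real.norm_eq_abs]
        calc C * (|b - a| * ‖x m‖) ≤ C * (|b - a| * (C * ‖k‖)) := by
              gcongr; exact hx2 m
          _ = _ := by ring
    have hlim : Filter.Tendsto (fun n : ℕ => 1 / ((n : ℝ) + 1)) Filter.atTop (nhds 0) :=
      tendsto_one_div_add_atTop_nhds_zero_nat
    have hcau : CauchySeq u := by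
      refine Metric.cauchySeq_iff.2 fun ε hε' => ?_
      set B := C * (C * ‖k‖) with hB
      have hB0 : 0 ≤ B := by positivity
      obtain ⟨N, hN⟩ := Metric.cauchySeq_iff.1 hlim.cauchySeq (ε / (B + 1)) (by positivity)
      refine ⟨N, fun m hm n hn => ?_⟩
      have h1 := hN n hn m hm
      rw [Real.dist_eq, lt_div_iff₀ (by positivity)] at h1
      rw [dist_eq_norm]
      have := hdiff m n
      nlinarith [abs_nonneg ((1 / ((n : ℝ) + 1)) - 1 / ((m : ℝ) + 1))]
    obtain ⟨v, hv⟩ := cauchySeq_tendsto_of_complete hcau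
    refine ⟨v, ?_, le_of_tendsto' hv.norm hu2⟩
    have h1 : Filter.Tendsto (fun n : ℕ => S (u n) + ((1 / ((n : ℝ) + 1) : ℝ) : ℂ) • u n + I (u n))
        Filter.atTop (nhds (S v + ((0 : ℝ) : ℂ) • v + I v)) :=
      (((S.continuous.tendsto v).comp hv).add (((Complex.continuous_ofReal.tendsto 0).comp hlim).smul hv)).add ((I.continuous.tendsto v).comp hv)
    simp only [hu1, Complex.ofReal_zero, zero_smul, add_zero] at h1
    exact tendsto_nhds_unique h1 tendsto_const_nhds
  refine exists_solution_of_dense (L := S + I) (fun u hu => huniq 0 le_rfl u ?_) hC hI ?_ ?_ g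
  · simpa using hu
  · rintro _ ⟨k, rfl⟩ _ ⟨l, rfl⟩
    rw [← map_sub]
    exact hrange _
  · rintro _ ⟨k, rfl⟩
    exact hrange k

lemma dense_contDiff (E : Type*) [NormedAddCommGroup E] [NormedSpace ℂ E] (T : ℝ) (r : Expo) :
    Dense {f : LJ T r E | ∃ g : ℝ → E, f =ᵐ[volJ T] g ∧ ContDiff ℝ ∞ g} := by
  refine (Lp.dense_hasCompactSupport_contDiff (F := E) (μ := volJ T)
    (p := ENNReal.ofReal r.1) ENNReal.ofReal_ne_top).mono ?_
  rintro f ⟨g, h1, -, h2⟩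
  exact ⟨g, h1, h2⟩

/-- `mild A g = A w` for `w = preMild A g`, and `S` undoes `A`. The equation is then the integrated
form `w = ∫g - ∫ mild A g`. -/
lemma exists_solution_of_continuous {S A : V →L[ℂ] V} (hA : A.IsPositive)
    (hSA : ∀ x, S (A x) = x) (hT : 0 < T) {f : LJ T r V} {g : ℝ → V} (hf : f =ᵐ[volJ T] g)
    (hg : Continuous g) :
    ∃ u : LJ T r V, S.compLpL _ (volJ T) u + volterra T r V u = volterra T r V f
      ∧ ‖u‖ ≤ mrConst r * ‖f‖ := by
  have hu := continuous_mild (A := A) hg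
  have hum := memLp_of_continuousOn (T := T) hu.continuousOn (ENNReal.ofReal r.1)
  refine ⟨hum.toLp, ?_, ?_⟩
  · refine Lp.ext ?_
    filter_upwards [Lp.coeFn_add (S.compLpL _ (volJ T) hum.toLp) (volterra T r V hum.toLp),
      S.coeFn_compLpL hum.toLp, volterra_coeFn hum.toLp, volterra_coeFn f, hum.coeFn_toLp,
      ae_restrict_mem measurableSet_Ioo] with t h1 h2 h3 h4 h5 ht
    have ht' := Ioo_subset_Icc_self ht
    rw [h1, Pi.add_apply, h2, h3, h4, h5, integral_congr_volJ hum.coeFn_toLp ht',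
      integral_congr_volJ hf ht', mild_eq hg, hSA, preMild_eq hg, sub_add_cancel]
  · have hfm := memLp_of_continuousOn (T := T) hg.continuousOn (ENNReal.ofReal r.1)
    have : f = hfm.toLp := Lp.ext (hf.trans hfm.coeFn_toLp.symm)
    rw [this, norm_toLp_eq, norm_toLp_eq]
    have h := integral_norm_rpow_mild_le hA hg hT r
    have hm := mrConst_nonneg r
    have h2 := Real.rpow_le_rpow (integral_nonneg fun s => by positivity) h
      (one_div_nonneg.2 r.pos.le)
    rwa [Real.mul_rpow (by positivity) (integral_nonneg fun s => by positivity),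
      ← Real.rpow_mul hm, mul_one_div_cancel r.pos.ne', Real.rpow_one] at h2

lemma exists_solution_of_inverse {S A : V →L[ℂ] V} (hS : S.IsPositive) (hA : A.IsPositive)
    (hSA : ∀ x, S (A x) = x) (hT : 0 < T) (g : LJ T r V) :
    ∃ u : LJ T r V, S.compLpL _ (volJ T) u + volterra T r V u = volterra T r V g
      ∧ ‖u‖ ≤ mrConst r * ‖g‖ := by
  refine exists_solution_of_dense
    (L := S.compLpL (ENNReal.ofReal r.1) (volJ T) + volterra T r V)
    (fun u hu => eq_zero_of_add_volterra hS hu) (mrConst_nonneg r)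
    (dense_contDiff V T r) ?_ ?_ g
  · rintro g ⟨g', hg, hg'⟩ h ⟨h', hh, hh'⟩
    exact exists_solution_of_continuous hA hSA hT ((Lp.coeFn_sub g h).trans (hg.sub hh))
      (hg'.continuous.sub hh'.continuous)
  · rintro g ⟨g', hg, hg'⟩
    exact exists_solution_of_continuous hA hSA hT hg hg'.continuous

/-- `-ε` is not in the spectrum of the nonnegative operator `S`. -/
lemma exists_positive_inverse {S : V →L[ℂ] V} (hS : S.IsPositive) {ε : ℝ} (hε : 0 < ε) :
    ∃ A : V →L[ℂ] V, A.IsPositive ∧ ∀ x, S (A x) + ε • A x = x := by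
  have h0 : (0 : V →L[ℂ] V) ≤ S := (ContinuousLinearMap.nonneg_iff_isPositive S).2 hS
  have hu : IsUnit (algebraMap ℝ (V →L[ℂ] V) (-ε) - S) := by
    by_contra h
    have := spectrum_nonneg_of_nonneg h0 (show (-ε) ∈ spectrum ℝ S from h)
    linarith
  obtain ⟨B, hB⟩ := hu.neg
  have hBx : ∀ x, (B : V →L[ℂ] V) x = S x + ε • x := fun x => by
    rw [hB, Algebra.algebraMap_eq_smul_one]
    simp [add_comm]
  have hinv : ∀ x, (B : V →L[ℂ] V) ((↑B⁻¹ : V →L[ℂ] V) x) = x := fun x =>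
    congrArg (fun L : V →L[ℂ] V => L x) B.mul_inv
  refine ⟨↑B⁻¹, ?_, fun x => ?_⟩
  · have hsym : ∀ x y, ⟪(B : V →L[ℂ] V) x, y⟫_ℂ = ⟪x, (B : V →L[ℂ] V) y⟫_ℂ := fun x y => by
      rw [hBx, hBx, inner_add_left, inner_add_right, RCLike.real_smul_eq_coe_smul (K := ℂ),
        RCLike.real_smul_eq_coe_smul (K := ℂ), inner_smul_left, inner_smul_right, RCLike.conj_ofReal]
      congr 1
      exact hS.isSelfAdjoint.isSymmetric x y
    refine ⟨fun x y => ?_, fun x => ?_⟩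
    · have := hsym ((↑B⁻¹ : V →L[ℂ] V) x) ((↑B⁻¹ : V →L[ℂ] V) y)
      rw [hinv, hinv] at this
      exact this.symm
    · rw [ContinuousLinearMap.reApplyInnerSelf_apply]
      have h1 : ⟪(↑B⁻¹ : V →L[ℂ] V) x, x⟫_ℂ
          = ⟪(↑B⁻¹ : V →L[ℂ] V) x, (B : V →L[ℂ] V) ((↑B⁻¹ : V →L[ℂ] V) x)⟫_ℂ := by rw [hinv]
      rw [h1, hBx, inner_add_right, RCLike.real_smul_eq_coe_smul (K := ℂ), inner_smul_right, map_add,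
        RCLike.re_ofReal_mul, inner_self_eq_norm_sq]
      have := hS.re_inner_nonneg_right ((↑B⁻¹ : V →L[ℂ] V) x)
      positivity
  · rw [← hBx, hinv]

/-- A smooth function vanishing at `0` is the primitive of its derivative. The constants missing
from this class are the `L^r` limits of `(1 - e^{-nt}) v`. -/
lemma dense_range_volterra : DenseRange (volterra T r V) := by
  set R := (volterra T r V).range.topologicalClosure with hR
  have hmem : ∀ k, volterra T r V k ∈ R := fun k =>
    Submodule.le_topologicalClosure _ ⟨k, rfl⟩
  have hclosed : IsClosed (R : Set (LJ T r V)) := Submodule.isClosed_topologicalClosure _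
  have hsmooth : ∀ (f : LJ T r V) (g : ℝ → V), f =ᵐ[volJ T] g → ContDiff ℝ ∞ g → g 0 = 0 → f ∈ R := by
    intro f g hf hg h0
    have hd : Continuous (deriv g) := hg.continuous_deriv (by simp)
    have hk := memLp_of_continuousOn (T := T) hd.continuousOn (ENNReal.ofReal r.1)
    convert hmem hk.toLp
    refine Lp.ext ?_
    filter_upwards [volterra_coeFn hk.toLp, hf, ae_restrict_mem measurableSet_Ioo] with t h1 h2 ht
    rw [h1, h2, integral_congr_volJ hk.coeFn_toLp (Ioo_subset_Icc_self ht),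
      intervalIntegral.integral_deriv_eq_sub (fun x _ => hg.differentiable (by simp) x)
        (hd.intervalIntegrable _ _), h0, sub_zero]
  have hconst : ∀ v : V, (memLp_const v).toLp ∈ R := by
    intro v
    have hexp : ∀ n : ℕ, Continuous fun t : ℝ => Real.exp (-(n * t)) • v := fun n => by fun_prop
    have hm := fun n : ℕ => memLp_of_continuousOn (T := T) (hexp n).continuousOn (ENNReal.ofReal r.1)
    have hin : ∀ n : ℕ, (memLp_const v).toLp - (hm n).toLp ∈ R := fun n => by
      refine hsmooth _ (fun t => v - Real.exp (-(n * t)) • v) ?_ ?_ (by simp)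
      · exact (Lp.coeFn_sub _ _).trans ((memLp_const v).coeFn_toLp.sub (hm n).coeFn_toLp)
      · have : ContDiff ℝ ∞ fun t : ℝ => Real.exp (-(n * t)) := by fun_prop
        exact contDiff_const.sub (this.smul contDiff_const)
    have hlim : Filter.Tendsto (fun n : ℕ => (hm n).toLp) Filter.atTop (nhds 0) := by
      refine tendsto_zero_iff_norm_tendsto_zero.2 ?_
      simp only [norm_toLp_eq]
      have hexp1 : ∀ (n : ℕ), ∀ t ∈ Ioo 0 T, ‖Real.exp (-(n * t)) • v‖ ≤ ‖v‖ := fun n t ht => by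
        rw [norm_smul, Real.norm_of_nonneg (Real.exp_pos _).le]
        have : 0 ≤ n * t := mul_nonneg (Nat.cast_nonneg n) ht.1.le
        exact mul_le_of_le_one_left (norm_nonneg v) (Real.exp_le_one_iff.2 (by linarith))
      have h1 : Filter.Tendsto (fun n : ℕ => ∫ t in Ioo 0 T, ‖Real.exp (-(n * t)) • v‖ ^ r.1)
          Filter.atTop (nhds (∫ t in Ioo 0 T, (0 : ℝ))) := by
        refine tendsto_integral_of_dominated_convergence (fun _ => ‖v‖ ^ r.1)
          (fun n => (((hexp n).norm.rpow_const fun _ => Or.inr r.pos.le)).aestronglyMeasurable)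
          (integrable_const _) (fun n => ?_) ?_
        · filter_upwards [ae_restrict_mem measurableSet_Ioo] with t ht
          rw [Real.norm_of_nonneg (by positivity)]
          exact Real.rpow_le_rpow (norm_nonneg _) (hexp1 n t ht) r.pos.le
        · filter_upwards [ae_restrict_mem measurableSet_Ioo] with t ht
          have h2 : Filter.Tendsto (fun n : ℕ => Real.exp (-(n * t))) Filter.atTop (nhds 0) :=
            Real.tendsto_exp_neg_atTop_nhds_zero.comp
              (tendsto_natCast_atTop_atTop.atTop_mul_const ht.1)
          have h3 := ((h2.smul_const v).norm).rpow_const (p := r.1) (Or.inr r.pos.le)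
          simpa [Real.zero_rpow r.pos.ne'] using h3
      have h2 := h1.rpow_const (p := 1 / r.1) (Or.inr (one_div_nonneg.2 r.pos.le))
      simpa [Real.zero_rpow (inv_ne_zero r.pos.ne')] using h2
    have hlim' : Filter.Tendsto (fun n : ℕ => (memLp_const v).toLp - (hm n).toLp) Filter.atTop
        (nhds ((memLp_const v).toLp - 0)) := tendsto_const_nhds.sub hlim
    rw [sub_zero] at hlim'
    exact hclosed.mem_of_tendsto hlim' (Filter.Eventually.of_forall hin)
  have huniv : ∀ f, f ∈ R := by
    intro f
    have hsub : {f : LJ T r V | ∃ g : ℝ → V, f =ᵐ[volJ T] g ∧ ContDiff ℝ ∞ g} ⊆ R := by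
      rintro f ⟨g, hf, hg⟩
      have : f - (memLp_const (g 0)).toLp ∈ R := hsmooth _ (fun t => g t - g 0)
        ((Lp.coeFn_sub _ _).trans (hf.sub (memLp_const _).coeFn_toLp))
        (hg.sub contDiff_const) (sub_self _)
      simpa using R.add_mem this (hconst (g 0))
    exact hclosed.closure_subset_iff.2 hsub (dense_contDiff V T r f)
  intro f
  have := huniv f
  rwa [hR, ← SetLike.mem_coe, Submodule.topologicalClosure_coe] at this

/-- Autonomous maximal regularity: the problem `(S u)' + u = g`, `S u (0) = 0`. -/
theorem exists_solution_autonomous {S : V →L[ℂ] V} (hS : S.IsPositive) (hT : 0 < T) (g : LJ T r V) :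
    ∃ u : LJ T r V, S.compLpL _ (volJ T) u + volterra T r V u = volterra T r V g
      ∧ ‖u‖ ≤ mrConst r * ‖g‖ := by
  have hSe : ∀ (ε : ℝ) (u : LJ T r V), (S + (ε : ℂ) • ContinuousLinearMap.id ℂ V).compLpL _ (volJ T) u
      = S.compLpL _ (volJ T) u + (ε : ℂ) • u := fun ε u => by
    refine Lp.ext ?_
    filter_upwards [(S + (ε : ℂ) • ContinuousLinearMap.id ℂ V).coeFn_compLpL u, S.coeFn_compLpL u,
      Lp.coeFn_add (S.compLpL _ (volJ T) u) ((ε : ℂ) • u), Lp.coeFn_smul (ε : ℂ) u] with t h1 h2 h3 h4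
    rw [h1, h3, Pi.add_apply, h2, h4]
    simp
  have hpos : ∀ ε : ℝ, 0 ≤ ε → (S + (ε : ℂ) • ContinuousLinearMap.id ℂ V).IsPositive := fun ε hε =>
    hS.add (ContinuousLinearMap.isPositive_id.smul_of_nonneg (by exact_mod_cast hε))
  -- `S + ε` has a bounded positive inverse, and the constant `mrConst r` does not see `ε`.
  refine exists_solution_of_regularised (fun u => (volterra_comm S u).symm) (mrConst_nonneg r)
    (fun ε hε u hu => ?_) (fun ε hε g => ?_) dense_range_volterra g
  · refine eq_zero_of_add_volterra (hpos ε hε) ?_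
    rw [hSe, hu]
  · obtain ⟨A, hA, hSA⟩ := exists_positive_inverse hS hε
    obtain ⟨u, hu1, hu2⟩ := exists_solution_of_inverse (hpos ε hε.le) hA (fun x => by simpa using hSA x)
      hT g
    exact ⟨u, by rw [← hSe]; exact hu1, hu2⟩

end

/-! ### Distributional derivatives and primitives -/

section

variable {X : Type*} [NormedAddCommGroup X] [NormedSpace ℂ X] {T : ℝ}

lemma integral_smul_primitive [CompleteSpace X] {ψ : ℝ → ℝ} (hψ : Continuous ψ) {v : ℝ → X}
    (hv : Integrable v (volJ T)) :
    ∫ t in Ioo 0 T, ψ t • ∫ s in (0 : ℝ)..t, v s = ∫ s in Ioo 0 T, (∫ t in s..T, ψ t) • v s := by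
  set f : ℝ → ℝ → X := fun t s => {p : ℝ × ℝ | p.2 < p.1}.indicator (fun p => ψ p.1 • v p.2) (t, s)
    with hf
  have hm : MeasurableSet {p : ℝ × ℝ | p.2 < p.1} := measurableSet_lt measurable_snd measurable_fst
  have hi : Integrable (Function.uncurry f) ((volJ T).prod (volJ T)) :=
    Integrable.indicator (Integrable.smul_prod
      (hψ.integrableOn_Icc.mono_set Ioo_subset_Icc_self) hv) hm
  have h := integral_integral_swap hi
  convert h using 1
  · refine setIntegral_congr_fun measurableSet_Ioo fun t ht => ?_
    have : ∀ s, f t s = (Iio t).indicator (fun s => ψ t • v s) s := fun s => by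
      simp [hf, indicator]
    simp only [this]
    rw [integral_indicator measurableSet_Iio, Measure.restrict_restrict measurableSet_Iio,
      intervalIntegral.integral_of_le ht.1.le, integral_Ioc_eq_integral_Ioo, integral_smul]
    congr 3
    ext s; simp only [mem_Ioo, mem_inter_iff, mem_Iio]; grind
  · refine setIntegral_congr_fun measurableSet_Ioo fun s hs => ?_
    have : ∀ t, f t s = (Ioi s).indicator (fun t => ψ t • v s) t := fun t => by
      simp [hf, indicator]
    simp only [this]
    rw [integral_indicator measurableSet_Ioi, Measure.restrict_restrict measurableSet_Ioi,
      intervalIntegral.integral_of_le hs.2.le, integral_Ioc_eq_integral_Ioo, integral_smul_const]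
    congr 3
    ext t; simp only [mem_Ioo, mem_inter_iff, mem_Ioi]; grind

lemma isDistribDeriv_primitive [CompleteSpace X] {v : ℝ → X} (hv : Integrable v (volJ T)) :
    IsDistribDeriv T (fun t => ∫ s in (0 : ℝ)..t, v s) v := by
  intro φ h1 _ h3
  have hT : φ T = 0 := image_eq_zero_of_notMem_tsupport fun h => lt_irrefl T (h3 h).2
  have hd : Continuous (deriv φ) := h1.continuous_deriv (by simp)
  rw [integral_smul_primitive hd hv, ← integral_neg]
  refine integral_congr_ae (Filter.Eventually.of_forall fun s => ?_)
  simp only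
  rw [intervalIntegral.integral_deriv_eq_sub (fun x _ => h1.differentiable (by simp) x)
    (hd.intervalIntegrable _ _), hT, zero_sub, neg_smul]

lemma exists_Icc_of_isCompact {K : Set ℝ} (hK : IsCompact K) (hKT : K ⊆ Ioo 0 T) (hT : 0 < T) :
    ∃ a b, 0 < a ∧ b < T ∧ a ≤ b ∧ K ⊆ Icc a b := by
  rcases K.eq_empty_or_nonempty with rfl | hne
  · exact ⟨T / 2, T / 2, by linarith, by linarith, le_rfl, empty_subset _⟩
  · have h1 := hKT (hK.sInf_mem hne)
    have h2 := hKT (hK.sSup_mem hne)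
    have h3 : K ⊆ Icc (sInf K) (sSup K) := fun x hx =>
      ⟨csInf_le hK.bddBelow hx, le_csSup hK.bddAbove hx⟩
    obtain ⟨x, hx⟩ := hne
    exact ⟨_, _, h1.1, h2.2, (h3 hx).1.trans (h3 hx).2, h3⟩

/-- A test function of mean zero is the derivative of a test function. -/
lemma exists_deriv_eq_of_integral_eq_zero (hT : 0 < T) {χ : ℝ → ℝ} (h1 : ContDiff ℝ ∞ χ)
    (h2 : HasCompactSupport χ) (h3 : tsupport χ ⊆ Ioo 0 T) (h0 : ∫ t in (0 : ℝ)..T, χ t = 0) :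
    ∃ φ : ℝ → ℝ, ContDiff ℝ ∞ φ ∧ HasCompactSupport φ ∧ tsupport φ ⊆ Ioo 0 T ∧ deriv φ = χ := by
  obtain ⟨a, b, ha, hb, hab, hK⟩ := exists_Icc_of_isCompact h2 h3 hT
  set φ : ℝ → ℝ := fun t => ∫ s in (0 : ℝ)..t, χ s with hφ
  have hd : ∀ t, HasDerivAt φ (χ t) t := fun t =>
    intervalIntegral.integral_hasDerivAt_right (h1.continuous.intervalIntegrable 0 t)
      (h1.continuous.stronglyMeasurableAtFilter _ _) h1.continuous.continuousAt
  have hderiv : deriv φ = χ := funext fun t => (hd t).deriv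
  have hz : ∀ s, s ∉ Icc a b → χ s = 0 := fun s hs =>
    image_eq_zero_of_notMem_tsupport fun h => hs (hK h)
  have hsupp : Function.support φ ⊆ Icc a b := by
    intro t ht
    by_contra hcon
    refine ht ?_
    rcases lt_or_ge t a with h | h
    · refine intervalIntegral.integral_zero_ae (Filter.Eventually.of_forall fun s hs => hz s ?_)
      intro hs'
      rw [uIoc, mem_Ioc] at hs
      have := hs.2.trans (max_le ha.le h.le)
      have : s ≤ max 0 t := hs.2
      rcases le_max_iff.1 this with h' | h' <;> linarith [hs'.1]
    · have hbt : b < t := by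
        by_contra h'
        exact hcon ⟨h, not_lt.1 h'⟩
      have : φ t = φ T + ∫ s in T..t, χ s :=
        (intervalIntegral.integral_add_adjacent_intervals (h1.continuous.intervalIntegrable _ _)
          (h1.continuous.intervalIntegrable _ _)).symm
      rw [this]
      simp only [hφ]
      rw [h0, zero_add]
      refine intervalIntegral.integral_zero_ae (Filter.Eventually.of_forall fun s hs => hz s ?_)
      intro hs'
      have : min T t < s := hs.1
      rcases min_lt_iff.1 this with h' | h' <;> linarith [hs'.2]
  have hts : tsupport φ ⊆ Icc a b := closure_minimal hsupp isClosed_Icc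
  refine ⟨φ, ?_, HasCompactSupport.of_support_subset_isCompact isCompact_Icc hsupp, hts.trans ?_, hderiv⟩
  · rw [contDiff_infty_iff_deriv]
    exact ⟨fun t => (hd t).differentiableAt, hderiv ▸ h1⟩
  · exact Icc_subset_Ioo ha hb

/-- A continuous function on `[0, T]` with vanishing distributional derivative and vanishing initial
value is zero. -/
lemma eq_zero_of_isDistribDeriv_zero [CompleteSpace X] (hT : 0 < T) {z : ℝ → X}
    (hz : ContinuousOn z (Icc 0 T)) (h0 : z 0 = 0) (hd : IsDistribDeriv T z fun _ => 0) :
    ∀ t ∈ Ioo 0 T, z t = 0 := by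
  let f : ContDiffBump (T / 2) := ⟨T / 8, T / 4, by linarith, by linarith⟩
  set ψ : ℝ → ℝ := f.normed volume with hψ
  have hψ1 : ContDiff ℝ ∞ ψ := f.contDiff_normed
  have hψ2 : HasCompactSupport ψ := f.hasCompactSupport_normed
  have hψ3 : tsupport ψ ⊆ Ioo 0 T := by
    rw [hψ, f.tsupport_normed_eq, Real.closedBall_eq_Icc]
    exact Icc_subset_Ioo (by show 0 < T / 2 - T / 4; linarith) (by show T / 2 + T / 4 < T; linarith)
  have hint : ∀ χ : ℝ → ℝ, tsupport χ ⊆ Ioo 0 T → ∫ t in (0 : ℝ)..T, χ t = ∫ t, χ t := fun χ h => by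
    rw [intervalIntegral.integral_of_le hT.le, integral_Ioc_eq_integral_Ioo]
    exact setIntegral_eq_integral_of_forall_compl_eq_zero fun t ht =>
      image_eq_zero_of_notMem_tsupport fun h' => ht (h h')
  have hψi : ∫ t in (0 : ℝ)..T, ψ t = 1 := by rw [hint ψ hψ3]; exact f.integral_normed
  have hzi : Integrable z (volJ T) := hz.integrableOn_Icc.mono_set Ioo_subset_Icc_self
  have hχz : ∀ χ : ℝ → ℝ, Continuous χ → Integrable (fun t => χ t • z t) (volJ T) := fun χ h =>
    ((h.continuousOn.smul hz).integrableOn_Icc).mono_set Ioo_subset_Icc_self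
  set c := ∫ t in Ioo 0 T, ψ t • z t with hc
  -- Du Bois-Reymond: subtracting a multiple of the unit-mass bump `ψ` gives `χ` mean zero, so the
  -- difference is the derivative of a test function. Hence `z` agrees with the constant `c = ∫ψz`,
  -- and `z 0 = 0` forces `c = 0`.
  have key : ∀ χ : ℝ → ℝ, ContDiff ℝ ∞ χ → HasCompactSupport χ → tsupport χ ⊆ Ioo 0 T →
      ∫ t, χ t • ((Ioo 0 T).indicator (fun t => z t - c) t) = 0 := by
    intro χ k1 k2 k3
    set m := ∫ t in (0 : ℝ)..T, χ t with hm
    obtain ⟨φ, p1, p2, p3, p4⟩ := exists_deriv_eq_of_integral_eq_zero hT (χ := χ + (-m) • ψ)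
      (k1.add (hψ1.const_smul (-m)))
      (k2.add (hψ2.mono (Function.support_const_smul_subset _ _)))
      ((tsupport_add χ _).trans (union_subset k3
        ((closure_mono (Function.support_const_smul_subset _ _)).trans hψ3)))
      (by
        have e := intervalIntegral.integral_add (μ := volume) (k1.continuous.intervalIntegrable 0 T)
          ((hψ1.continuous.const_smul (-m)).intervalIntegrable 0 T)
        refine Eq.trans e ?_
        simp only [Pi.smul_apply]
        rw [intervalIntegral.integral_smul, hψi, ← hm]; simp)
    have h := hd φ p1 p2 p3
    rw [p4] at h
    simp only [Pi.add_apply, Pi.smul_apply, smul_zero, integral_zero, neg_zero, add_smul] at h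
    have hs : ∀ t, (-m • ψ t) • z t = (-m) • (ψ t • z t) := fun t => by rw [smul_assoc]
    simp only [hs] at h
    have hadd : ∫ t in Ioo 0 T, (χ t • z t + -m • ψ t • z t)
        = (∫ t in Ioo 0 T, χ t • z t) + ∫ t in Ioo 0 T, -m • ψ t • z t :=
      integral_add (hχz χ k1.continuous) ((hχz ψ hψ1.continuous).smul (-m))
    rw [hadd, integral_smul, ← hc] at h
    have e : ∀ t, χ t • ((Ioo 0 T).indicator (fun t => z t - c) t)
        = (Ioo 0 T).indicator (fun t => χ t • z t - χ t • c) t := fun t => by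
      by_cases ht : t ∈ Ioo 0 T <;> simp [ht, smul_sub]
    simp only [e]
    rw [integral_indicator measurableSet_Ioo, integral_sub (hχz χ k1.continuous)
      ((k1.continuous.integrableOn_Icc.mono_set Ioo_subset_Icc_self).smul_const c),
      integral_smul_const]
    have e2 : ∫ t in Ioo 0 T, χ t = m := by
      rw [hm, intervalIntegral.integral_of_le hT.le, integral_Ioc_eq_integral_Ioo]
    rw [e2, sub_eq_add_neg, ← neg_smul]
    exact h
  have hloc : LocallyIntegrableOn ((Ioo 0 T).indicator fun t => z t - c) (Ioo 0 T) :=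
    IntegrableOn.locallyIntegrableOn
      ((integrable_indicator_iff measurableSet_Ioo).2 (hzi.sub (integrable_const c))).integrableOn
  have hae := isOpen_Ioo.ae_eq_zero_of_integral_contDiff_smul_eq_zero hloc key
  have heq : EqOn z (fun _ => c) (Ioo 0 T) := by
    refine Measure.eqOn_open_of_ae_eq (μ := volume) ?_ isOpen_Ioo (hz.mono Ioo_subset_Icc_self)
      continuousOn_const
    rw [Filter.EventuallyEq, ae_restrict_iff' measurableSet_Ioo]
    filter_upwards [hae] with t ht htT
    have := ht htT
    rwa [indicator_of_mem htT, sub_eq_zero] at this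
  have heq' : EqOn z (fun _ => c) (Icc 0 T) := by
    rw [← closure_Ioo hT.ne] at hz ⊢
    exact heq.of_subset_closure hz continuousOn_const subset_closure le_rfl
  have hc0 : c = 0 := by
    rw [← h0]; exact (heq' ⟨le_rfl, hT.le⟩).symm
  intro t ht
  rw [heq ht, hc0]

/-- `u ∈ W^{1,1}` with `u(0) = 0` and derivative `v` if and only if `u` is the primitive of `v`. -/
lemma isDistribDeriv_and_vanishes_iff [CompleteSpace X] (hT : 0 < T) {u v : ℝ → X}
    (hv : Integrable v (volJ T)) :
    (IsDistribDeriv T u v ∧ VanishesAtZero T u) ↔ ∀ᵐ t ∂(volJ T), u t = ∫ s in (0 : ℝ)..t, v s := by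
  constructor
  · rintro ⟨hd, w, hw, hwu, hw0⟩
    have hp := continuousOn_primitive hv
    have hpd := isDistribDeriv_primitive hv
    have hz := eq_zero_of_isDistribDeriv_zero hT (hw.sub hp) (by simp [hw0]) ?_
    · filter_upwards [hwu, ae_restrict_mem measurableSet_Ioo] with t h1 h2
      rw [← h1]
      exact sub_eq_zero.1 (hz t h2)
    · intro φ h1 h2 h3
      have hφ : Continuous (deriv φ) := h1.continuous_deriv (by simp)
      have i1 : Integrable (fun t => deriv φ t • w t) (volJ T) :=
        (hφ.continuousOn.smul hw).integrableOn_Icc.mono_set Ioo_subset_Icc_self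
      have i2 : Integrable (fun t => deriv φ t • ∫ s in (0 : ℝ)..t, v s) (volJ T) :=
        (hφ.continuousOn.smul hp).integrableOn_Icc.mono_set Ioo_subset_Icc_self
      simp only [Pi.sub_apply, smul_sub, smul_zero, integral_zero, neg_zero]
      rw [integral_sub i1 i2, hpd φ h1 h2 h3,
        (hd.congr hwu (Filter.EventuallyEq.refl _ v)) φ h1 h2 h3, sub_self]
  · intro h
    refine ⟨(isDistribDeriv_primitive hv).congr h (Filter.EventuallyEq.refl _ v),
      _, continuousOn_primitive hv, Filter.EventuallyEq.symm h, by simp⟩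

end

/-! ### The space `MR` in terms of the Volterra operator -/

section

variable {V X : Type*} [NormedAddCommGroup V] [NormedSpace ℂ V]
  [NormedAddCommGroup X] [NormedSpace ℂ X] [CompleteSpace X] {T : ℝ} {r : Expo} {e : V →L[ℂ] X}

/-- Turns the distributional derivative and the initial condition into one closed linear relation.
Completeness of `MR` follows, and only equations in Bochner spaces remain. -/
lemma mem_MR_iff (hT : 0 < T) (p : WithLp 1 (LJ T r V × LJ T r X)) :
    p ∈ MR T r e ↔ e.compLpL _ (volJ T) p.fst = volterra T r X p.snd := by
  have h : p ∈ MR T r e ↔ _ := isDistribDeriv_and_vanishes_iff (u := fun t => e (p.fst t)) hT p.snd.integrable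
  rw [h, Lp.ext_iff]
  constructor
  · intro h
    filter_upwards [h, e.coeFn_compLpL p.fst, volterra_coeFn p.snd] with t h1 h2 h3
    rw [h2, h3, h1]
  · intro h
    filter_upwards [h, e.coeFn_compLpL p.fst, volterra_coeFn p.snd] with t h1 h2 h3
    rw [← h2, h1, h3]

lemma completeSpace_MR [CompleteSpace V] (hT : 0 < T) : CompleteSpace (MR T r e) := by
  have h : IsClosed (MR T r e : Set (WithLp 1 (LJ T r V × LJ T r X))) := by
    have : (MR T r e : Set (WithLp 1 (LJ T r V × LJ T r X)))
        = {p | (e.compLpL _ (volJ T)) (WithLp.fstL 1 ℂ _ _ p) = volterra T r X (WithLp.sndL 1 ℂ _ _ p)} := by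
      ext p; exact mem_MR_iff hT p
    rw [this]
    exact isClosed_eq (by fun_prop) (by fun_prop)
  exact h.completeSpace_coe

end

/-! ### Interpolation of lower bounds -/

lemma norm_ofReal_cpow_le {c : ℝ} (hc : 0 < c) {w : ℂ} {M : ℝ} (h0 : 0 ≤ w.re) (hM : w.re ≤ M) :
    ‖(c : ℂ) ^ w‖ ≤ (1 + c) ^ M := by
  rw [Complex.norm_cpow_eq_rpow_re_of_pos hc]
  calc c ^ w.re ≤ (1 + c) ^ w.re := Real.rpow_le_rpow hc.le (by linarith) h0
    _ ≤ (1 + c) ^ M := Real.rpow_le_rpow_of_exponent_le (by linarith) hM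

/-- A quantitative stability estimate for bilinear forms between weighted `ℓ^p` spaces. -/
lemma norm_form_le_add {ι κ : Type*} [Fintype ι] [Fintype κ] (B : ι → κ → ℂ) {m : ι → ℝ} {n : κ → ℝ}
    {γ s s' r r' θ : ℝ} (hss : s.HolderConjugate s') (hrr : r.HolderConjugate r')
    (h1 : ∀ (a : ι → ℂ) (b : κ → ℂ), ‖∑ i, ∑ j, B i j * a i * b j‖
      ≤ γ * (∑ i, ‖a i‖ ^ s * m i) ^ (1 / s) * (∑ j, ‖b j‖ ^ s' * n j) ^ (1 / s'))
    (h2 : ∀ (a : ι → ℂ) (b : κ → ℂ), ‖∑ i, ∑ j, B i j * a i * b j‖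
      ≤ γ * (∑ i, ‖a i‖ ^ s' * m i) ^ (1 / s') * (∑ j, ‖b j‖ ^ s * n j) ^ (1 / s))
    {c : ι → ℝ} {d : κ → ℝ} (hc : ∀ i, 0 < c i) (hd : ∀ j, 0 < d j)
    (hcm : ∑ i, c i ^ r * m i = 1) (hdn : ∑ j, d j ^ (2 : ℝ) * n j = 1)
    (hθ0 : 0 < θ) (hθ1 : θ < 1) (hθ : 1 / r = (1 - θ) / s' + θ / s) :
    ‖∑ i, ∑ j, B i j * ((c i ^ (r / 2) : ℝ) : ℂ) * (d j : ℂ)‖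
      ≤ ‖∑ i, ∑ j, B i j * (c i : ℂ) * ((d j ^ (2 / r') : ℝ) : ℂ)‖ + 4 * γ * |θ - 1 / 2| := by
  have hs0 := hss.pos
  have hs'0 := hss.symm.pos
  have hr0 := hrr.pos
  have hr'0 := hrr.symm.pos
  have hsum : 1 / s + 1 / s' = 1 := by simpa using hss.inv_add_inv_eq_one
  have hsumr : 1 / r + 1 / r' = 1 := by simpa using hrr.inv_add_inv_eq_one
  -- The complex reciprocal exponent of the Riesz–Thorin interpolation: real part `1/s'` and `1/s`
  -- on the two edges, value `1/r` at `θ` and `1/2` at `1/2`. Thus `Φ θ` and `Φ (1/2)` are the two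
  -- forms being compared.
  set α : ℂ → ℂ := fun z => (1 - z) * ((1 / s' : ℝ) : ℂ) + z * ((1 / s : ℝ) : ℂ) with hα
  have hαre : ∀ z, (α z).re = (1 - z.re) * (1 / s') + z.re * (1 / s) := fun z => by
    simp only [hα, Complex.add_re, Complex.re_mul_ofReal, Complex.sub_re, Complex.one_re]
  set Φ : ℂ → ℂ := fun z => ∑ i, ∑ j, B i j * (c i : ℂ) ^ ((r : ℂ) * α z)
    * (d j : ℂ) ^ ((2 : ℂ) * (1 - α z)) with hΦ
  have hcn : ∀ i z, ‖(c i : ℂ) ^ ((r : ℂ) * α z)‖ = c i ^ (r * (α z).re) := fun i z => by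
    rw [Complex.norm_cpow_eq_rpow_re_of_pos (hc i), Complex.re_ofReal_mul]
  have hdn' : ∀ j z, ‖(d j : ℂ) ^ ((2 : ℂ) * (1 - α z))‖ = d j ^ (2 * (1 - (α z).re)) := fun j z => by
    rw [Complex.norm_cpow_eq_rpow_re_of_pos (hd j)]
    congr 1
    simp
  have hdiff : Differentiable ℂ Φ := by
    refine Differentiable.fun_sum fun i _ => Differentiable.fun_sum fun j _ => ?_
    have hαd : Differentiable ℂ α := by fun_prop
    refine Differentiable.mul (Differentiable.mul (differentiable_const _) ?_) ?_
    · exact (hαd.const_mul _).const_cpow (Or.inl (by exact_mod_cast (hc i).ne'))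
    · exact ((hαd.const_sub _).const_mul _).const_cpow (Or.inl (by exact_mod_cast (hd j).ne'))
  have hedge0 : ∀ z : ℂ, z.re = 0 → ‖Φ z‖ ≤ γ := fun z hz => by
    have e : (α z).re = 1 / s' := by rw [hαre, hz]; ring
    refine (h2 _ _).trans (le_of_eq ?_)
    simp only [hcn, hdn', e]
    have e1 : ∀ i, (c i ^ (r * (1 / s'))) ^ s' = c i ^ r := fun i => by
      rw [← Real.rpow_mul (hc i).le]; congr 1; field_simp
    have e2 : ∀ j, (d j ^ (2 * (1 - 1 / s'))) ^ s = d j ^ (2 : ℝ) := fun j => by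
      rw [← Real.rpow_mul (hd j).le, show 1 - 1 / s' = 1 / s by linarith]; congr 1; field_simp
    simp only [e1, e2, hcm, hdn, Real.one_rpow, mul_one]
  have hedge1 : ∀ z : ℂ, z.re = 1 → ‖Φ z‖ ≤ γ := fun z hz => by
    have e : (α z).re = 1 / s := by rw [hαre, hz]; ring
    refine (h1 _ _).trans (le_of_eq ?_)
    simp only [hcn, hdn', e]
    have e1 : ∀ i, (c i ^ (r * (1 / s))) ^ s = c i ^ r := fun i => by
      rw [← Real.rpow_mul (hc i).le]; congr 1; field_simp
    have e2 : ∀ j, (d j ^ (2 * (1 - 1 / s))) ^ s' = d j ^ (2 : ℝ) := fun j => by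
      rw [← Real.rpow_mul (hd j).le, show 1 - 1 / s = 1 / s' by linarith]; congr 1; field_simp
    simp only [e1, e2, hcm, hdn, Real.one_rpow, mul_one]
  have hstrip : ∀ z : ℂ, 0 ≤ z.re → z.re ≤ 1 → ‖Φ z‖ ≤ γ := by
    intro z hz0 hz1
    -- The growth condition is met with exponent `0`, since the finite sum `Φ` is bounded on the
    -- strip.
    refine PhragmenLindelof.vertical_strip hdiff.diffContOnCl
      ⟨0, by simpa using Real.pi_pos, 0, ?_⟩ hedge0 hedge1 hz0 hz1
    refine Asymptotics.IsBigO.of_bound (∑ i, ∑ j, ‖B i j‖ * (1 + c i) ^ r * (1 + d j) ^ (2 : ℝ)) ?_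
    rw [Filter.eventually_inf_principal]
    refine Filter.Eventually.of_forall fun w hw => ?_
    have hw : 0 < w.re ∧ w.re < 1 := hw
    have hα0 : 0 ≤ (α w).re := by
      rw [hαre]
      have : 0 ≤ 1 - w.re := by linarith
      have := hw.1
      positivity
    have hα1 : (α w).re ≤ 1 := by
      rw [hαre]
      have a1 : 0 < 1 / s := by positivity
      have a2 : 0 < 1 / s' := by positivity
      nlinarith [hw.1, hw.2]
    simp only [zero_mul, Real.exp_zero, norm_one, mul_one]
    refine (norm_sum_le _ _).trans (Finset.sum_le_sum fun i _ => (norm_sum_le _ _).trans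
      (Finset.sum_le_sum fun j _ => ?_))
    rw [norm_mul, norm_mul]
    have k1 : ‖(c i : ℂ) ^ ((r : ℂ) * α w)‖ ≤ (1 + c i) ^ r := by
      refine norm_ofReal_cpow_le (hc i) ?_ ?_
      · rw [Complex.re_ofReal_mul]; positivity
      · rw [Complex.re_ofReal_mul]; nlinarith
    have k2 : ‖(d j : ℂ) ^ ((2 : ℂ) * (1 - α w))‖ ≤ (1 + d j) ^ (2 : ℝ) := by
      have e : ((2 : ℂ) * (1 - α w)).re = 2 * (1 - (α w).re) := by simp
      refine norm_ofReal_cpow_le (hd j) ?_ ?_ <;> rw [e] <;> linarith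
    have := (hc i).le
    gcongr
  -- The disc of radius `1/2` about `1/2` lies in the strip, and there `Φ` stays within `2γ` of its
  -- value at the centre. The slope is `2γ / (1/2) = 4γ`.
  have hSchwarz := Complex.dist_le_div_mul_dist_of_mapsTo_ball (f := Φ) (c := (1 / 2 : ℝ))
    (z := (θ : ℂ)) (R₁ := 1 / 2) (R₂ := 2 * γ) hdiff.differentiableOn ?_ ?_
  · have eθ : α θ = ((1 / r : ℝ) : ℂ) := by
      rw [hθ]; simp only [hα]; push_cast; ring
    have eh : α ((1 / 2 : ℝ) : ℂ) = ((1 / 2 : ℝ) : ℂ) := by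
      have : (1 / 2 : ℝ) = (1 - 1 / 2) * (1 / s') + 1 / 2 * (1 / s) := by linarith
      conv_rhs => rw [this]
      simp only [hα]; push_cast; ring
    have v1 : Φ θ = ∑ i, ∑ j, B i j * (c i : ℂ) * ((d j ^ (2 / r') : ℝ) : ℂ) := by
      simp only [hΦ, eθ]
      refine Finset.sum_congr rfl fun i _ => Finset.sum_congr rfl fun j _ => ?_
      congr 1
      · congr 1
        rw [← Complex.ofReal_mul, mul_one_div_cancel hr0.ne', Complex.ofReal_one, Complex.cpow_one]
      · rw [Complex.ofReal_cpow (hd j).le]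
        congr 1
        rw [← Complex.ofReal_one, ← Complex.ofReal_sub, show 1 - 1 / r = 1 / r' by linarith]
        push_cast; ring
    have v2 : Φ ((1 / 2 : ℝ) : ℂ) = ∑ i, ∑ j, B i j * ((c i ^ (r / 2) : ℝ) : ℂ) * (d j : ℂ) := by
      simp only [hΦ, eh]
      refine Finset.sum_congr rfl fun i _ => Finset.sum_congr rfl fun j _ => ?_
      congr 1
      · congr 1
        rw [Complex.ofReal_cpow (hc i).le]
        congr 1; push_cast; ring
      · have : (2 : ℂ) * (1 - ((1 / 2 : ℝ) : ℂ)) = 1 := by push_cast; norm_num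
        rw [this, Complex.cpow_one]
    rw [v1, v2, dist_eq_norm, dist_eq_norm, ← Complex.ofReal_sub, Complex.norm_real,
      Real.norm_eq_abs] at hSchwarz
    have h3 := norm_sub_norm_le (∑ i, ∑ j, B i j * ((c i ^ (r / 2) : ℝ) : ℂ) * (d j : ℂ))
      (∑ i, ∑ j, B i j * (c i : ℂ) * ((d j ^ (2 / r') : ℝ) : ℂ))
    rw [norm_sub_rev] at h3
    have : 2 * γ / (1 / 2) * |θ - 1 / 2| = 4 * γ * |θ - 1 / 2| := by ring
    linarith
  · intro z hz
    have hb : ∀ w ∈ Metric.ball (((1 / 2 : ℝ) : ℂ)) (1 / 2), ‖Φ w‖ ≤ γ := by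
      intro w hw
      rw [Metric.mem_ball, dist_eq_norm] at hw
      have h4 := (Complex.abs_re_le_norm (w - ((1 / 2 : ℝ) : ℂ))).trans_lt hw
      rw [Complex.sub_re, Complex.ofReal_re, abs_lt] at h4
      exact hstrip w (by linarith) (by linarith)
    rw [Metric.mem_closedBall, dist_eq_norm]
    refine (norm_sub_le _ _).trans ?_
    have := hb z hz
    have := hb _ (Metric.mem_ball_self (by norm_num))
    linarith
  · rw [Metric.mem_ball, dist_eq_norm, ← Complex.ofReal_sub, Complex.norm_real, Real.norm_eq_abs,
      abs_lt]
    constructor <;> linarith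

/-! ### Transfer to Bochner spaces by step functions -/

section

variable {V : Type*} [NormedAddCommGroup V] [InnerProductSpace ℂ V] {T : ℝ}

/-- The step function `∑ i, a i 1_{E i} e i`. -/
def stepLp (T : ℝ) (r : Expo) {ι : Type*} [Fintype ι] {E : ι → Set ℝ} (hE : ∀ i, MeasurableSet (E i))
    (e : ι → V) (a : ι → ℂ) : LJ T r V :=
  ∑ i, a i • indicatorConstLp _ (hE i) (measure_ne_top (volJ T) _) (e i)

variable {ι κ : Type*} [Fintype ι] [Fintype κ] {E : ι → Set ℝ} {hE : ∀ i, MeasurableSet (E i)}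
  {e : ι → V}

lemma coeFn_sum_LJ {G : Type*} [NormedAddCommGroup G] {r : Expo} (f : ι → LJ T r G) :
    ((∑ i, f i : LJ T r G) : ℝ → G) =ᵐ[volJ T] fun t => ∑ i, f i t := by
  classical
  have : ∀ s : Finset ι, ((∑ i ∈ s, f i : LJ T r G) : ℝ → G) =ᵐ[volJ T] fun t => ∑ i ∈ s, f i t := by
    intro s
    induction s using Finset.induction_on with
    | empty => exact Lp.coeFn_zero G _ (volJ T)
    | insert i s hi ih =>
      rw [Finset.sum_insert hi]
      filter_upwards [Lp.coeFn_add (f i) (∑ i ∈ s, f i), ih] with t h1 h2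
      rw [h1, Pi.add_apply, h2, Finset.sum_insert hi]
  exact this Finset.univ

lemma stepLp_coeFn (r : Expo) (a : ι → ℂ) : stepLp T r hE e a =ᵐ[volJ T]
    fun t => ∑ i, a i • (E i).indicator (fun _ => e i) t := by
  have h1 : ∀ᵐ t ∂(volJ T), ∀ i, (a i • indicatorConstLp (ENNReal.ofReal r.1) (hE i)
      (measure_ne_top (volJ T) _) (e i) : LJ T r V) t = a i • (E i).indicator (fun _ => e i) t := by
    rw [Filter.eventually_all]
    intro i
    filter_upwards [Lp.coeFn_smul (a i) (indicatorConstLp (ENNReal.ofReal r.1) (hE i)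
      (measure_ne_top (volJ T) _) (e i)), indicatorConstLp_coeFn (p := ENNReal.ofReal r.1) (hs := hE i)
      (hμs := measure_ne_top (volJ T) _) (c := e i)] with t h1 h2
    rw [h1, Pi.smul_apply, h2]
  filter_upwards [coeFn_sum_LJ fun i => (a i • indicatorConstLp (ENNReal.ofReal r.1) (hE i)
      (measure_ne_top (volJ T) _) (e i) : LJ T r V), h1] with t h2 h3
  rw [stepLp, h2]
  exact Finset.sum_congr rfl fun i _ => h3 i

/-- For fixed disjoint sets and unit vectors, the coefficients give an isometric copy of a weighted
`ℓ^r` with the same weights for every `r`. -/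
lemma norm_stepLp (hd : Pairwise fun i j => Disjoint (E i) (E j)) (he : ∀ i, ‖e i‖ = 1) (r : Expo)
    (a : ι → ℂ) :
    ‖stepLp T r hE e a‖ = (∑ i, ‖a i‖ ^ r.1 * (volJ T).real (E i)) ^ (1 / r.1) := by
  rw [norm_LJ_eq]
  congr 1
  have h : ∀ t, ‖∑ i, a i • (E i).indicator (fun _ => e i) t‖ ^ r.1
      = ∑ i, (E i).indicator (fun _ => ‖a i‖ ^ r.1) t := fun t => by
    by_cases ht : ∃ i, t ∈ E i
    · obtain ⟨i, hi⟩ := ht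
      have hne : ∀ j, j ≠ i → t ∉ E j := fun j hj h' => (hd hj).le_bot ⟨h', hi⟩
      rw [Finset.sum_eq_single i (fun j _ hj => by simp [hne j hj]) (by simp),
        Finset.sum_eq_single i (fun j _ hj => by simp [hne j hj]) (by simp)]
      simp [hi, norm_smul, he]
    · push Not at ht
      simp [ht, Real.zero_rpow r.pos.ne']
  have h2 : ∫ t in Ioo 0 T, ‖stepLp T r hE e a t‖ ^ r.1
      = ∫ t in Ioo 0 T, ∑ i, (E i).indicator (fun _ => ‖a i‖ ^ r.1) t := by
    refine integral_congr_ae ?_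
    filter_upwards [stepLp_coeFn (hE := hE) (e := e) r a] with t ht
    rw [ht, h]
  rw [h2, integral_finsetSum _ fun i _ => (integrable_const _).indicator (hE i)]
  refine Finset.sum_congr rfl fun i _ => ?_
  rw [integral_indicator (hE i), setIntegral_const, smul_eq_mul, mul_comm]

/-- A polar decomposition of the values: directions go into `e`, and the coefficients are strictly
positive so that complex powers of them are entire functions of the exponent. -/
lemma exists_eq_stepLp (r : Expo) (φ : SimpleFunc ℝ V) {f : LJ T r V} (hf : f =ᵐ[volJ T] φ) :
    ∃ (ι : Type) (_ : Fintype ι) (E : ι → Set ℝ) (hE : ∀ i, MeasurableSet (E i)) (e : ι → V)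
      (c : ι → ℝ), (Pairwise fun i j => Disjoint (E i) (E j)) ∧ (∀ i, ‖e i‖ = 1) ∧
        (∀ i, 0 < c i) ∧ f = stepLp T r hE e fun i => (c i : ℂ) := by
  classical
  set R := φ.range.filter (· ≠ 0) with hR
  obtain ⟨n, ⟨g⟩⟩ : ∃ n, Nonempty (Fin n ≃ R) := ⟨_, ⟨(Fintype.equivFin R).symm⟩⟩
  have hne : ∀ i, (g i : V) ≠ 0 := fun i => (Finset.mem_filter.1 (g i).2).2
  refine ⟨Fin n, inferInstance, fun i => φ ⁻¹' {(g i : V)}, fun i => φ.measurableSet_fiber _,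
    fun i => ((‖(g i : V)‖⁻¹ : ℝ) : ℂ) • (g i : V), fun i => ‖(g i : V)‖, ?_, ?_,
    fun i => norm_pos_iff.2 (hne i), ?_⟩
  · intro i j hij
    refine Disjoint.preimage _ (disjoint_singleton.2 fun h => hij (g.injective (Subtype.ext h)))
  · intro i
    rw [norm_smul, Complex.norm_real, norm_inv, norm_norm, inv_mul_cancel₀ (norm_ne_zero_iff.2 (hne i))]
  · refine Lp.ext (hf.trans (Filter.EventuallyEq.trans ?_ (stepLp_coeFn r _).symm))
    refine Filter.Eventually.of_forall fun t => ?_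
    simp only
    by_cases h0 : φ t = 0
    · rw [h0, Finset.sum_eq_zero]
      intro i _
      have : t ∉ φ ⁻¹' {(g i : V)} := fun h => hne i (by rw [← h0]; exact h.symm)
      simp [this]
    · have hm : φ t ∈ R := Finset.mem_filter.2 ⟨φ.mem_range_self t, h0⟩
      obtain ⟨i, hi⟩ := g.surjective ⟨φ t, hm⟩
      have hi' : (g i : V) = φ t := congrArg Subtype.val hi
      rw [Finset.sum_eq_single i]
      · have : t ∈ φ ⁻¹' {(g i : V)} := hi'.symm
        rw [indicator_of_mem this, smul_smul, ← Complex.ofReal_mul,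
          mul_inv_cancel₀ (norm_ne_zero_iff.2 (hne i)), Complex.ofReal_one, one_smul, hi']
      · intro j _ hj
        have : t ∉ φ ⁻¹' {(g j : V)} := fun h =>
          hj (g.injective (Subtype.ext (by rw [hi']; exact h.symm)))
        simp [this]
      · simp

lemma dense_simple (G : Type*) [NormedAddCommGroup G] (T : ℝ) (r : Expo) :
    Dense {f : LJ T r G | ∃ φ : SimpleFunc ℝ G, f =ᵐ[volJ T] φ} := by
  refine (Lp.simpleFunc.dense (E := G) (μ := volJ T) (p := ENNReal.ofReal r.1)
    ENNReal.ofReal_ne_top).mono ?_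
  rintro f hf
  exact ⟨Lp.simpleFunc.toSimpleFunc ⟨f, hf⟩, (Lp.simpleFunc.toSimpleFunc_eq_toFun ⟨f, hf⟩).symm⟩

/-- Hölder's inequality for the pairing of `L^r(J; V)` with `L^{r'}(J; V)`. -/
lemma norm_integral_inner_le {r q : Expo} (h : r.1.HolderConjugate q.1) (f : LJ T r V) (g : LJ T q V) :
    Integrable (fun t => ⟪g t, f t⟫_ℂ) (volJ T) ∧
      ‖∫ t in Ioo 0 T, ⟪g t, f t⟫_ℂ‖ ≤ ‖f‖ * ‖g‖ := by
  have hH := integral_mul_le_Lp_mul_Lq_of_nonneg (μ := volJ T) h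
    (f := fun t => ‖f t‖) (g := fun t => ‖g t‖) (Filter.Eventually.of_forall fun _ => norm_nonneg _)
    (Filter.Eventually.of_forall fun _ => norm_nonneg _) (Lp.memLp f).norm (Lp.memLp g).norm
  have hc : (ENNReal.ofReal r.1).HolderConjugate (ENNReal.ofReal q.1) := h.ennrealOfReal
  have hi : Integrable (fun t => ‖f t‖ * ‖g t‖) (volJ T) := (Lp.memLp f).norm.integrable_mul (Lp.memLp g).norm
  have hle : ∀ t, ‖⟪g t, f t⟫_ℂ‖ ≤ ‖f t‖ * ‖g t‖ := fun t => by
    rw [mul_comm]; exact norm_inner_le_norm _ _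
  refine ⟨hi.mono' ((Lp.aestronglyMeasurable g).inner (Lp.aestronglyMeasurable f))
    (Filter.Eventually.of_forall hle), ?_⟩
  rw [norm_LJ_eq, norm_LJ_eq]
  exact (norm_integral_le_of_norm_le hi (Filter.Eventually.of_forall hle)).trans hH

/-- The operators `Q r` agree on common elements, so one matrix, computed at the exponent `p`,
represents the form at all exponents. The conjugate on `b` makes the form bilinear, which keeps the
interpolating function holomorphic. -/
lemma sum_form_eq_integral (Q : ∀ r : Expo, LJ T r V →L[ℂ] LJ T r V)
    (hQ : ∀ (r q : Expo) (f : LJ T r V) (g : LJ T q V), f =ᵐ[volJ T] g → Q r f =ᵐ[volJ T] Q q g)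
    {r q p p' : Expo} (hp : p.1.HolderConjugate p'.1) {H : κ → Set ℝ}
    (hH : ∀ j, MeasurableSet (H j)) (k : κ → V) (a : ι → ℂ) (b : κ → ℂ) :
    ∑ i, ∑ j, (∫ t in Ioo 0 T, ⟪(indicatorConstLp (ENNReal.ofReal p'.1) (hH j)
        (measure_ne_top (volJ T) _) (k j) : LJ T p' V) t, Q p (indicatorConstLp _ (hE i)
        (measure_ne_top (volJ T) _) (e i)) t⟫_ℂ) * a i * b j
      = ∫ t in Ioo 0 T, ⟪stepLp T q hH k (fun j => conj (b j)) t, Q r (stepLp T r hE e a) t⟫_ℂ := by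
  set X : ι → LJ T p V := fun i => indicatorConstLp _ (hE i) (measure_ne_top (volJ T) _) (e i)
  set Y : κ → LJ T p' V := fun j => indicatorConstLp _ (hH j) (measure_ne_top (volJ T) _) (k j) with hY
  have hint : ∀ i j, Integrable (fun t => ⟪Y j t, Q p (X i) t⟫_ℂ) (volJ T) := fun i j =>
    (norm_integral_inner_le hp _ _).1
  have hstep : Q r (stepLp T r hE e a) =ᵐ[volJ T] fun t => ∑ i, a i • Q p (X i) t := by
    have h1 : stepLp T r hE e a =ᵐ[volJ T] stepLp T p hE e a :=
      (stepLp_coeFn r a).trans (stepLp_coeFn p a).symm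
    refine (hQ r p _ _ h1).trans ?_
    have h2 : Q p (stepLp T p hE e a) = ∑ i, a i • Q p (X i) := by
      simp only [stepLp, map_sum, map_smul, X]
    rw [h2]
    have h3 : ∀ᵐ t ∂(volJ T), ∀ i, (a i • Q p (X i) : LJ T p V) t = a i • Q p (X i) t := by
      rw [Filter.eventually_all]
      exact fun i => Lp.coeFn_smul _ _
    filter_upwards [coeFn_sum_LJ fun i => a i • Q p (X i), h3] with t h4 h5
    rw [h4]
    exact Finset.sum_congr rfl fun i _ => h5 i
  have hY' : ∀ᵐ t ∂(volJ T), ∀ j, Y j t = (H j).indicator (fun _ => k j) t := by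
    rw [Filter.eventually_all]
    exact fun j => indicatorConstLp_coeFn
  have hfin : ∫ t in Ioo 0 T, ⟪stepLp T q hH k (fun j => conj (b j)) t, Q r (stepLp T r hE e a) t⟫_ℂ
      = ∫ t in Ioo 0 T, ∑ i, ∑ j, ⟪Y j t, Q p (X i) t⟫_ℂ * a i * b j := by
    refine integral_congr_ae ?_
    filter_upwards [hstep, stepLp_coeFn (hE := hH) (e := k) q (fun j => conj (b j)), hY']
      with t h1 h2 h3
    rw [h1, h2, sum_inner, Finset.sum_comm]
    refine Finset.sum_congr rfl fun j _ => ?_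
    rw [inner_sum]
    refine Finset.sum_congr rfl fun i _ => ?_
    rw [inner_smul_left, inner_smul_right, Complex.conj_conj, h3 j]
    ring
  rw [hfin, integral_finsetSum _ fun i _ => integrable_finsetSum _ fun j _ =>
    ((hint i j).mul_const _).mul_const _]
  refine Finset.sum_congr rfl fun i _ => ?_
  rw [integral_finsetSum _ fun j _ => ((hint i j).mul_const _).mul_const _]
  refine Finset.sum_congr rfl fun j _ => ?_
  rw [integral_mul_const, integral_mul_const]

lemma norm_sq_LJ {G : Type*} [NormedAddCommGroup G] {two : Expo} (h2 : two.1 = 2) (w : LJ T two G) :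
    ‖w‖ ^ 2 = ∫ t in Ioo 0 T, ‖w t‖ ^ 2 := by
  have h : ∀ t, ‖w t‖ ^ two.1 = ‖w t‖ ^ 2 := fun t =>
    (congrArg (fun q : ℝ => ‖w t‖ ^ q) h2).trans (Real.rpow_two _)
  have h1 : ‖w‖ = (∫ t in Ioo 0 T, ‖w t‖ ^ 2) ^ (1 / 2 : ℝ) := by
    simp only [norm_LJ_eq, h]
    exact congrArg (fun q : ℝ => (∫ t in Ioo 0 T, ‖w t‖ ^ 2) ^ (1 / q)) h2
  rw [h1, ← Real.sqrt_eq_rpow, Real.sq_sqrt]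
  exact integral_nonneg fun t => by positivity

/-- Duality in `L²`: the bound extends from simple functions by density and is then tested on `w`
itself. -/
lemma norm_le_of_forall_simple {two : Expo} (h2 : two.1 = 2) {w : LJ T two V} {K : ℝ}
    (h : ∀ h : LJ T two V, (∃ φ : SimpleFunc ℝ V, h =ᵐ[volJ T] φ) → ‖h‖ = 1 →
      ‖∫ t in Ioo 0 T, ⟪h t, w t⟫_ℂ‖ ≤ K) (hK : 0 ≤ K) : ‖w‖ ≤ K := by
  have hconj : two.1.HolderConjugate two.1 := by rw [h2]; exact Real.HolderConjugate.two_two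
  have hlin : ∀ g₁ g₂ : LJ T two V, ∫ t in Ioo 0 T, ⟪(g₁ - g₂ : LJ T two V) t, w t⟫_ℂ
      = (∫ t in Ioo 0 T, ⟪g₁ t, w t⟫_ℂ) - ∫ t in Ioo 0 T, ⟪g₂ t, w t⟫_ℂ := fun g₁ g₂ => by
    rw [← integral_sub (norm_integral_inner_le hconj w g₁).1 (norm_integral_inner_le hconj w g₂).1]
    refine integral_congr_ae ?_
    filter_upwards [Lp.coeFn_sub g₁ g₂] with t ht
    rw [ht, Pi.sub_apply, inner_sub_left]
  have hsimple : ∀ g : LJ T two V, (∃ φ : SimpleFunc ℝ V, g =ᵐ[volJ T] φ) →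
      ‖∫ t in Ioo 0 T, ⟪g t, w t⟫_ℂ‖ ≤ K * ‖g‖ := by
    rintro g ⟨φ, hφ⟩
    by_cases hg : ‖g‖ = 0
    · have := (norm_integral_inner_le hconj w g).2
      rw [hg, mul_zero] at this ⊢
      exact this
    · have h1 := h (((‖g‖⁻¹ : ℝ) : ℂ) • g) ⟨((‖g‖⁻¹ : ℝ) : ℂ) • φ,
        (Lp.coeFn_smul _ _).trans (hφ.const_smul _)⟩
        (by rw [norm_smul, Complex.norm_real, norm_inv, norm_norm, inv_mul_cancel₀ hg])
      have h3 : ∫ t in Ioo 0 T, ⟪(((‖g‖⁻¹ : ℝ) : ℂ) • g : LJ T two V) t, w t⟫_ℂ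
          = ((‖g‖⁻¹ : ℝ) : ℂ) * ∫ t in Ioo 0 T, ⟪g t, w t⟫_ℂ := by
        rw [← integral_const_mul]
        refine integral_congr_ae ?_
        filter_upwards [Lp.coeFn_smul ((‖g‖⁻¹ : ℝ) : ℂ) g] with t ht
        rw [ht, Pi.smul_apply, inner_smul_left, Complex.conj_ofReal]
      rw [h3, norm_mul, Complex.norm_real, norm_inv, norm_norm,
        inv_mul_le_iff₀ ((norm_nonneg g).lt_of_ne' hg)] at h1
      linarith
  have hall : ∀ g : LJ T two V, ‖∫ t in Ioo 0 T, ⟪g t, w t⟫_ℂ‖ ≤ K * ‖g‖ := by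
    intro g
    have hcont : Continuous fun g : LJ T two V => ∫ t in Ioo 0 T, ⟪g t, w t⟫_ℂ := by
      refine LipschitzWith.continuous (K := ‖w‖₊) (LipschitzWith.of_dist_le_mul fun g₁ g₂ => ?_)
      rw [dist_eq_norm, dist_eq_norm, ← hlin]
      exact (norm_integral_inner_le hconj w _).2
    exact closure_minimal (s := {g : LJ T two V | ∃ φ : SimpleFunc ℝ V, g =ᵐ[volJ T] φ}) hsimple
      (isClosed_le hcont.norm (continuous_norm.const_mul K)) (dense_simple V T two g)
  have hw := hall w
  have e : ∫ t in Ioo 0 T, ⟪w t, w t⟫_ℂ = ((‖w‖ ^ 2 : ℝ) : ℂ) := by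
    have h3 : ∀ t, ⟪w t, w t⟫_ℂ = ((‖w t‖ ^ 2 : ℝ) : ℂ) := fun t => by
      rw [inner_self_eq_norm_sq_to_K]; norm_cast
    simp only [h3]
    rw [integral_complex_ofReal, norm_sq_LJ h2]
  rw [e, Complex.norm_real, Real.norm_of_nonneg (by positivity)] at hw
  rcases (norm_nonneg w).eq_or_lt with h0 | h0
  · rw [← h0]; exact hK
  · nlinarith

/-- A lower bound on `L²` persists on `L^r` for `r` near `2`, if the operator is bounded on `L^s`
and `L^{s'}`. -/
theorem lower_bound_of_interpolation (Q : ∀ r : Expo, LJ T r V →L[ℂ] LJ T r V)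
    (hQ : ∀ (r q : Expo) (f : LJ T r V) (g : LJ T q V), f =ᵐ[volJ T] g → Q r f =ᵐ[volJ T] Q q g)
    {s r two : Expo} (h2 : two.1 = 2) {γ b θ : ℝ} (hγ : 0 ≤ γ)
    (hs : ∀ f : LJ T s V, ‖Q s f‖ ≤ γ * ‖f‖)
    (hs' : ∀ f : LJ T s.conj V, ‖Q s.conj f‖ ≤ γ * ‖f‖)
    (hb : ∀ f : LJ T two V, b * ‖f‖ ≤ ‖Q two f‖) (hθ0 : 0 < θ) (hθ1 : θ < 1)
    (hθ : 1 / r.1 = (1 - θ) / s.conj.1 + θ / s.1) (f : LJ T r V) :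
    (b - 4 * γ * |θ - 1 / 2|) * ‖f‖ ≤ ‖Q r f‖ := by
  have hconj : two.1.HolderConjugate two.1 := by rw [h2]; exact Real.HolderConjugate.two_two
  have hunit : ∀ f : LJ T r V, (∃ φ : SimpleFunc ℝ V, f =ᵐ[volJ T] φ) → ‖f‖ = 1 →
      b - 4 * γ * |θ - 1 / 2| ≤ ‖Q r f‖ := by
    rintro f ⟨φ, hφ⟩ hf
    obtain ⟨ι, _, E, hE, e, c, hEd, he, hc, rfl⟩ := exists_eq_stepLp r φ hφ
    have hnc : ∀ (i : ι) (x : ℝ), ‖((c i ^ x : ℝ) : ℂ)‖ = c i ^ x := fun i x => by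
      rw [Complex.norm_real, Real.norm_of_nonneg (Real.rpow_nonneg (hc i).le _)]
    have hpow : ∀ {q : Expo} {x : ℝ}, x ^ (1 / q.1) = 1 → 0 ≤ x → x = 1 := fun {q x} h h0 => by
      have := congrArg (· ^ q.1) h
      simpa [← Real.rpow_mul h0, inv_mul_cancel₀ q.pos.ne'] using this
    have hcm : ∑ i, c i ^ r.1 * (volJ T).real (E i) = 1 := by
      rw [norm_stepLp hEd he] at hf
      have h0 : 0 ≤ ∑ i, ‖((c i : ℝ) : ℂ)‖ ^ r.1 * (volJ T).real (E i) :=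
        Finset.sum_nonneg fun i _ => by positivity
      have := hpow hf h0
      simpa [abs_of_pos (hc _)] using this
    -- Raising the coefficients to the power `r/2` turns a unit vector of `L^r` into a unit vector
    -- of `L²`, to which the lower bound applies.
    set F : LJ T two V := stepLp T two hE e fun i => ((c i ^ (r.1 / 2) : ℝ) : ℂ) with hF
    have hFn : ‖F‖ = 1 := by
      rw [hF, norm_stepLp hEd he]
      simp only [hnc]
      have : ∀ i, (c i ^ (r.1 / 2)) ^ two.1 = c i ^ r.1 := fun i => by
        rw [← Real.rpow_mul (hc i).le, h2]; congr 1; ring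
      simp only [this, hcm, Real.one_rpow]
    have hb' := hb F
    rw [hFn, mul_one] at hb'
    have hkey : ‖Q two F‖ ≤ ‖Q r (stepLp T r hE e fun i => (c i : ℂ))‖ + 4 * γ * |θ - 1 / 2| := by
      refine norm_le_of_forall_simple h2 ?_ (by positivity)
      rintro h ⟨ψ, hψ⟩ hh
      obtain ⟨κ, _, H, hH, k, d, hHd, hk, hd, rfl⟩ := exists_eq_stepLp two ψ hψ
      have hdn : ∑ j, d j ^ (2 : ℝ) * (volJ T).real (H j) = 1 := by
        rw [norm_stepLp hHd hk] at hh
        have h0 : 0 ≤ ∑ j, ‖((d j : ℝ) : ℂ)‖ ^ two.1 * (volJ T).real (H j) :=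
          Finset.sum_nonneg fun i _ => by positivity
        have := hpow hh h0
        rw [h2] at this
        simpa only [Complex.norm_real, Real.norm_of_nonneg (hd _).le] using this
      set B : ι → κ → ℂ := fun i j => ∫ t in Ioo 0 T, ⟪(indicatorConstLp (ENNReal.ofReal two.1) (hH j)
        (measure_ne_top (volJ T) _) (k j) : LJ T two V) t, Q two (indicatorConstLp _ (hE i)
        (measure_ne_top (volJ T) _) (e i)) t⟫_ℂ with hB
      have hform := fun (p q : Expo) (a : ι → ℂ) (b : κ → ℂ) => sum_form_eq_integral Q hQ (r := p)
        (q := q) (hE := hE) (e := e) hconj hH k a b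
      have hbound : ∀ (p q : Expo) (hpq : p.1.HolderConjugate q.1)
          (hp : ∀ f : LJ T p V, ‖Q p f‖ ≤ γ * ‖f‖) (a : ι → ℂ) (b : κ → ℂ),
          ‖∑ i, ∑ j, B i j * a i * b j‖ ≤ γ * (∑ i, ‖a i‖ ^ p.1 * (volJ T).real (E i)) ^ (1 / p.1)
            * (∑ j, ‖b j‖ ^ q.1 * (volJ T).real (H j)) ^ (1 / q.1) := by
        intro p q hpq hp a b
        rw [hB, hform p q]
        refine (norm_integral_inner_le hpq _ _).2.trans ?_
        rw [norm_stepLp hHd hk]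
        simp only [RCLike.norm_conj]
        refine mul_le_mul_of_nonneg_right ?_ (Real.rpow_nonneg
          (Finset.sum_nonneg fun i _ => by positivity) _)
        rw [← norm_stepLp hEd he (hE := hE)]
        exact hp _
      have hmain := norm_form_le_add B s.holderConjugate r.holderConjugate
        (hbound s s.conj s.holderConjugate hs)
        (hbound s.conj s s.holderConjugate.symm hs') hc hd hcm hdn hθ0 hθ1 hθ
      rw [hB, hform two two, hform r r.conj] at hmain
      simp only [Complex.conj_ofReal] at hmain
      refine hmain.trans (add_le_add_left ?_ _)
      refine (norm_integral_inner_le r.holderConjugate _ _).2.trans (le_of_eq ?_)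
      rw [norm_stepLp hHd hk]
      -- Likewise the power `2/r'` makes the `L²` test function a unit vector of `L^{r'}`.
      have hnd : ∀ j, ‖((d j ^ (2 / r.conj.1) : ℝ) : ℂ)‖ ^ r.conj.1 = d j ^ (2 : ℝ) := fun j => by
        rw [Complex.norm_real, Real.norm_of_nonneg (Real.rpow_nonneg (hd j).le _),
          ← Real.rpow_mul (hd j).le, div_mul_cancel₀ _ r.conj.pos.ne']
      simp only [hnd, hdn, Real.one_rpow, mul_one]
    linarith
  refine closure_minimal (s := {f : LJ T r V | ∃ φ : SimpleFunc ℝ V, f =ᵐ[volJ T] φ}) ?_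
    (isClosed_le (continuous_norm.const_mul _) (Q r).continuous.norm) (dense_simple V T r f)
  rintro g ⟨φ, hφ⟩
  by_cases hg : ‖g‖ = 0
  · simp only [mem_ofPred_eq, hg, mul_zero]; positivity
  · have h1 := hunit (((‖g‖⁻¹ : ℝ) : ℂ) • g) ⟨((‖g‖⁻¹ : ℝ) : ℂ) • φ,
      (Lp.coeFn_smul _ _).trans (hφ.const_smul _)⟩
      (by rw [norm_smul, Complex.norm_real, norm_inv, norm_norm, inv_mul_cancel₀ hg])
    rw [map_smul, norm_smul, Complex.norm_real, norm_inv, norm_norm, inv_mul_eq_div,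
      le_div_iff₀ ((norm_nonneg g).lt_of_ne' hg)] at h1
    exact h1

end

/-! ### Perturbation of the autonomous problem -/

section

variable {V : Type*} [NormedAddCommGroup V] [InnerProductSpace ℂ V] [CompleteSpace V] {T : ℝ}
  {r : Expo} {S : V →L[ℂ] V}

lemma eq_of_add_volterra_eq (hS : S.IsPositive) {u w g : LJ T r V}
    (hu : S.compLpL _ (volJ T) u + volterra T r V u = g)
    (hw : S.compLpL _ (volJ T) w + volterra T r V w = g) : u = w := by
  rw [← sub_eq_zero]
  refine eq_zero_of_add_volterra hS ?_
  rw [map_sub, map_sub, sub_add_sub_comm, hu, hw, sub_self]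

/-- The solution operator `g ↦ u` of the autonomous problem `(S u)' + u = g`, `S u (0) = 0`. -/
def autSol (hS : S.IsPositive) (hT : 0 < T) (r : Expo) : LJ T r V →L[ℂ] LJ T r V :=
  LinearMap.mkContinuous
    { toFun := fun g => (exists_solution_autonomous hS hT g).choose
      map_add' := fun g h => by
        have h1 := (exists_solution_autonomous hS hT g).choose_spec.1
        have h2 := (exists_solution_autonomous hS hT h).choose_spec.1
        refine eq_of_add_volterra_eq hS (exists_solution_autonomous hS hT (g + h)).choose_spec.1 ?_
        generalize (exists_solution_autonomous hS hT g).choose = u at h1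
        generalize (exists_solution_autonomous hS hT h).choose = w at h2
        rw [map_add, map_add, add_add_add_comm, h1, h2, map_add]
      map_smul' := fun c g => by
        have h1 := (exists_solution_autonomous hS hT g).choose_spec.1
        refine eq_of_add_volterra_eq hS (exists_solution_autonomous hS hT (c • g)).choose_spec.1 ?_
        generalize (exists_solution_autonomous hS hT g).choose = u at h1
        rw [RingHom.id_apply, map_smul, map_smul, ← smul_add, h1, map_smul] }
    (mrConst r) fun g => (exists_solution_autonomous hS hT g).choose_spec.2

lemma autSol_add_volterra (hS : S.IsPositive) (hT : 0 < T) (g : LJ T r V) :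
    S.compLpL _ (volJ T) (autSol hS hT r g) + volterra T r V (autSol hS hT r g)
      = volterra T r V g :=
  (exists_solution_autonomous hS hT g).choose_spec.1

lemma autSol_spec (hS : S.IsPositive) (hT : 0 < T) (g : LJ T r V) :
    S.compLpL _ (volJ T) (autSol hS hT r g) = volterra T r V (g - autSol hS hT r g) := by
  rw [map_sub, eq_sub_iff_add_eq]
  exact autSol_add_volterra hS hT g

lemma autSol_unique (hS : S.IsPositive) (hT : 0 < T) {u y : LJ T r V}
    (h : S.compLpL _ (volJ T) u = volterra T r V y) : autSol hS hT r (y + u) = u :=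
  eq_of_add_volterra_eq hS (autSol_add_volterra hS hT (y + u)) (by rw [h, map_add])

lemma autSol_congr (hS : S.IsPositive) (hT : 0 < T) {r q : Expo} {f : LJ T r V} {g : LJ T q V}
    (h : f =ᵐ[volJ T] g) : autSol hS hT r f =ᵐ[volJ T] autSol hS hT q g := by
  set u := autSol hS hT r f with hu
  set w := autSol hS hT q g with hw
  have key : ∀ {p : Expo} (k : LJ T p V), ∀ᵐ t ∂(volJ T), S (autSol hS hT p k t)
      + ∫ s in (0 : ℝ)..t, autSol hS hT p k s = ∫ s in (0 : ℝ)..t, k s := fun {p} k => by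
    have h1 := Lp.ext_iff.1 (autSol_spec (r := p) hS hT k)
    filter_upwards [h1, S.coeFn_compLpL (autSol hS hT p k), volterra_coeFn (k - autSol hS hT p k),
      ae_restrict_mem measurableSet_Ioo] with t h1 h2 h3 ht
    have ht' := Ioo_subset_Icc_self ht
    have h0 : (0 : ℝ) ∈ Icc 0 T := ⟨le_rfl, hT.le⟩
    rw [← h2, h1, h3, integral_congr_volJ (Lp.coeFn_sub k (autSol hS hT p k)) ht']
    simp only [Pi.sub_apply]
    rw [intervalIntegral.integral_sub (intervalIntegrable_of_integrable k.integrable h0 ht')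
      (intervalIntegrable_of_integrable (LJ.integrable _) h0 ht'), sub_add_cancel]
  have hz := ae_eq_zero_of_add_primitive hS (u := fun t => u t - w t) (u.integrable.sub w.integrable) ?_
  · filter_upwards [hz] with t ht using sub_eq_zero.1 ht
  · filter_upwards [key f, key g, ae_restrict_mem measurableSet_Ioo] with t h1 h2 ht
    have ht' := Ioo_subset_Icc_self ht
    have h0 : (0 : ℝ) ∈ Icc 0 T := ⟨le_rfl, hT.le⟩
    rw [intervalIntegral.integral_sub (intervalIntegrable_of_integrable u.integrable h0 ht')
      (intervalIntegrable_of_integrable w.integrable h0 ht'), map_sub, sub_add_sub_comm, h1, h2,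
      integral_congr_volJ h ht', sub_self]

/-- The energy inequality `Re ∫ ⟨u, (S u)'⟩ ≥ 0`. -/
lemma integral_re_inner_nonneg (hS : S.IsPositive) (hT : 0 < T) {two : Expo} (h2 : two.1 = 2)
    {u y : LJ T two V} (h : S.compLpL _ (volJ T) u = volterra T two V y) :
    0 ≤ ∫ t in Ioo 0 T, RCLike.re ⟪u t, y t⟫_ℂ := by
  have hconj : two.1.HolderConjugate two.1 := by rw [h2]; exact Real.HolderConjugate.two_two
  set R := ∫ t in Ioo 0 T, RCLike.re ⟪u t, y t⟫_ℂ with hR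
  have hsq : ∀ w : LJ T two V, Integrable (fun t => ‖w t‖ ^ 2) (volJ T) := fun w => by
    have := (norm_integral_inner_le hconj w w).1.re
    simpa only [inner_self_eq_norm_sq] using this
  -- `u` also solves the problem for `τS` with datum `τy + u`. The `L²` constant is `1` for every
  -- positive operator, so `‖u‖ ≤ ‖u + τy‖` for all `τ > 0`; the first-order term of the expanded
  -- square is the energy.
  have key : ∀ τ : ℝ, 0 < τ → 0 ≤ τ * (τ * ‖y‖ ^ 2 + 2 * R) := by
    intro τ hτ
    have hSτ : ((τ : ℂ) • S).IsPositive := hS.smul_of_nonneg (by exact_mod_cast hτ.le)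
    have h1 : ((τ : ℂ) • S).compLpL _ (volJ T) u = volterra T two V ((τ : ℂ) • y) := by
      rw [map_smul, ← h]
      refine Lp.ext ?_
      filter_upwards [((τ : ℂ) • S).coeFn_compLpL u, S.coeFn_compLpL u,
        Lp.coeFn_smul (τ : ℂ) (S.compLpL _ (volJ T) u)] with t k1 k2 k3
      rw [k1, k3, Pi.smul_apply, k2]
      rfl
    obtain ⟨w, hw1, hw2⟩ := exists_solution_autonomous hSτ hT ((τ : ℂ) • y + u)
    have hwu : w = u := by
      rw [← sub_eq_zero]
      refine eq_zero_of_add_volterra hSτ ?_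
      rw [map_sub, map_sub, sub_add_sub_comm, hw1, h1, map_add, sub_self]
    rw [hwu, mrConst_two h2, one_mul] at hw2
    have h3 : ‖u‖ ^ 2 ≤ ‖(τ : ℂ) • y + u‖ ^ 2 := pow_le_pow_left₀ (norm_nonneg _) hw2 2
    have h4 : ‖(τ : ℂ) • y + u‖ ^ 2 = τ ^ 2 * ‖y‖ ^ 2 + 2 * τ * R + ‖u‖ ^ 2 := by
      have i1 := (hsq y).const_mul (τ ^ 2)
      have i2 := (norm_integral_inner_le hconj y u).1.re.const_mul (2 * τ)
      have i3 : Integrable (fun t => τ ^ 2 * ‖y t‖ ^ 2 + 2 * τ * RCLike.re ⟪u t, y t⟫_ℂ) (volJ T) :=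
        i1.add i2
      rw [norm_sq_LJ h2, norm_sq_LJ h2 y, norm_sq_LJ h2 u, hR, ← integral_const_mul,
        ← integral_const_mul, ← integral_add i1 i2, ← integral_add i3 (hsq u)]
      refine integral_congr_ae ?_
      filter_upwards [Lp.coeFn_add ((τ : ℂ) • y) u, Lp.coeFn_smul (τ : ℂ) y] with t k1 k2
      rw [k1, Pi.add_apply, k2, Pi.smul_apply, norm_add_sq (𝕜 := ℂ), norm_smul, Complex.norm_real,
        mul_pow, Real.norm_eq_abs, sq_abs, inner_smul_left, Complex.conj_ofReal, inner_re_symm (u t)]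
      have : RCLike.re ((τ : ℂ) * ⟪y t, u t⟫_ℂ) = τ * RCLike.re ⟪y t, u t⟫_ℂ := Complex.re_ofReal_mul _ _
      rw [this]
      ring
    nlinarith
  by_contra hneg
  push Not at hneg
  have hy : 0 ≤ ‖y‖ ^ 2 := by positivity
  -- A `τ` so small that `τ‖y‖² ≤ -R`, which contradicts `τ‖y‖² + 2R ≥ 0`.
  have h5 := key (-R / (‖y‖ ^ 2 + 1)) (div_pos (by linarith) (by positivity))
  have h6 := nonneg_of_mul_nonneg_right h5 (div_pos (by linarith) (by positivity))
  have h7 : -R / (‖y‖ ^ 2 + 1) * ‖y‖ ^ 2 ≤ -R := by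
    rw [div_mul_eq_mul_div, div_le_iff₀ (by positivity)]
    nlinarith
  linarith

/-- Multiplication by a strongly measurable family of operators preserves measurability. -/
lemma aestronglyMeasurable_apply {X Y : Type*} [NormedAddCommGroup X] [NormedSpace ℂ X]
    [NormedAddCommGroup Y] [NormedSpace ℂ Y] {𝓑 : ℝ → X →L[ℂ] Y}
    (h : ∀ x, AEStronglyMeasurable (fun t => 𝓑 t x) (volJ T)) {u : ℝ → X}
    (hu : AEStronglyMeasurable u (volJ T)) : AEStronglyMeasurable (fun t => 𝓑 t (u t)) (volJ T) := by
  obtain ⟨v, hv, huv⟩ := hu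
  refine AEStronglyMeasurable.congr (f := fun t => 𝓑 t (v t)) ?_ (by
    filter_upwards [huv] with t ht; rw [ht])
  refine aestronglyMeasurable_of_tendsto_ae Filter.atTop (f := fun n t => 𝓑 t (hv.approx n t)) ?_
    (Filter.Eventually.of_forall fun t => ((𝓑 t).continuous.tendsto _).comp (hv.tendsto_approx t))
  intro n
  set φ := hv.approx n
  have : (fun t => 𝓑 t (φ t)) = fun t => ∑ x ∈ φ.range, (φ ⁻¹' {x}).indicator (fun t => 𝓑 t x) t := by
    funext t
    rw [Finset.sum_eq_single (φ t)]
    · simp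
    · intro x _ hx
      have : t ∉ φ ⁻¹' {x} := fun h => hx h.symm
      simp [this]
    · intro hx
      exact absurd (φ.mem_range_self t) hx
  rw [this]
  exact Finset.aestronglyMeasurable_fun_sum _ fun x _ => (h x).indicator (φ.measurableSet_fiber x)

/-- Multiplication by a bounded, strongly measurable family of operators on `L^r(J; V)`. -/
def mulOp (T : ℝ) (r : Expo) {𝓑 : ℝ → V →L[ℂ] V}
    (h : ∀ x, AEStronglyMeasurable (fun t => 𝓑 t x) (volJ T)) {M : ℝ}
    (hM : ∀ t ∈ Ioo 0 T, ‖𝓑 t‖ ≤ M) : LJ T r V →L[ℂ] LJ T r V :=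
  have hle : ∀ u : LJ T r V, ∀ᵐ t ∂(volJ T), ‖𝓑 t (u t)‖ ≤ M * ‖u t‖ := fun u => by
    filter_upwards [ae_restrict_mem measurableSet_Ioo] with t ht
    exact (𝓑 t).le_of_opNorm_le (hM t ht) _
  have hmem : ∀ u : LJ T r V, MemLp (fun t => 𝓑 t (u t)) (ENNReal.ofReal r.1) (volJ T) := fun u =>
    MemLp.of_le_mul (Lp.memLp u) (aestronglyMeasurable_apply h (Lp.aestronglyMeasurable u)) (hle u)
  LinearMap.mkContinuous
    { toFun := fun u => (hmem u).toLp
      map_add' := fun u v => by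
        rw [← MemLp.toLp_add]
        refine MemLp.toLp_congr _ _ ?_
        filter_upwards [Lp.coeFn_add u v] with t ht
        rw [ht, Pi.add_apply, map_add, Pi.add_apply]
      map_smul' := fun c u => by
        rw [RingHom.id_apply, ← MemLp.toLp_const_smul]
        refine MemLp.toLp_congr _ _ ?_
        filter_upwards [Lp.coeFn_smul c u] with t ht
        rw [ht, Pi.smul_apply, map_smul, Pi.smul_apply] }
    M fun u => by
      refine Lp.norm_le_mul_norm_of_ae_le_mul ?_
      filter_upwards [(hmem u).coeFn_toLp, hle u] with t h1 h2
      exact (congrArg norm h1).trans_le h2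

lemma mulOp_coeFn {Y : Type*} [NormedAddCommGroup Y] [InnerProductSpace ℂ Y]
    {𝓑 : ℝ → Y →L[ℂ] Y} (h : ∀ x, AEStronglyMeasurable (fun t => 𝓑 t x) (volJ T)) {M : ℝ}
    (hM : ∀ t ∈ Ioo 0 T, ‖𝓑 t‖ ≤ M) (u : LJ T r Y) :
    mulOp T r h hM u =ᵐ[volJ T] fun t => 𝓑 t (u t) :=
  (MemLp.of_le_mul (Lp.memLp u) (aestronglyMeasurable_apply h (Lp.aestronglyMeasurable u)) (by
    filter_upwards [ae_restrict_mem measurableSet_Ioo] with t ht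
    exact (𝓑 t).le_of_opNorm_le (hM t ht) _)).coeFn_toLp

lemma norm_mulOp_le {Y : Type*} [NormedAddCommGroup Y] [InnerProductSpace ℂ Y]
    {𝓑 : ℝ → Y →L[ℂ] Y} (h : ∀ x, AEStronglyMeasurable (fun t => 𝓑 t x) (volJ T)) {M : ℝ}
    (hM : ∀ t ∈ Ioo 0 T, ‖𝓑 t‖ ≤ M) (u : LJ T r Y) : ‖mulOp T r h hM u‖ ≤ M * ‖u‖ := by
  refine Lp.norm_le_mul_norm_of_ae_le_mul ?_
  filter_upwards [mulOp_coeFn h hM u, ae_restrict_mem measurableSet_Ioo] with t h1 ht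
  rw [h1]
  exact (𝓑 t).le_of_opNorm_le (hM t ht) _

/-- A strongly measurable family of operators on `V`, uniformly coercive and bounded on `(0, T)`. -/
structure IsCoerciveFamily (T cl cu : ℝ) (𝓑 : ℝ → V →L[ℂ] V) : Prop where
  measurable : ∀ x, AEStronglyMeasurable (fun t => 𝓑 t x) (volJ T)
  bounded : ∀ t ∈ Ioo 0 T, ‖𝓑 t‖ ≤ cu
  coercive : ∀ t ∈ Ioo 0 T, ∀ x, cl * ‖x‖ ^ 2 ≤ RCLike.re ⟪x, 𝓑 t x⟫_ℂ

/-- The operator `f ↦ y + 𝓑 u`, where `u` solves the autonomous problem with right-hand side `f` and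
`y = f - u`. -/
def pertOp (hS : S.IsPositive) (hT : 0 < T) {cl cu : ℝ} {𝓑 : ℝ → V →L[ℂ] V}
    (h𝓑 : IsCoerciveFamily T cl cu 𝓑) (r : Expo) : LJ T r V →L[ℂ] LJ T r V :=
  ContinuousLinearMap.id ℂ _ - autSol hS hT r
    + (mulOp T r h𝓑.measurable h𝓑.bounded).comp (autSol hS hT r)

variable {cl cu : ℝ} {𝓑 : ℝ → V →L[ℂ] V}

lemma pertOp_apply (hS : S.IsPositive) (hT : 0 < T) (h𝓑 : IsCoerciveFamily T cl cu 𝓑) (f : LJ T r V) :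
    pertOp hS hT h𝓑 r f = f - autSol hS hT r f
      + mulOp T r h𝓑.measurable h𝓑.bounded (autSol hS hT r f) := rfl

lemma pertOp_congr (hS : S.IsPositive) (hT : 0 < T) (h𝓑 : IsCoerciveFamily T cl cu 𝓑) {r q : Expo}
    {f : LJ T r V} {g : LJ T q V} (h : f =ᵐ[volJ T] g) :
    pertOp hS hT h𝓑 r f =ᵐ[volJ T] pertOp hS hT h𝓑 q g := by
  have key : ∀ {p : Expo} (k : LJ T p V), pertOp hS hT h𝓑 p k =ᵐ[volJ T]
      fun t => k t - autSol hS hT p k t + 𝓑 t (autSol hS hT p k t) := fun {p} k => by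
    filter_upwards [Lp.coeFn_add (k - autSol hS hT p k)
      (mulOp T p h𝓑.measurable h𝓑.bounded (autSol hS hT p k)), Lp.coeFn_sub k (autSol hS hT p k),
      mulOp_coeFn h𝓑.measurable h𝓑.bounded (autSol hS hT p k)] with t h1 h2 h3
    rw [pertOp_apply, h1, Pi.add_apply, h2, h3, Pi.sub_apply]
  filter_upwards [key f, key g, h, autSol_congr hS hT h] with t h1 h2 h3 h4
  rw [h1, h2, h3, h4]

/-- Pair `g = (f - u) + 𝓑u` with `u`. The first term contributes nonnegatively by the energy
inequality, so coercivity gives `‖u‖ ≤ ‖g‖/cl`. Then `f = g + u - 𝓑u` yields the factor `1 + (1 +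
cu)/cl`. -/
lemma norm_le_pertOp_of_eq_two (hS : S.IsPositive) (hT : 0 < T) (h𝓑 : IsCoerciveFamily T cl cu 𝓑)
    (hcl : 0 < cl) (hcu : 0 ≤ cu) {two : Expo} (h2 : two.1 = 2) (f : LJ T two V) :
    ‖f‖ ≤ (1 + cl + cu) / cl * ‖pertOp hS hT h𝓑 two f‖ := by
  have hconj : two.1.HolderConjugate two.1 := by rw [h2]; exact Real.HolderConjugate.two_two
  set u := autSol hS hT two f with hu
  set g := pertOp hS hT h𝓑 two f with hg
  set Bu := mulOp T two h𝓑.measurable h𝓑.bounded u with hBu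
  have hgeq : g = f - u + Bu := rfl
  have hE := integral_re_inner_nonneg hS hT h2 (autSol_spec (r := two) hS hT f)
  rw [← hu] at hE
  have hsq : Integrable (fun t => ‖u t‖ ^ 2) (volJ T) := by
    have := (norm_integral_inner_le hconj u u).1.re
    simpa only [inner_self_eq_norm_sq] using this
  have h1 : cl * ‖u‖ ^ 2 ≤ ∫ t in Ioo 0 T, RCLike.re ⟪u t, Bu t⟫_ℂ := by
    rw [norm_sq_LJ h2, ← integral_const_mul]
    refine integral_mono_ae (hsq.const_mul _) (norm_integral_inner_le hconj Bu u).1.re ?_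
    filter_upwards [mulOp_coeFn h𝓑.measurable h𝓑.bounded u, ae_restrict_mem measurableSet_Ioo]
      with t h3 ht
    rw [h3]
    exact h𝓑.coercive t ht _
  have h3 : (∫ t in Ioo 0 T, RCLike.re ⟪u t, Bu t⟫_ℂ) + ∫ t in Ioo 0 T, RCLike.re ⟪u t, (f - u) t⟫_ℂ
      = ∫ t in Ioo 0 T, RCLike.re ⟪u t, g t⟫_ℂ := by
    rw [← integral_add (norm_integral_inner_le hconj Bu u).1.re
      (norm_integral_inner_le hconj (f - u) u).1.re]
    refine integral_congr_ae ?_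
    filter_upwards [Lp.coeFn_add (f - u) Bu] with t ht
    rw [hgeq, ht, Pi.add_apply, inner_add_right, map_add, add_comm]
  have h4 : ∫ t in Ioo 0 T, RCLike.re ⟪u t, g t⟫_ℂ ≤ ‖g‖ * ‖u‖ := by
    have := (norm_integral_inner_le hconj g u)
    rw [integral_re this.1]
    exact (RCLike.re_le_norm _).trans this.2
  have h5 : ‖u‖ ≤ ‖g‖ / cl := by
    rw [le_div_iff₀ hcl]
    rcases (norm_nonneg u).eq_or_lt with h | h
    · rw [← h, zero_mul]; exact norm_nonneg _
    · nlinarith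
  have h6 : ‖Bu‖ ≤ cu * ‖u‖ := norm_mulOp_le _ _ _
  have h7 : f = g + u - Bu := by rw [hgeq]; abel
  have h8 : ‖f‖ ≤ ‖g‖ + ‖u‖ + ‖Bu‖ := by
    rw [h7]
    exact (norm_sub_le _ _).trans (add_le_add_left (norm_add_le _ _) _)
  calc ‖f‖ ≤ ‖g‖ + (1 + cu) * ‖u‖ := by linarith
    _ ≤ ‖g‖ + (1 + cu) * (‖g‖ / cl) := by gcongr
    _ = _ := by field_simp; ring

/-- Because `cl ≤ 1 ≤ cu`, the identity obeys the same bounds, and they are preserved by convex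
combinations. The lower bounds are thus uniform on the segment to the identity, where `pertOp` is
the identity. -/
lemma IsCoerciveFamily.path (h : IsCoerciveFamily T cl cu 𝓑) (hcl : cl ≤ 1) (hcu : 1 ≤ cu) {l : ℝ}
    (h0 : 0 ≤ l) (h1 : l ≤ 1) :
    IsCoerciveFamily T cl cu fun t => ((1 - l : ℝ) : ℂ) • ContinuousLinearMap.id ℂ V + (l : ℂ) • 𝓑 t where
  measurable x := by
    simp only [add_apply, smul_apply]
    exact aestronglyMeasurable_const.add ((h.measurable x).const_smul _)
  bounded t ht := by
    have h2 := h.bounded t ht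
    have h3 : ‖ContinuousLinearMap.id ℂ V‖ ≤ 1 := ContinuousLinearMap.norm_id_le
    refine (norm_add_le _ _).trans ?_
    rw [norm_smul, norm_smul, Complex.norm_real, Complex.norm_real, Real.norm_of_nonneg h0,
      Real.norm_of_nonneg (by linarith)]
    nlinarith
  coercive t ht x := by
    have h2 := h.coercive t ht x
    simp only [add_apply, smul_apply, ContinuousLinearMap.id_apply,
      inner_add_right, inner_smul_right, map_add]
    have e : ∀ (a : ℝ) (z : ℂ), RCLike.re ((a : ℂ) * z) = a * RCLike.re z := Complex.re_ofReal_mul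
    rw [e, e, inner_self_eq_norm_sq]
    nlinarith [sq_nonneg ‖x‖, mul_nonneg (sub_nonneg.2 hcl) (sq_nonneg ‖x‖),
      mul_nonneg (sub_nonneg.2 h1) (mul_nonneg (sub_nonneg.2 hcl) (sq_nonneg ‖x‖))]

/-- Method of continuity. The lower bound keeps the inverses below `1/c`, so a step of length `1/n`
with `n > ‖N‖/c` is a Neumann perturbation, and `n` such steps lead from `1` to `1 + N`. -/
lemma isUnit_one_add_of_lower_bound {Y : Type*} [NormedAddCommGroup Y] [NormedSpace ℂ Y]
    [CompleteSpace Y] (N : Y →L[ℂ] Y) {c : ℝ} (hc : 0 < c)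
    (h : ∀ l : ℝ, 0 ≤ l → l ≤ 1 → ∀ f, c * ‖f‖ ≤ ‖f + (l : ℂ) • N f‖) : IsUnit (1 + N) := by
  obtain ⟨n, hn⟩ := exists_nat_gt (‖N‖ / c)
  have hn0 : 0 < (n : ℝ) := lt_of_le_of_lt (by positivity) hn
  have key : ∀ k : ℕ, k ≤ n → IsUnit (1 + ((k / n : ℝ) : ℂ) • N) := by
    intro k
    induction k with
    | zero => intro _; simp
    | succ k ih =>
      intro hk
      obtain ⟨U, hU⟩ := ih (by omega)
      have hl0 : (0 : ℝ) ≤ k / n := by positivity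
      have hl1 : (k / n : ℝ) ≤ 1 := by
        rw [div_le_one hn0]; exact_mod_cast (by omega : k ≤ n)
      have hinv : ‖(↑U⁻¹ : Y →L[ℂ] Y)‖ ≤ c⁻¹ := by
        refine ContinuousLinearMap.opNorm_le_bound _ (by positivity) fun y => ?_
        have h1 := h _ hl0 hl1 ((↑U⁻¹ : Y →L[ℂ] Y) y)
        have h2 : (↑U⁻¹ : Y →L[ℂ] Y) y + ((k / n : ℝ) : ℂ) • N ((↑U⁻¹ : Y →L[ℂ] Y) y) = y := by
          have h3 : ((U : Y →L[ℂ] Y) * (↑U⁻¹ : Y →L[ℂ] Y)) y = y := by rw [U.mul_inv]; rfl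
          rw [hU] at h3
          exact h3
        rw [h2] at h1
        rw [inv_mul_eq_div, le_div_iff₀ hc]; linarith
      have hsmall : ‖-((↑U⁻¹ : Y →L[ℂ] Y) * (((1 / n : ℝ) : ℂ) • N))‖ < 1 := by
        rw [norm_neg]
        refine (norm_mul_le _ _).trans_lt ?_
        rw [norm_smul, Complex.norm_real, Real.norm_of_nonneg (by positivity)]
        calc ‖(↑U⁻¹ : Y →L[ℂ] Y)‖ * (1 / n * ‖N‖) ≤ c⁻¹ * (1 / n * ‖N‖) := by gcongr
          _ = ‖N‖ / c / n := by field_simp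
          _ < 1 := by rw [div_lt_one hn0]; exact hn
      have hunit := (U.isUnit).mul (isUnit_one_sub_of_norm_lt_one hsmall)
      have e : 1 + (((k + 1 : ℕ) / n : ℝ) : ℂ) • N
          = (U : Y →L[ℂ] Y) * (1 - -((↑U⁻¹ : Y →L[ℂ] Y) * (((1 / n : ℝ) : ℂ) • N))) := by
        rw [sub_neg_eq_add, mul_add, mul_one, ← mul_assoc, U.mul_inv, one_mul, hU, add_assoc,
          ← add_smul]
        congr 2
        push_cast; ring
      rw [e]; exact hunit
  have := key n le_rfl
  rw [div_self hn0.ne'] at this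
  simpa using this

/-- Perturbation theorem: for exponents close to `2` the operator `pertOp` is invertible. -/
theorem pertOp_bijective (hS : S.IsPositive) (hT : 0 < T) (h𝓑 : IsCoerciveFamily T cl cu 𝓑)
    (hcl : 0 < cl) (hcl1 : cl ≤ 1) (hcu : 1 ≤ cu) {s : Expo} {C : ℝ} (hC : 0 ≤ C)
    (hs : ∀ f : LJ T s V, ‖autSol hS hT s f‖ + ‖f - autSol hS hT s f‖ ≤ C * ‖f‖)
    (hs' : ∀ f : LJ T s.conj V, ‖autSol hS hT s.conj f‖ + ‖f - autSol hS hT s.conj f‖ ≤ C * ‖f‖)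
    {θ : ℝ} (hθ0 : 0 < θ) (hθ1 : θ < 1) (hθ : 1 / r.1 = (1 - θ) / s.conj.1 + θ / s.1)
    (hκ : |θ - 1 / 2| ≤ 1 / 12 * (1 / (1 + 2 * (1 + (1 + cl + cu) / cl) * cu * C))) :
    Function.Bijective (pertOp hS hT h𝓑 r) ∧
      ∀ f, ‖f‖ ≤ 8 * ((1 + cl + cu) / cl) * ‖pertOp hS hT h𝓑 r f‖ := by
  set β := (1 + cl + cu) / cl with hβ
  have hβ0 : 0 < β := by positivity
  set two : Expo := ⟨2, one_lt_two⟩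
  have hγ0 : 0 ≤ cu * C := by positivity
  have hlow : ∀ {𝓑' : ℝ → V →L[ℂ] V} (h' : IsCoerciveFamily T cl cu 𝓑') (f : LJ T r V),
      1 / (8 * β) * ‖f‖ ≤ ‖pertOp hS hT h' r f‖ := by
    intro 𝓑' h' f
    -- As `cu ≥ 1`, one has `‖(f - u) + 𝓑u‖ ≤ cu (‖f - u‖ + ‖u‖)`.
    have hend : ∀ {q : Expo}, (∀ f : LJ T q V, ‖autSol hS hT q f‖ + ‖f - autSol hS hT q f‖ ≤ C * ‖f‖) →
        ∀ f : LJ T q V, ‖pertOp hS hT h' q f‖ ≤ cu * C * ‖f‖ := fun {q} hq f => by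
      have k1 := hq f
      have k2 := norm_mulOp_le (r := q) h'.measurable h'.bounded (autSol hS hT q f)
      have k3 := norm_add_le (f - autSol hS hT q f) (mulOp T q h'.measurable h'.bounded (autSol hS hT q f))
      rw [pertOp_apply]
      nlinarith [norm_nonneg (f - autSol hS hT q f), norm_nonneg (autSol hS hT q f)]
    have hmain := lower_bound_of_interpolation (fun q => pertOp hS hT h' q)
      (fun _ _ _ _ h => pertOp_congr hS hT h' h) (r := r) (two := two) rfl hγ0 (hend hs) (hend hs')
      (b := 1 / β) (fun f => by
        rw [one_div, inv_mul_le_iff₀ hβ0]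
        exact norm_le_pertOp_of_eq_two hS hT h' hcl (by linarith) rfl f) hθ0 hθ1 hθ f
    refine le_trans (mul_le_mul_of_nonneg_right ?_ (norm_nonneg f)) hmain
    have hD : 0 < 1 + 2 * (1 + β) * cu * C := by positivity
    -- This is where the form of `κ_s` is used: the interpolation loss takes at most a sixth of
    -- `1/β`. What remains, `5/(6β)`, is more than the `1/(8β)` needed.
    have h3 : 4 * (cu * C) * |θ - 1 / 2| ≤ 1 / (6 * β) := by
      refine (mul_le_mul_of_nonneg_left hκ (by positivity)).trans ?_
      rw [le_div_iff₀ (by positivity)]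
      have : 4 * (cu * C) * (1 / 12 * (1 / (1 + 2 * (1 + β) * cu * C))) * (6 * β)
          = (2 * β * (cu * C)) / (1 + 2 * (1 + β) * cu * C) := by
        field_simp; ring
      rw [this, div_le_one hD]
      nlinarith
    have h4 : 1 / β - 1 / (6 * β) = 5 / (6 * β) := by field_simp; norm_num
    have h5 : 1 / (8 * β) ≤ 5 / (6 * β) := by
      rw [div_le_div_iff₀ (by positivity) (by positivity)]; nlinarith
    linarith
  have hbound : ∀ f, ‖f‖ ≤ 8 * β * ‖pertOp hS hT h𝓑 r f‖ := fun f => by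
    have := hlow h𝓑 f
    rwa [one_div, inv_mul_le_iff₀ (by positivity)] at this
  refine ⟨⟨?_, ?_⟩, hbound⟩
  · refine (injective_iff_map_eq_zero _).2 fun f hf => ?_
    have := hbound f
    rw [hf, norm_zero, mul_zero] at this
    exact norm_le_zero_iff.1 this
  -- `pertOp = 1 + N`, and `1 + lN` is the `pertOp` of the convex combination with parameter `l`.
  · set N : LJ T r V →L[ℂ] LJ T r V :=
      (mulOp T r h𝓑.measurable h𝓑.bounded).comp (autSol hS hT r) - autSol hS hT r with hN
    have hunit := isUnit_one_add_of_lower_bound N (c := 1 / (8 * β)) (by positivity) fun l h0 h1 f => by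
      refine (hlow (h𝓑.path hcl1 hcu h0 h1) f).trans (le_of_eq ?_)
      congr 1
      rw [pertOp_apply]
      set u := autSol hS hT r f with hu
      have hNf : N f = mulOp T r h𝓑.measurable h𝓑.bounded u - u := rfl
      rw [hNf]
      have : mulOp T r (h𝓑.path hcl1 hcu h0 h1).measurable (h𝓑.path hcl1 hcu h0 h1).bounded u
          = ((1 - l : ℝ) : ℂ) • u + (l : ℂ) • mulOp T r h𝓑.measurable h𝓑.bounded u := by
        refine Lp.ext ?_
        filter_upwards [mulOp_coeFn (h𝓑.path hcl1 hcu h0 h1).measurable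
          (h𝓑.path hcl1 hcu h0 h1).bounded u, mulOp_coeFn h𝓑.measurable h𝓑.bounded u,
          Lp.coeFn_add (((1 - l : ℝ) : ℂ) • u) ((l : ℂ) • mulOp T r h𝓑.measurable h𝓑.bounded u),
          Lp.coeFn_smul ((1 - l : ℝ) : ℂ) u,
          Lp.coeFn_smul (l : ℂ) (mulOp T r h𝓑.measurable h𝓑.bounded u)] with t k1 k2 k3 k4 k5
        rw [k1, k3, Pi.add_apply, k4, k5, Pi.smul_apply, Pi.smul_apply, k2]
        rfl
      rw [this]
      push_cast
      module
    obtain ⟨U, hU⟩ := hunit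
    intro g
    refine ⟨(↑U⁻¹ : LJ T r V →L[ℂ] LJ T r V) g, ?_⟩
    have h1 : ((U : LJ T r V →L[ℂ] LJ T r V) * (↑U⁻¹ : LJ T r V →L[ℂ] LJ T r V)) g = g := by
      rw [U.mul_inv]; rfl
    have h2 : pertOp hS hT h𝓑 r = 1 + N := by
      ext1 f
      rw [pertOp_apply]
      show _ = f + (mulOp T r h𝓑.measurable h𝓑.bounded (autSol hS hT r f) - autSol hS hT r f)
      abel
    rw [h2, ← hU]
    exact h1

end

/-! ### Maximal regularity through the Riesz isometry -/

section

variable {Y Z : Type*} [NormedAddCommGroup Y] [NormedSpace ℂ Y]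
  [NormedAddCommGroup Z] [NormedSpace ℂ Z] {T : ℝ} {r : Expo}

lemma compLpL_symm_apply (J : Y ≃ₗᵢ[ℂ] Z) (f : LJ T r Z) :
    (J : Y →L[ℂ] Z).compLpL (ENNReal.ofReal r.1) (volJ T)
      ((J.symm : Z →L[ℂ] Y).compLpL (ENNReal.ofReal r.1) (volJ T) f) = f := by
  refine Lp.ext ?_
  filter_upwards [(J : Y →L[ℂ] Z).coeFn_compLpL ((J.symm : Z →L[ℂ] Y).compLpL _ (volJ T) f),
    (J.symm : Z →L[ℂ] Y).coeFn_compLpL f] with t h1 h2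
  rw [h1, h2]
  exact J.apply_symm_apply _

lemma symm_compLpL_apply (J : Y ≃ₗᵢ[ℂ] Z) (f : LJ T r Y) :
    (J.symm : Z →L[ℂ] Y).compLpL (ENNReal.ofReal r.1) (volJ T)
      ((J : Y →L[ℂ] Z).compLpL (ENNReal.ofReal r.1) (volJ T) f) = f := by
  refine Lp.ext ?_
  filter_upwards [(J.symm : Z →L[ℂ] Y).coeFn_compLpL ((J : Y →L[ℂ] Z).compLpL _ (volJ T) f),
    (J : Y →L[ℂ] Z).coeFn_compLpL f] with t h1 h2
  rw [h1, h2]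
  exact J.symm_apply_apply _

lemma norm_compLpL_isometryEquiv (J : Y ≃ₗᵢ[ℂ] Z) (f : LJ T r Y) :
    ‖(J : Y →L[ℂ] Z).compLpL (ENNReal.ofReal r.1) (volJ T) f‖ = ‖f‖ := by
  rw [Lp.norm_def, Lp.norm_def, eLpNorm_congr_norm_ae (g := f)]
  filter_upwards [(J : Y →L[ℂ] Z).coeFn_compLpL f] with t h1
  rw [h1]
  exact J.norm_map _

lemma parabolicOp_apply {e K : Y →L[ℂ] Z} (u : MR T r e) :
    parabolicOp T r e K u = MR.der u + K.compLpL (ENNReal.ofReal r.1) (volJ T) (MR.val u) := rfl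

variable {V X : Type*} [NormedAddCommGroup V] [InnerProductSpace ℂ V]
  [NormedAddCommGroup X] [NormedSpace ℂ X]

variable {J : V ≃ₗᵢ[ℂ] X} {e : V →L[ℂ] X}

lemma symm_der_eq (u : MR T r e) :
    (J.symm : X →L[ℂ] V).compLpL _ (volJ T) (MR.der u)
      = (J.symm : X →L[ℂ] V).compLpL _ (volJ T) (parabolicOp T r e (J : V →L[ℂ] X) u)
        - MR.val u := by
  rw [parabolicOp_apply, map_add, symm_compLpL_apply, add_sub_cancel_right]

variable [CompleteSpace V]

lemma mem_MR_iff_symm [CompleteSpace X] (hT : 0 < T) (p : WithLp 1 (LJ T r V × LJ T r X)) :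
    p ∈ MR T r e ↔ ((J.symm : X →L[ℂ] V).comp e).compLpL _ (volJ T) p.fst
      = volterra T r V ((J.symm : X →L[ℂ] V).compLpL _ (volJ T) p.snd) := by
  have h1 : ((J.symm : X →L[ℂ] V).comp e).compLpL (ENNReal.ofReal r.1) (volJ T) p.fst
      = (J.symm : X →L[ℂ] V).compLpL _ (volJ T) (e.compLpL _ (volJ T) p.fst) := by
    refine Lp.ext ?_
    filter_upwards [((J.symm : X →L[ℂ] V).comp e).coeFn_compLpL p.fst,
      (J.symm : X →L[ℂ] V).coeFn_compLpL (e.compLpL _ (volJ T) p.fst),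
      e.coeFn_compLpL p.fst] with t h1 h2 h3
    rw [h1, h2, h3]
    rfl
  have h2 : volterra T r V ((J.symm : X →L[ℂ] V).compLpL _ (volJ T) p.snd)
      = (J.symm : X →L[ℂ] V).compLpL _ (volJ T) (volterra T r X p.snd) :=
    volterra_comm (J.symm : X →L[ℂ] V) p.snd
  rw [mem_MR_iff hT, h1, h2]
  refine ⟨fun h => by rw [h], fun h => ?_⟩
  have := congrArg ((J : V →L[ℂ] X).compLpL _ (volJ T)) h
  rwa [compLpL_symm_apply, compLpL_symm_apply] at this

/-- The change of unknown: `f = J⁻¹(∂/∂t + J)u` parametrises `MR`, with `u` the autonomous solution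
for `f` and `J⁻¹u' = f - u`. -/
lemma val_eq_autSol [CompleteSpace X] 
    (hS : ((J.symm : X →L[ℂ] V).comp e).IsPositive) (hT : 0 < T) (u : MR T r e) :
    MR.val u = autSol hS hT r
      ((J.symm : X →L[ℂ] V).compLpL _ (volJ T) (parabolicOp T r e (J : V →L[ℂ] X) u)) := by
  rw [parabolicOp_apply, map_add, symm_compLpL_apply]
  exact (autSol_unique hS hT ((mem_MR_iff_symm hT u.1).1 u.2)).symm

lemma parabolicOp_bijective [CompleteSpace X] 
    (hS : ((J.symm : X →L[ℂ] V).comp e).IsPositive) (hT : 0 < T) :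
    Function.Bijective (parabolicOp T r e (J : V →L[ℂ] X)) := by
  refine ⟨(injective_iff_map_eq_zero _).2 fun u hu => ?_, fun h => ?_⟩
  · have h1 : MR.val u = 0 := by rw [val_eq_autSol hS hT, hu, map_zero, map_zero]
    have h2 : MR.der u = 0 := by
      rw [parabolicOp_apply, h1, map_zero, add_zero] at hu
      exact hu
    exact Subtype.ext ((WithLp.ofLp_injective 1) (Prod.ext h1 h2))
  · set g := (J.symm : X →L[ℂ] V).compLpL _ (volJ T) h with hg
    set u := autSol hS hT r g with hu
    have hmem : WithLp.toLp 1 (u, (J : V →L[ℂ] X).compLpL _ (volJ T) (g - u)) ∈ MR T r e := by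
      rw [mem_MR_iff_symm (J := J) hT]
      show ((J.symm : X →L[ℂ] V).comp e).compLpL _ (volJ T) u = volterra T r V
        ((J.symm : X →L[ℂ] V).compLpL _ (volJ T) ((J : V →L[ℂ] X).compLpL _ (volJ T) (g - u)))
      rw [symm_compLpL_apply]
      exact autSol_spec hS hT g
    refine ⟨⟨_, hmem⟩, ?_⟩
    rw [parabolicOp_apply]
    show (J : V →L[ℂ] X).compLpL _ (volJ T) (g - u) + (J : V →L[ℂ] X).compLpL _ (volJ T) u = h
    rw [← map_add, sub_add_cancel, hg, compLpL_symm_apply]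

lemma parabolicOp_isInvertible [CompleteSpace X] 
    (hS : ((J.symm : X →L[ℂ] V).comp e).IsPositive) (hT : 0 < T) :
    (parabolicOp T r e (J : V →L[ℂ] X)).IsInvertible := by
  have := completeSpace_MR (r := r) (e := e) hT
  have hb := parabolicOp_bijective (r := r) hS hT
  exact ⟨ContinuousLinearEquiv.ofBijective _ (LinearMap.ker_eq_bot.2 hb.1)
    (LinearMap.range_eq_top.2 hb.2), ContinuousLinearEquiv.coe_ofBijective _ _ _⟩

/-- The left side is the `ℓ¹`-type norm of the element of `MR` parametrised by `f`, because `J` is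
isometric. This is how the constant `constJ` enters the perturbation theorem. -/
lemma norm_autSol_add_le [CompleteSpace X] 
    (hS : ((J.symm : X →L[ℂ] V).comp e).IsPositive) (hT : 0 < T) (f : LJ T r V) :
    ‖autSol hS hT r f‖ + ‖f - autSol hS hT r f‖
      ≤ ‖(parabolicOp T r e (J : V →L[ℂ] X)).inverse‖ * ‖f‖ := by
  set h := (J : V →L[ℂ] X).compLpL _ (volJ T) f with hh
  set u := (parabolicOp T r e (J : V →L[ℂ] X)).inverse h with hu
  have hPu : parabolicOp T r e (J : V →L[ℂ] X) u = h := by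
    obtain ⟨M, hM⟩ := parabolicOp_isInvertible (r := r) hS hT
    rw [hu, ← hM, ContinuousLinearMap.inverse_equiv]
    exact M.apply_symm_apply h
  have h1 : MR.val u = autSol hS hT r f := by
    rw [val_eq_autSol hS hT, hPu, hh, symm_compLpL_apply]
  have h2 : ‖MR.der u‖ = ‖f - autSol hS hT r f‖ := by
    refine (norm_compLpL_isometryEquiv J.symm _).symm.trans ?_
    rw [symm_der_eq, hPu, hh, h1, symm_compLpL_apply]
  have h3 : ‖u‖ = ‖MR.val u‖ + ‖MR.der u‖ := WithLp.prod_norm_eq_of_L1 u.1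
  rw [← h2, ← h1, ← h3]
  refine (ContinuousLinearMap.le_opNorm _ _).trans_eq ?_
  rw [hh, norm_compLpL_isometryEquiv]

/-- `pertOp` acts on `J⁻¹(∂/∂t + J)u`, whose norm is the modified norm of `u`; a bound for its
inverse is therefore already the bound claimed for the solution operator. -/
lemma isSolution_iff [CompleteSpace X] 
    (hS : ((J.symm : X →L[ℂ] V).comp e).IsPositive) (hT : 0 < T) {cl cu : ℝ} {𝒜 : ℝ → V →L[ℂ] X}
    (h𝒜 : IsCoerciveFamily T cl cu fun t => (J.symm : X →L[ℂ] V).comp (𝒜 t)) (f : LJ T r X)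
    (u : MR T r e) :
    IsSolution 𝒜 f u ↔ pertOp hS hT h𝒜 r
      ((J.symm : X →L[ℂ] V).compLpL _ (volJ T) (parabolicOp T r e (J : V →L[ℂ] X) u))
        = (J.symm : X →L[ℂ] V).compLpL _ (volJ T) f := by
  rw [pertOp_apply, ← val_eq_autSol, ← symm_der_eq, Lp.ext_iff]
  refine Filter.eventually_congr ?_
  filter_upwards [Lp.coeFn_add ((J.symm : X →L[ℂ] V).compLpL _ (volJ T) (MR.der u))
      (mulOp T r h𝒜.measurable h𝒜.bounded (MR.val u)),
    mulOp_coeFn h𝒜.measurable h𝒜.bounded (MR.val u),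
    (J.symm : X →L[ℂ] V).coeFn_compLpL (MR.der u), (J.symm : X →L[ℂ] V).coeFn_compLpL f]
    with t h1 h2 h3 h4
  rw [h1, Pi.add_apply, h2, h3, h4]
  exact (J.symm.injective.eq_iff (a := MR.der u t + 𝒜 t (MR.val u t))).symm.trans (by
    rw [map_add]; rfl)

/-- A self-adjoint operator with trivial kernel has dense range, and `J` carries the range of `S` to
that of `e`. -/
lemma denseRange_of_isPositive 
    (hS : ((J.symm : X →L[ℂ] V).comp e).IsPositive) (he : Function.Injective e) : DenseRange e := by
  set S := (J.symm : X →L[ℂ] V).comp e with hSdef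
  have hinj : Function.Injective S := J.symm.injective.comp he
  have h1 : DenseRange S := by
    have : (S.range)ᗮ = ⊥ := by
      rw [ContinuousLinearMap.orthogonal_range, hS.isSelfAdjoint.adjoint_eq]
      exact LinearMap.ker_eq_bot.2 hinj
    have h2 := (Submodule.topologicalClosure_eq_top_iff).2 this
    exact Submodule.dense_iff_topologicalClosure_eq_top.2 h2
  have h2 : e = J ∘ S := by
    funext x; exact (J.apply_symm_apply _).symm
  rw [h2]
  exact J.surjective.denseRange.comp h1 J.continuous

/-- Coercivity bounds `A` from below, so the graph map is bounded below in the norm of `V` and its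
range is complete. -/
lemma isClosed_range_of_coercive {S : V →L[ℂ] X} {A : V →L[ℂ] X} {cl : ℝ} (hcl : 0 < cl)
    (h : ∀ x, cl * ‖x‖ ^ 2 ≤ RCLike.re ⟪x, J.symm (A x)⟫_ℂ) :
    IsClosed (range fun x : V => (S x, A x)) := by
  have hlow : ∀ x, cl * ‖x‖ ≤ ‖A x‖ := fun x => by
    have h1 := (h x).trans ((RCLike.re_le_norm _).trans (norm_inner_le_norm _ _))
    rw [J.symm.norm_map] at h1
    rcases (norm_nonneg x).eq_or_lt with h0 | h0
    · rw [← h0, mul_zero]; exact norm_nonneg _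
    · nlinarith
  have hanti : AntilipschitzWith (Real.toNNReal cl⁻¹) (S.prod A) := by
    refine ContinuousLinearMap.antilipschitz_of_bound _ fun x => ?_
    rw [Real.coe_toNNReal _ (by positivity), inv_mul_eq_div, le_div_iff₀ hcl, mul_comm]
    exact (hlow x).trans (le_max_right _ _)
  exact hanti.isClosed_range (S.prod A).uniformContinuous

/-- Maximal regularity of coercive non-autonomous problems for exponents close to `2`. -/
theorem hasMaximalRegularity_of_coercive [CompleteSpace X] 
    (hS : ((J.symm : X →L[ℂ] V).comp e).IsPositive) (hT : 0 < T) (he : Function.Injective e)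
    {cl cu : ℝ} (hcl : 0 < cl) (hcl1 : cl ≤ 1) (hcu : 1 ≤ cu) {𝒜 : ℝ → V →L[ℂ] X}
    (h𝒜 : IsCoerciveFamily T cl cu fun t => (J.symm : X →L[ℂ] V).comp (𝒜 t)) {s : Expo} {C : ℝ}
    (hs : ‖(parabolicOp T s e (J : V →L[ℂ] X)).inverse‖ ≤ C)
    (hs' : ‖(parabolicOp T s.conj e (J : V →L[ℂ] X)).inverse‖ ≤ C)
    {θ : ℝ} (hθ0 : 0 < θ) (hθ1 : θ < 1) (hθ : 1 / r.1 = (1 - θ) / s.conj.1 + θ / s.1)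
    (hκ : |θ - 1 / 2| ≤ 1 / 12 * (1 / (1 + 2 * (1 + (1 + cl + cu) / cl) * cu * C))) :
    HasMaximalRegularity T r e 𝒜 ∧ ∀ (f : LJ T r X) (u : MR T r e), IsSolution 𝒜 f u →
      ‖parabolicOp T r e (J : V →L[ℂ] X) u‖ ≤ 8 * ((1 + cl + cu) / cl) * ‖f‖ := by
  obtain ⟨hb, hbound⟩ := pertOp_bijective (r := r) hS hT h𝒜 hcl hcl1 hcu (le_trans (norm_nonneg (parabolicOp T s e (J : V →L[ℂ] X)).inverse) hs)
    (fun f => (norm_autSol_add_le hS hT f).trans (mul_le_mul_of_nonneg_right hs (norm_nonneg _)))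
    (fun f => (norm_autSol_add_le hS hT f).trans (mul_le_mul_of_nonneg_right hs' (norm_nonneg _)))
    hθ0 hθ1 hθ hκ
  have hP := parabolicOp_bijective (r := r) hS hT
  have hJ : ∀ x, J (J.symm x) = x := J.apply_symm_apply
  refine ⟨⟨⟨he, denseRange_of_isPositive hS he⟩, ⟨cu, fun t ht => ?_⟩, fun ψ => ?_, fun t ht => ?_,
    fun f => ?_⟩, fun f u hu => ?_⟩
  · refine ContinuousLinearMap.opNorm_le_bound _ (by linarith) fun x => ?_
    have h1 := ((J.symm : X →L[ℂ] V).comp (𝒜 t)).le_of_opNorm_le (h𝒜.bounded t ht) x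
    rwa [ContinuousLinearMap.comp_apply, show ‖(J.symm : X →L[ℂ] V) (𝒜 t x)‖ = ‖𝒜 t x‖ from
      J.symm.norm_map _] at h1
  · have h1 := J.continuous.comp_aestronglyMeasurable (h𝒜.measurable ψ)
    refine h1.congr (Filter.Eventually.of_forall fun t => J.apply_symm_apply _)
  · exact isClosed_range_of_coercive (J := J) hcl fun x => h𝒜.coercive t ht x
  · obtain ⟨g, hg⟩ := hb.2 ((J.symm : X →L[ℂ] V).compLpL _ (volJ T) f)
    obtain ⟨u, hu⟩ := hP.2 ((J : V →L[ℂ] X).compLpL _ (volJ T) g)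
    refine ⟨u, (isSolution_iff hS hT h𝒜 f u).2 ?_, fun w hw => ?_⟩
    · rw [hu, symm_compLpL_apply, hg]
    · have h1 := (isSolution_iff hS hT h𝒜 f w).1 hw
      have h2 := hb.1 (h1.trans hg.symm)
      refine hP.1 (Eq.trans ?_ hu.symm)
      rw [← h2, compLpL_symm_apply]
  · have h1 := (isSolution_iff hS hT h𝒜 f u).1 hu
    have h2 := hbound
      ((J.symm : X →L[ℂ] V).compLpL _ (volJ T) (parabolicOp T r e (J : V →L[ℂ] X) u))
    rw [h1] at h2
    rwa [show _ = ‖_‖ from norm_compLpL_isometryEquiv J.symm _,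
      show _ = ‖f‖ from norm_compLpL_isometryEquiv J.symm f] at h2

end

/-! ### The Sobolev space with partially vanishing trace -/

section

variable {d : ℕ} {Ω D : Set (Pt d)}

instance : CompleteSpace (W Ω D) :=
  inferInstanceAs (CompleteSpace ↥(testPairs Ω D).topologicalClosure)

lemma W.inner_eq (φ ψ : W Ω D) :
    ⟪φ, ψ⟫_ℂ = ⟪toL2 Ω D φ, toL2 Ω D ψ⟫_ℂ + ⟪wgrad Ω D φ, wgrad Ω D ψ⟫_ℂ :=
  WithLp.prod_inner_apply (toPair Ω D φ) (toPair Ω D ψ)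

lemma W.norm_sq_eq (ψ : W Ω D) : ‖ψ‖ ^ 2 = ‖toL2 Ω D ψ‖ ^ 2 + ‖wgrad Ω D ψ‖ ^ 2 := by
  rw [← inner_self_eq_norm_sq (𝕜 := ℂ), W.inner_eq, map_add, inner_self_eq_norm_sq,
    inner_self_eq_norm_sq]

lemma dualityMap_apply (ψ φ : W Ω D) : dualityMap Ω D ψ φ = ⟪φ, ψ⟫_ℂ := rfl

lemma embed_apply (ψ φ : W Ω D) : embed Ω D ψ φ = ⟪toL2 Ω D φ, toL2 Ω D ψ⟫_ℂ := rfl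

lemma norm_dualityMap (ψ : W Ω D) : ‖dualityMap Ω D ψ‖ = ‖ψ‖ := by
  refine le_antisymm (ContinuousLinearMap.opNorm_le_bound _ (norm_nonneg _) fun φ => ?_) ?_
  · rw [dualityMap_apply, mul_comm]
    exact norm_inner_le_norm _ _
  · rcases (norm_nonneg ψ).eq_or_lt with h | h
    · rw [← h]; exact norm_nonneg _
    · have h1 := (dualityMap Ω D ψ).le_opNorm ψ
      rw [dualityMap_apply, inner_self_eq_norm_sq_to_K, norm_pow, RCLike.norm_ofReal,
        abs_of_nonneg (norm_nonneg ψ), sq] at h1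
      exact le_of_mul_le_mul_right h1 h

/-- Riesz representation, applied to the conjugate of the antilinear functional. -/
lemma dualityMap_surjective : Function.Surjective (dualityMap Ω D) := fun F => by
  let G : W Ω D →L[ℂ] ℂ :=
    { toFun := fun φ => conj (F φ)
      map_add' := fun φ ψ => by rw [map_add, map_add]
      map_smul' := fun c φ => by
        rw [map_smulₛₗ, smul_eq_mul, map_mul, RingHom.id_apply, Complex.conj_conj, smul_eq_mul]
      cont := Complex.continuous_conj.comp F.continuous }
  refine ⟨(InnerProductSpace.toDual ℂ (W Ω D)).symm G, ?_⟩
  ext φ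
  have h : ⟪(InnerProductSpace.toDual ℂ (W Ω D)).symm G, φ⟫_ℂ = conj (F φ) :=
    InnerProductSpace.toDual_symm_apply
  rw [dualityMap_apply, ← inner_conj_symm, h, Complex.conj_conj]

/-- The duality map as an isometric isomorphism. -/
def dualityEquiv (Ω D : Set (Pt d)) : W Ω D ≃ₗᵢ[ℂ] WDual Ω D :=
  LinearIsometryEquiv.ofSurjective ⟨(dualityMap Ω D : W Ω D →ₗ[ℂ] WDual Ω D), norm_dualityMap⟩
    dualityMap_surjective

lemma coe_dualityEquiv :
    ((dualityEquiv Ω D : W Ω D ≃ₗᵢ[ℂ] WDual Ω D) : W Ω D →L[ℂ] WDual Ω D) = dualityMap Ω D := by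
  ext; rfl

lemma inner_dualityEquiv_symm (F : WDual Ω D) (φ : W Ω D) :
    ⟪φ, (dualityEquiv Ω D).symm F⟫_ℂ = F φ := by
  have := (dualityEquiv Ω D).apply_symm_apply F
  exact congrArg (fun G : WDual Ω D => G φ) this

instance : CompleteSpace (WDual Ω D) :=
  (dualityEquiv Ω D).toIsometryEquiv.completeSpace_iff.1 inferInstance

/-- The form of `𝒥⁻¹ ∘ embed` in `W` is the `L²` scalar product, which is symmetric and nonnegative.
-/
lemma isPositive_symm_comp_embed :
    (((dualityEquiv Ω D).symm : WDual Ω D →L[ℂ] W Ω D).comp (embed Ω D)).IsPositive := by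
  have key : ∀ φ ψ : W Ω D, ⟪φ, (((dualityEquiv Ω D).symm : WDual Ω D →L[ℂ] W Ω D).comp
      (embed Ω D)) ψ⟫_ℂ = ⟪toL2 Ω D φ, toL2 Ω D ψ⟫_ℂ := fun φ ψ => inner_dualityEquiv_symm _ φ
  refine ⟨fun φ ψ => ?_, fun ψ => ?_⟩
  · refine Eq.trans ?_ (key φ ψ).symm
    rw [← inner_conj_symm]
    refine (congrArg conj (key ψ φ)).trans ?_
    rw [inner_conj_symm]
  · rw [ContinuousLinearMap.reApplyInnerSelf_apply, inner_re_symm, key, inner_self_eq_norm_sq]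
    positivity

/-- Integration by parts against real test functions supported in `Ω`. -/
lemma integral_wgrad_eq_zero {ψ : W Ω D} (hψ : toL2 Ω D ψ = 0) {g : Pt d → ℝ}
    (hg : ContDiff ℝ ∞ g) (hc : HasCompactSupport g) (hs : tsupport g ⊆ Ω) (i : Fin d) :
    ∫ x in Ω, (g x : ℂ) * wgrad Ω D ψ x i = 0 := by
  set v : Pt d := EuclideanSpace.single i 1 with hv
  set gc : Pt d → ℂ := fun x => (g x : ℂ) with hgc
  have hgc1 : ContDiff ℝ ∞ gc := Complex.ofRealCLM.contDiff.comp hg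
  have hgc2 : HasCompactSupport gc := hc.comp_left (g := ((↑) : ℝ → ℂ)) Complex.ofReal_zero
  have hgcs : tsupport gc ⊆ Ω := (tsupport_comp_subset Complex.ofReal_zero g).trans hs
  have hdc : Continuous fun x => fderiv ℝ gc x v :=
    (hgc1.continuous_fderiv (by simp)).clm_apply continuous_const
  have hdcs : tsupport (fun x => fderiv ℝ gc x v) ⊆ tsupport gc :=
    tsupport_fderiv_apply_subset ℝ v
  have hdc2 : HasCompactSupport fun x => fderiv ℝ gc x v := hgc2.fderiv_apply ℝ v
  have hG : Continuous fun x => (EuclideanSpace.single i (gc x) : Vec d) :=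
    (PiLp.continuous_toLp 2 (fun _ : Fin d => ℂ)).comp
      ((continuous_single i).comp hgc1.continuous)
  have hG2 : HasCompactSupport fun x => (EuclideanSpace.single i (gc x) : Vec d) :=
    hgc2.comp_left (g := fun z : ℂ => (EuclideanSpace.single i z : Vec d)) (by simp)
  have mG : MemLp (fun x => (EuclideanSpace.single i (gc x) : Vec d)) 2 (volume.restrict Ω) :=
    hG.memLp_of_hasCompactSupport hG2
  have mH : MemLp (fun x => conj (fderiv ℝ gc x v)) 2 (volume.restrict Ω) :=
    (Complex.continuous_conj.comp hdc).memLp_of_hasCompactSupport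
      (hdc2.comp_left (g := conj) (map_zero _))
  -- The integration by parts identity is a closed condition on pairs in `L²`; it holds for smooth
  -- pairs and so passes to their closure.
  have hclosed : IsClosed {p : L2Pair Ω | ⟪mG.toLp, p.snd⟫_ℂ + ⟪mH.toLp, p.fst⟫_ℂ = 0} := by
    refine isClosed_eq ?_ continuous_const
    exact (continuous_const.inner (WithLp.sndL 2 ℂ _ _).continuous).add
      (continuous_const.inner (WithLp.fstL 2 ℂ _ _).continuous)
  have hG3 : ∀ (x : Pt d) (w : Vec d), ⟪(EuclideanSpace.single i (gc x) : Vec d), w⟫_ℂ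
      = gc x * w i := fun x w => by
    rw [EuclideanSpace.inner_single_left, Complex.conj_ofReal]
  have hsub : (testPairs Ω D : Set (L2Pair Ω))
      ⊆ {p : L2Pair Ω | ⟪mG.toLp, p.snd⟫_ℂ + ⟪mH.toLp, p.fst⟫_ℂ = 0} := by
    rintro p ⟨f, hf, h1, h2⟩
    have hdf : Continuous fun x => fderiv ℝ f x v :=
      (hf.smooth.continuous_fderiv (by simp)).clm_apply continuous_const
    have e1 : ⟪mG.toLp, p.snd⟫_ℂ = ∫ x, gc x * fderiv ℝ f x v := by
      rw [L2.inner_def, ← setIntegral_eq_integral_of_forall_compl_eq_zero (s := Ω)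
        (f := fun x => gc x * fderiv ℝ f x v)]
      · refine integral_congr_ae ?_
        filter_upwards [mG.coeFn_toLp, h2] with x k1 k2
        rw [k1, k2, hG3]
        rfl
      · intro x hx
        rw [image_eq_zero_of_notMem_tsupport fun h => hx (hgcs h), zero_mul]
    have e2 : ⟪mH.toLp, p.fst⟫_ℂ = ∫ x, fderiv ℝ gc x v * f x := by
      rw [L2.inner_def, ← setIntegral_eq_integral_of_forall_compl_eq_zero (s := Ω)
        (f := fun x => fderiv ℝ gc x v * f x)]
      · refine integral_congr_ae ?_
        filter_upwards [mH.coeFn_toLp, h1] with x k1 k2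
        rw [k1, k2, RCLike.inner_apply, Complex.conj_conj, mul_comm]
      · intro x hx
        rw [image_eq_zero_of_notMem_tsupport (f := fun x => fderiv ℝ gc x v)
          fun h => hx (hgcs (hdcs h)), zero_mul]
    rw [mem_ofPred_eq, e1, e2, integral_mul_fderiv_eq_neg_fderiv_mul_of_integrable, neg_add_cancel]
    · exact (hdc.mul hf.smooth.continuous).integrable_of_hasCompactSupport hdc2.mul_right
    · exact (hgc1.continuous.mul hdf).integrable_of_hasCompactSupport hgc2.mul_right
    · exact (hgc1.continuous.mul hf.smooth.continuous).integrable_of_hasCompactSupport hgc2.mul_right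
    · exact fun x _ => hgc1.differentiable (by simp) x
    · exact fun x _ => hf.smooth.differentiable (by simp) x
  have hmem : toPair Ω D ψ ∈ {p : L2Pair Ω | ⟪mG.toLp, p.snd⟫_ℂ + ⟪mH.toLp, p.fst⟫_ℂ = 0} :=
    closure_minimal hsub hclosed ψ.2
  have h0 : ⟪mG.toLp, wgrad Ω D ψ⟫_ℂ + ⟪mH.toLp, toL2 Ω D ψ⟫_ℂ = 0 := hmem
  rw [hψ, inner_zero_right, add_zero, L2.inner_def] at h0
  rw [← h0]
  refine integral_congr_ae ?_
  filter_upwards [mG.coeFn_toLp] with x k1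
  rw [k1, hG3]

/-- Elements of `W` are limits of pairs, so the function must be shown to determine the gradient
component. If the function is zero, the gradient annihilates all test functions in the open set `Ω`
and hence vanishes. -/
lemma embed_injective (hΩ : IsOpen Ω) : Function.Injective (embed Ω D) := by
  refine (injective_iff_map_eq_zero _).2 fun ψ hψ => ?_
  have h1 : toL2 Ω D ψ = 0 := by
    have := embed_apply ψ ψ
    rw [hψ] at this
    exact inner_self_eq_zero.1 this.symm
  have h2 : wgrad Ω D ψ = 0 := by
    have hloc : ∀ i, LocallyIntegrableOn (fun x => wgrad Ω D ψ x i) Ω := fun i => by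
      have hL2 : MemLp (fun x => wgrad Ω D ψ x i) 2 (volume.restrict Ω) :=
        (EuclideanSpace.proj (𝕜 := ℂ) i : Vec d →L[ℂ] ℂ).comp_memLp (wgrad Ω D ψ)
      rw [locallyIntegrableOn_iff hΩ.isLocallyClosed]
      intro k hk hkc
      have : IsFiniteMeasure (volume.restrict k : Measure (Pt d)) :=
        ⟨by simpa using hkc.measure_lt_top⟩
      exact (hL2.mono_measure (Measure.restrict_mono hk le_rfl)).integrable (by norm_num)
    have hae : ∀ i, ∀ᵐ x ∂(volume.restrict Ω), wgrad Ω D ψ x i = 0 := fun i => by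
      rw [ae_restrict_iff' hΩ.measurableSet]
      refine hΩ.ae_eq_zero_of_integral_contDiff_smul_eq_zero (hloc i) fun g hg hc hs => ?_
      rw [← integral_wgrad_eq_zero h1 hg hc hs i,
        ← setIntegral_eq_integral_of_forall_compl_eq_zero (s := Ω)]
      · rfl
      · intro x hx
        rw [image_eq_zero_of_notMem_tsupport fun h => hx (hs h), zero_smul]
    refine Lp.ext ?_
    filter_upwards [ae_all_iff.2 hae, Lp.coeFn_zero (Vec d) 2 (volume.restrict Ω)] with x k1 k2
    rw [k2]
    ext i
    exact k1 i
  have h3 := W.norm_sq_eq ψ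
  rw [h1, h2, norm_zero, norm_zero] at h3
  exact norm_eq_zero.1 (pow_eq_zero_iff two_ne_zero |>.1 (by rw [h3]; norm_num))

/-! ### The elliptic operators -/

variable {cl cu : ℝ}

lemma ellipticOp_apply (μ : Coeff Ω cl cu) (ψ φ : W Ω D) :
    ellipticOp D μ ψ φ = ⟪wgrad Ω D φ, (μ.memLp (wgrad Ω D ψ)).toLp⟫_ℂ :=
  μ.integral_eq_inner _ _

lemma symm_ellipticOp (μ : Coeff Ω cl cu) (ψ : W Ω D) :
    (dualityEquiv Ω D).symm (ellipticOp D μ ψ)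
      = (wgrad Ω D).adjoint (μ.memLp (wgrad Ω D ψ)).toLp := by
  refine ext_inner_left ℂ fun φ => ?_
  rw [inner_dualityEquiv_symm, ellipticOp_apply, ContinuousLinearMap.adjoint_inner_right]

/-- `cu ≥ 1` also covers the zeroth-order term; the function and gradient parts are then combined by
the Cauchy–Schwarz inequality in `ℝ²`. -/
lemma norm_symm_ellipticOp_add_embed_le (hcu : 1 ≤ cu) (μ : Coeff Ω cl cu) :
    ‖((dualityEquiv Ω D).symm : WDual Ω D →L[ℂ] W Ω D).comp (ellipticOp D μ + embed Ω D)‖ ≤ cu := by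
  refine ContinuousLinearMap.opNorm_le_bound _ (by linarith) fun ψ => ?_
  refine ((dualityEquiv Ω D).symm.norm_map _).trans_le ?_
  refine ContinuousLinearMap.opNorm_le_bound _ (by positivity) fun φ => ?_
  show ‖ellipticOp D μ ψ φ + ⟪toL2 Ω D φ, toL2 Ω D ψ⟫_ℂ‖ ≤ _
  have h1 : ‖ellipticOp D μ ψ φ‖ ≤ cu * ‖wgrad Ω D ψ‖ * ‖wgrad Ω D φ‖ :=
    (μ.integral_bound _ _).trans_eq (by rw [abs_of_nonneg (by linarith)])
  have h2 : ‖⟪toL2 Ω D φ, toL2 Ω D ψ⟫_ℂ‖ ≤ ‖toL2 Ω D φ‖ * ‖toL2 Ω D ψ‖ := norm_inner_le_norm _ _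
  refine (norm_add_le _ _).trans ((add_le_add h1 h2).trans ?_)
  have h3 := W.norm_sq_eq ψ
  have h4 := W.norm_sq_eq φ
  set a := ‖toL2 Ω D ψ‖
  set b := ‖wgrad Ω D ψ‖
  set a' := ‖toL2 Ω D φ‖
  set b' := ‖wgrad Ω D φ‖
  have h5 : a' * a + b * b' ≤ ‖ψ‖ * ‖φ‖ := by
    refine le_of_sq_le_sq ?_ (by positivity)
    rw [mul_pow, h3, h4]
    nlinarith [sq_nonneg (a * b' - a' * b)]
  have h6 : a' * a ≤ cu * (a' * a) := le_mul_of_one_le_left (by positivity) hcu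
  calc cu * b * b' + a' * a ≤ cu * (a' * a + b * b') := by linarith
    _ ≤ cu * (‖ψ‖ * ‖φ‖) := by gcongr
    _ = _ := by ring

lemma re_inner_toLp_ge (μ : Coeff Ω cl cu) (g : Lp (Vec d) 2 (volume.restrict Ω)) :
    cl * ‖g‖ ^ 2 ≤ RCLike.re ⟪g, (μ.memLp g).toLp⟫_ℂ := by
  have h1 : ‖g‖ ^ 2 = ∫ x in Ω, ‖g x‖ ^ 2 := by
    rw [← inner_self_eq_norm_sq (𝕜 := ℂ), L2.inner_def, ← integral_re (L2.integrable_inner g g)]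
    simp only [inner_self_eq_norm_sq]
  have i1 : Integrable (fun x => ‖g x‖ ^ 2) (volume.restrict Ω) := by
    have := (L2.integrable_inner (𝕜 := ℂ) g g).re
    simpa only [inner_self_eq_norm_sq] using this
  rw [h1, L2.inner_def, ← integral_re (L2.integrable_inner _ _), ← integral_const_mul]
  refine integral_mono_ae (i1.const_mul _) (L2.integrable_inner g (μ.memLp g).toLp).re ?_
  filter_upwards [μ.2.coercive, (μ.memLp g).coeFn_toLp] with x h2 h3
  rw [h3]
  exact h2 _

lemma re_inner_symm_ellipticOp_add_embed_ge (hcl1 : cl ≤ 1) (μ : Coeff Ω cl cu) (ψ : W Ω D) :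
    cl * ‖ψ‖ ^ 2 ≤ RCLike.re ⟪ψ, (dualityEquiv Ω D).symm ((ellipticOp D μ + embed Ω D) ψ)⟫_ℂ := by
  rw [inner_dualityEquiv_symm, add_apply, add_apply, embed_apply, ellipticOp_apply, map_add,
    inner_self_eq_norm_sq, W.norm_sq_eq]
  have := re_inner_toLp_ge μ (wgrad Ω D ψ)
  nlinarith [sq_nonneg ‖toL2 Ω D ψ‖]

/-- The elements of `L¹(Ω; ℝ^{d×d})` that are elliptic coefficient functions. -/
abbrev CoeffL1 (Ω : Set (Pt d)) (cl cu : ℝ) : Type :=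
  {M : Lp (Fin d → Fin d → ℝ) 1 (volume.restrict Ω) //
    ∃ μ : Coeff Ω cl cu, M =ᵐ[volume.restrict Ω] fun x i j => μ.1 x i j}

/-- Multiplication of a fixed vector field in `L²` by elliptic coefficient functions. -/
def coeffMul (g : Lp (Vec d) 2 (volume.restrict Ω)) (M : CoeffL1 Ω cl cu) :
    Lp (Vec d) 2 (volume.restrict Ω) :=
  (M.2.choose.memLp g).toLp

lemma coeffMul_eq (g : Lp (Vec d) 2 (volume.restrict Ω)) (M : CoeffL1 Ω cl cu) {μ : Coeff Ω cl cu}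
    (h : M.1 =ᵐ[volume.restrict Ω] fun x i j => μ.1 x i j) :
    coeffMul g M = (μ.memLp g).toLp := by
  refine MemLp.toLp_congr _ _ ?_
  filter_upwards [h, M.2.choose_spec] with x h1 h2
  have : M.2.choose.1 x = μ.1 x := h2.symm.trans h1
  rw [this]

lemma cplx_apply (M : Matrix (Fin d) (Fin d) ℝ) (v : Vec d) (i : Fin d) :
    cplx M v i = ∑ j, (M i j : ℂ) * v j := by
  simp [cplx, Matrix.mulVec, dotProduct]

lemma continuous_cplx (v : Vec d) : Continuous fun M : Fin d → Fin d → ℝ => cplx M v := by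
  have : (fun M : Fin d → Fin d → ℝ => cplx M v)
      = fun M => WithLp.toLp 2 fun i => ∑ j, (M i j : ℂ) * v j := by
    funext M; ext i; exact cplx_apply _ _ _
  rw [this]
  refine (PiLp.continuous_toLp 2 (fun _ : Fin d => ℂ)).comp ?_
  fun_prop

/-- An `L¹`-convergent sequence has an almost everywhere convergent subsequence, and the common
bound `cu` gives the majorant `(2cu)²‖g‖²` for dominated convergence. This is how `L¹`-measurability
of the coefficients becomes strong measurability of the operators. -/
lemma continuous_coeffMul (g : Lp (Vec d) 2 (volume.restrict Ω)) :
    Continuous (coeffMul g : CoeffL1 Ω cl cu → _) := by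
  rw [continuous_iff_seqContinuous]
  intro M M₀ hM
  refine Filter.tendsto_of_subseq_tendsto fun ns hns => ?_
  have h1 : Filter.Tendsto (fun n => (M (ns n)).1) Filter.atTop (nhds M₀.1) :=
    (continuous_subtype_val.tendsto _).comp (hM.comp hns)
  obtain ⟨ms, hms, hae⟩ := (tendstoInMeasure_of_tendsto_Lp h1).exists_seq_tendsto_ae
  refine ⟨ms, ?_⟩
  rw [tendsto_iff_norm_sub_tendsto_zero]
  obtain ⟨μ₀, hμ₀⟩ := M₀.2
  choose μ hμ using fun n => (M (ns (ms n))).2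
  set f : ℕ → Lp (Vec d) 2 (volume.restrict Ω) := fun n => coeffMul g (M (ns (ms n))) - coeffMul g M₀
    with hf
  have hfx : ∀ n, f n =ᵐ[volume.restrict Ω]
      fun x => cplx ((M (ns (ms n))).1 x) (g x) - cplx (M₀.1 x) (g x) := fun n => by
    have e1 := coeffMul_eq g _ (hμ n)
    have e2 := coeffMul_eq g _ hμ₀
    filter_upwards [Lp.coeFn_sub (coeffMul g (M (ns (ms n)))) (coeffMul g M₀),
      ((μ n).memLp g).coeFn_toLp, (μ₀.memLp g).coeFn_toLp, hμ n, hμ₀] with x k1 k2 k3 k4 k5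
    rw [hf]
    simp only []
    rw [k1, Pi.sub_apply, e1, e2, k2, k3, k4, k5]
  have hnorm : ∀ n, ‖f n‖ ^ 2 = ∫ x in Ω, ‖f n x‖ ^ 2 := fun n => by
    rw [← inner_self_eq_norm_sq (𝕜 := ℂ), L2.inner_def,
      ← integral_re (L2.integrable_inner (f n) (f n))]
    simp only [inner_self_eq_norm_sq]
  have ig : Integrable (fun x => (2 * cu) ^ 2 * ‖g x‖ ^ 2) (volume.restrict Ω) := by
    have := (L2.integrable_inner (𝕜 := ℂ) g g).re
    simp only [inner_self_eq_norm_sq] at this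
    exact this.const_mul _
  have hlim : Filter.Tendsto (fun n => ∫ x in Ω, ‖f n x‖ ^ 2) Filter.atTop
      (nhds (∫ x in Ω, (0 : ℝ))) := by
    refine tendsto_integral_of_dominated_convergence _
      (fun n => (Lp.aestronglyMeasurable (f n)).norm.pow 2) ig (fun n => ?_) ?_
    · filter_upwards [hfx n, hμ n, hμ₀, (μ n).2.bounded, μ₀.2.bounded] with x k1 k2 k3 k4 k5
      rw [Real.norm_of_nonneg (by positivity), ← mul_pow, k1, k2, k3]
      refine pow_le_pow_left₀ (norm_nonneg _) ((norm_sub_le _ _).trans ?_) 2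
      have := (cplx ((μ n).1 x)).le_of_opNorm_le k4 (g x)
      have := (cplx (μ₀.1 x)).le_of_opNorm_le k5 (g x)
      linarith
    · filter_upwards [hae, ae_all_iff.2 hfx] with x k1 k2
      have k3 : Filter.Tendsto (fun n => cplx ((M (ns (ms n))).1 x) (g x)) Filter.atTop
          (nhds (cplx (M₀.1 x) (g x))) := ((continuous_cplx (g x)).tendsto _).comp k1
      have k4 := ((tendsto_iff_norm_sub_tendsto_zero.1 k3).pow 2)
      rw [zero_pow two_ne_zero] at k4
      refine k4.congr fun n => ?_
      rw [k2 n]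
  rw [integral_zero] at hlim
  have h3 : Filter.Tendsto (fun n => Real.sqrt (‖f n‖ ^ 2)) Filter.atTop (nhds (Real.sqrt 0)) := by
    simp only [hnorm]
    exact (Real.continuous_sqrt.tendsto _).comp hlim
  rw [Real.sqrt_zero] at h3
  refine h3.congr fun n => Real.sqrt_sq (norm_nonneg _)

lemma aestronglyMeasurable_coeff_toLp {T : ℝ} (hT : 0 < T) {μ : ℝ → Coeff Ω cl cu}
    (hμ : L1Measurable T μ) (g : Lp (Vec d) 2 (volume.restrict Ω)) :
    AEStronglyMeasurable (fun t => ((μ t).memLp g).toLp) (volJ T) := by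
  obtain ⟨m, hm, hmeas⟩ := hμ
  have hmid : T / 2 ∈ Ioo 0 T := ⟨by linarith, by linarith⟩
  classical
  -- The values outside `J` must still be elliptic; the coefficient at the midpoint `T / 2` serves
  -- as default.
  let f : ℝ → CoeffL1 Ω cl cu := fun t =>
    if ht : t ∈ Ioo 0 T then ⟨m t, μ t, hm t ht⟩ else ⟨m (T / 2), μ (T / 2), hm _ hmid⟩
  have hf : AEStronglyMeasurable f (volJ T) := by
    rw [← Topology.IsEmbedding.subtypeVal.aestronglyMeasurable_comp_iff]
    refine hmeas.congr ?_
    filter_upwards [ae_restrict_mem measurableSet_Ioo] with t ht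
    simp only [f, dif_pos ht]
  refine ((continuous_coeffMul g).comp_aestronglyMeasurable hf).congr ?_
  filter_upwards [ae_restrict_mem measurableSet_Ioo] with t ht
  simp only [f, dif_pos ht]
  exact coeffMul_eq g _ (hm t ht)

lemma isCoerciveFamily_ellipticOp {T : ℝ} (hT : 0 < T) (hcl1 : cl ≤ 1) (hcu : 1 ≤ cu)
    {μ : ℝ → Coeff Ω cl cu} (hμ : L1Measurable T μ) :
    IsCoerciveFamily T cl cu fun t =>
      ((dualityEquiv Ω D).symm : WDual Ω D →L[ℂ] W Ω D).comp (ellipticOp D (μ t) + embed Ω D) where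
  measurable ψ := by
    have h1 := (wgrad Ω D).adjoint.continuous.comp_aestronglyMeasurable
      (aestronglyMeasurable_coeff_toLp hT hμ (wgrad Ω D ψ))
    refine (h1.add (aestronglyMeasurable_const
      (b := (dualityEquiv Ω D).symm (embed Ω D ψ)))).congr (Filter.Eventually.of_forall fun t => ?_)
    show (wgrad Ω D).adjoint _ + _ = (dualityEquiv Ω D).symm (ellipticOp D (μ t) ψ + embed Ω D ψ)
    rw [map_add, symm_ellipticOp]
  bounded t _ := norm_symm_ellipticOp_add_embed_le hcu (μ t)
  coercive t _ ψ := re_inner_symm_ellipticOp_add_embed_ge hcl1 (μ t) ψ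

end

/-! ### The constants -/

section

variable {d : ℕ} {Ω D : Set (Pt d)} {T cl cu : ℝ} {s r : Expo}

lemma constJ_nonneg : 0 ≤ constJ Ω D T s :=
  (norm_nonneg (refOp Ω D T s).inverse).trans (le_max_left _ _)

lemma kappa_mem (hcl : 0 < cl) (hcu : 0 < cu) :
    0 < kappa Ω D T cl cu s ∧ kappa Ω D T cl cu s ≤ 1 / 12 := by
  have hC := constJ_nonneg (Ω := Ω) (D := D) (T := T) (s := s)
  have h : 1 ≤ 1 + 2 * (1 + (1 + cl + cu) / cl) * max 1 cu * constJ Ω D T s := by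
    have : 0 ≤ 2 * (1 + (1 + cl + cu) / cl) * max 1 cu * constJ Ω D T s := by positivity
    linarith
  refine ⟨?_, ?_⟩
  · rw [kappa]; positivity
  · rw [kappa]
    have : 1 / (1 + 2 * (1 + (1 + cl + cu) / cl) * max 1 cu * constJ Ω D T s) ≤ 1 := by
      rw [div_le_one (by linarith)]; exact h
    linarith

lemma two_lt_rZero (hcl : 0 < cl) (hcu : 0 < cu) (hs : 2 < s.1) : 2 < rZero Ω D T cl cu s := by
  obtain ⟨h1, h2⟩ := kappa_mem (Ω := Ω) (D := D) (T := T) (s := s) hcl hcu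
  have h3 : 2 / s.1 < 1 := by rw [div_lt_one (by linarith)]; exact hs
  have h4 : 0 < 2 / s.1 := by have := s.2; positivity
  rw [rZero, lt_inv_comm₀ two_pos (by nlinarith)]
  nlinarith

/-- The interpolation parameter belonging to an exponent between `r₀'` and `r₀`. -/
lemma exists_interpolation_parameter {κ ρ : ℝ} (hs : 2 < s.1) (hκ0 : 0 < κ) (hκ : κ ≤ 1 / 12)
    (hρ : ρ = (1 / 2 - κ * (1 - 2 / s.1))⁻¹) (h1 : ρ.conjExponent < r.1) (h2 : r.1 < ρ) :
    ∃ θ : ℝ, 0 < θ ∧ θ < 1 ∧ 1 / r.1 = (1 - θ) / s.conj.1 + θ / s.1 ∧ |θ - 1 / 2| ≤ κ := by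
  have hs0 : 0 < s.1 := by linarith
  have hr0 : 0 < r.1 := by linarith [r.2]
  have hinv : 1 / s.conj.1 = 1 - 1 / s.1 := by
    have h : s.1 - 1 ≠ 0 := by linarith
    show 1 / (s.1 / (s.1 - 1)) = _
    field_simp
  set a := 1 / s.1 with ha
  have ha0 : 0 < a := by positivity
  have ha1 : a < 1 / 2 := one_div_lt_one_div_of_lt two_pos hs
  have e2 : 2 / s.1 = 2 * a := by rw [ha]; ring
  rw [e2] at hρ
  have hδ : 0 < 1 - 2 * a := by linarith
  have hq : 0 < 1 / 2 - κ * (1 - 2 * a) := by nlinarith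
  have hq2 : 1 / 2 - κ * (1 - 2 * a) < 1 / 2 := by nlinarith
  have hup : 1 / 2 - κ * (1 - 2 * a) < 1 / r.1 := by
    rw [lt_div_iff₀ hr0, mul_comm, ← lt_div_iff₀ hq, one_div, ← hρ]; exact h2
  have hlow : 1 / r.1 < 1 / 2 + κ * (1 - 2 * a) := by
    -- The reciprocals of `ρ` and its conjugate lie symmetrically about `1/2`.
    have hc : ρ.conjExponent = (1 / 2 + κ * (1 - 2 * a))⁻¹ := by
      rw [Real.conjExponent, hρ]
      have h5 : 1 / 2 + κ * (1 - 2 * a) ≠ 0 := by nlinarith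
      have h6 := hq.ne'
      rw [div_eq_iff]
      · generalize κ * (1 - 2 * a) = x at h5 h6 ⊢
        rw [eq_inv_mul_iff_mul_eq₀ h5]
        have h7 : (1 / 2 - x)⁻¹ * (1 / 2 - x) = 1 := inv_mul_cancel₀ h6
        linear_combination -h7
      · have : 2 < (1 / 2 - κ * (1 - 2 * a))⁻¹ := by
          rw [lt_inv_comm₀ two_pos hq]; linarith
        linarith
    rw [hc] at h1
    rw [one_div]
    exact inv_lt_of_inv_lt₀ (by nlinarith) h1
  -- The solution of `1/r = (1 - θ)(1 - a) + θ a` with `a = 1/s`. The range of `r` translates into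
  -- `|θ - 1/2| ≤ κ`.
  refine ⟨1 / 2 + (1 / 2 - 1 / r.1) / (1 - 2 * a), ?_⟩
  set η := (1 / 2 - 1 / r.1) / (1 - 2 * a) with hη
  have hη1 : η * (1 - 2 * a) = 1 / 2 - 1 / r.1 := div_mul_cancel₀ _ hδ.ne'
  have hη2 : |η| ≤ κ := by
    rw [abs_le]
    constructor
    · rw [hη, le_div_iff₀ hδ]; linarith
    · rw [hη, div_le_iff₀ hδ]; linarith
  obtain ⟨h6, h7⟩ := abs_le.1 hη2
  refine ⟨by linarith, by linarith, ?_, by rwa [add_sub_cancel_left]⟩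
  rw [div_eq_mul_one_div (1 - _) s.conj.1, hinv, div_eq_mul_one_div _ s.1, ← ha]
  linarith

end

end MaxReg

end

/-! ### The theorem for the elliptic operators -/

theorem theorem7p2 {d : ℕ} (hd : 2 ≤ d) (Ω D : Set (MaxReg.Pt d))
    (hΩ : IsOpen Ω) (hΩb : Bornology.IsBounded Ω)
    (hD : IsClosed D) (hDΩ : D ⊆ frontier Ω)
    (T : ℝ) (hT : 0 < T)
    (cl cu : ℝ) (hcl : 0 < cl) (hcl1 : cl ≤ 1) (hcu1 : 1 ≤ cu)
    (s : MaxReg.Expo) (hs : 2 < s.1) :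
    -- the operators in the definition of the constants are invertible
    (MaxReg.refOp Ω D T s).IsInvertible ∧ (MaxReg.refOp Ω D T s.conj).IsInvertible ∧
    2 < MaxReg.rZero Ω D T cl cu s ∧
    ∀ μ : ℝ → MaxReg.Coeff Ω cl cu, MaxReg.L1Measurable T μ →
    ∀ r : MaxReg.Expo, (MaxReg.rZero Ω D T cl cu s).conjExponent < r.1 →
      r.1 < MaxReg.rZero Ω D T cl cu s →
      MaxReg.HasMaximalRegularity (V := MaxReg.W Ω D) (X := MaxReg.WDual Ω D) T r (MaxReg.embed Ω D)
        (fun t => MaxReg.ellipticOp D (μ t) + MaxReg.embed Ω D) ∧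
      -- the norm of the inverse, for the norm `‖(∂/∂t + 𝒥) u‖` on the solution space
      ∀ (f : MaxReg.LJ T r (MaxReg.WDual Ω D)) (u : MaxReg.MRW Ω D T r),
        MaxReg.IsSolution (V := MaxReg.W Ω D) (X := MaxReg.WDual Ω D)
          (fun t => MaxReg.ellipticOp D (μ t) + MaxReg.embed Ω D) f u →
        ‖MaxReg.refOp Ω D T r u‖ ≤ 8 * ((1 + cl + cu) / cl) * ‖f‖ := by
  have hcu : 0 < cu := by linarith
  have hpos := MaxReg.isPositive_symm_comp_embed (Ω := Ω) (D := D)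
  have hinv : ∀ q : MaxReg.Expo, (MaxReg.refOp Ω D T q).IsInvertible := fun q => by
    have := MaxReg.parabolicOp_isInvertible (r := q) hpos hT
    rwa [MaxReg.coe_dualityEquiv] at this
  refine ⟨hinv s, hinv s.conj, MaxReg.two_lt_rZero hcl hcu hs, fun μ hμ r h1 h2 => ?_⟩
  obtain ⟨hκ0, hκ1⟩ := MaxReg.kappa_mem (Ω := Ω) (D := D) (T := T) (s := s) hcl hcu
  obtain ⟨θ, hθ0, hθ1, hθ, hκ⟩ := MaxReg.exists_interpolation_parameter hs hκ0 hκ1 rfl h1 h2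
  rw [MaxReg.kappa, max_eq_right hcu1] at hκ
  have := MaxReg.hasMaximalRegularity_of_coercive (r := r) (s := s)
    (C := MaxReg.constJ Ω D T s) hpos hT (MaxReg.embed_injective hΩ) hcl hcl1 hcu1
    (MaxReg.isCoerciveFamily_ellipticOp hT hcl1 hcu1 hμ)
    (by rw [MaxReg.coe_dualityEquiv]; exact le_max_left _ _)
    (by rw [MaxReg.coe_dualityEquiv]; exact le_max_right _ _) hθ0 hθ1 hθ hκ
  rwa [MaxReg.coe_dualityEquiv] at this
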